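/- Let $n_1,n_2,m_1,m_2$ be positive integers with $\gcd(n_1,n_2)=\gcd(m_1,m_2)=1$, let $\omega_1,\dots,\omega_4$ be nonzero real numbers with $n_1\omega_2=n_2\omega_1$, $m_1\omega_4=m_2\omega_3$ and $\omega_1,\omega_3$ linearly independent over $\mathbb Q$, and let $a_0,\dots,a_4\in\{1,-1\}$. On $\mathbb R^2\times\mathbb C^4$, with coordinates $(x_1,x_2,z_1,\dots,z_4)$, let $$L(x,z)=(x_2,0,-i\omega_1z_1,\dots,-i\omega_4z_4),\quad \phi(x,z)=(x_1,-x_2,\bar z_1,\dots,\bar z_4),\quad \psi(x,z)=(a_0x_1,-a_0x_2,a_1\bar z_1,\dots,a_4\bar z_4).$$ Let $\mathbf S=\Re\times\mathbf T^2$, $\Re\simeq(\mathbb R,+)$, act by $$(s,\theta_1,\theta_2)(x,z)=(x_1,\,sx_1+x_2,\,e^{in_1\theta_1}z_1,\,e^{in_2\theta_1}z_2,\,e^{im_1\theta_2}z_3,\,e^{im_2\theta_2}z_4),$$ and let $\Gamma=\mathbf S\rtimes(\mathbf Z_2^\phi\times\mathbf Z_2^\psi)$ ($\phi$ and $\psi$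 act on $\mathbf S$ by inversion), with the homomorphism $\sigma:\Gamma\to\{\pm1\}$ that is $1$ on $\mathbf S$ and $-1$ on $\phi$ and on $\psi$. Let $\mathcal P(\Gamma)$ be the ring of real $\Gamma$-invariant polynomial functions, and $\vec{\mathcal Q}_\sigma(\Gamma)$ the $\mathcal P(\Gamma)$-module of polynomial mappings $g$ of $\mathbb R^2\times\mathbb C^4$ to itself with $g(\gamma v)=\sigma(\gamma)\gamma g(v)$ for all $\gamma\in\Gamma$. Put $\varepsilon=a_1^{n_2}a_2^{n_1}$, $\delta=a_3^{m_2}a_4^{m_1}$, $u_5=\mathrm{Im}(z_1^{n_2}\bar z_2^{n_1})$, $u_9=\mathrm{Im}(z_3^{m_2}\bar z_4^{m_1})$, and $$v_1=x_1,\ v_2=|z_1|^2,\ v_3=|z_2|^2,\ v_4=\mathrm{Re}(z_1^{n_2}\bar z_2^{n_1}),\ v_5=|z_3|^2,\ v_6=|z_4|^2,\ v_7=\mathrm{Re}(z_3^{m_2}\bar z_4^{m_1}),\ v_8=u_5u_9.$$ Let $H_0=(x_1,x_2,0,0,0,0)$, $H_1=(0,1,0,0,0,0)$, and let $H_2,H_4$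 (resp. $H_6,H_8$; $H_{10},H_{12}$; $H_{14},H_{16}$) be the mappings whose only nonzero component is the one in $z_1$ (resp. $z_2$; $z_3$; $z_4$), equal to $z_1,\ \bar z_1^{n_2-1}z_2^{n_1}$ (resp. $z_2,\ z_1^{n_2}\bar z_2^{n_1-1}$; $z_3,\ \bar z_3^{m_2-1}z_4^{m_1}$; $z_4,\ z_3^{m_2}\bar z_4^{m_1-1}$). For $q=2,4,\dots,16$ let $H_{q+1}=iH_q$. **(1)** The following functions form a Hilbert basis of $\mathcal P(\Gamma)$ (i.e. a finite set generating it as an $\mathbb R$-algebra): $(1+a_0)v_1$, $v_2$, $v_3$, $(1+\varepsilon)v_4$, $v_5$, $v_6$, $(1+\delta)v_7$, $(1+\varepsilon\delta)v_8$, $(1-a_0)v_1^2$, $(1-\varepsilon)v_4^2$, $(1-\delta)v_7^2$, $(1-\varepsilon\delta)v_8^2$, $(1-a_0)(1-\varepsilon)v_1v_4$, $(1-a_0)(1-\delta)v_1v_7$, $(1-a_0)(1-\varepsilon\delta)v_1v_8$, $(1-\varepsilon)(1-\delta)v_4v_7$, $(1-\varepsilon)(1-\varepsilon\delta)v_4v_8$,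 $(1-\delta)(1-\varepsilon\delta)v_7v_8$. **(2)** $\vec{\mathcal Q}_\sigma(\Gamma)$ is generated over $\mathcal P(\Gamma)$ by the following mappings, where $i\in\{3,7,11,15\}$, $j\in\{0,2,6,10,14\}$, $k\in\{5,9\}$, $\ell\in\{13,17\}$, $r\in\{4,8\}$, $s\in\{12,16\}$: - $(1+a_0)H_1$, $H_i$, $(1+\varepsilon)H_k$, $(1+\delta)H_\ell$; - $(1-a_0)v_1H_1$, $(1-a_0)(1-\varepsilon)v_1H_k$, $(1-a_0)(1-\delta)v_1H_\ell$; - $(1-a_0)(1-\varepsilon)v_4H_1$, $(1-\varepsilon)v_4H_k$, $(1-\varepsilon)(1-\delta)v_4H_\ell$; - $(1-a_0)(1-\delta)v_7H_1$, $(1-\varepsilon)(1-\delta)v_7H_k$, $(1-\delta)v_7H_\ell$; - $(1-a_0)(1-\varepsilon\delta)v_8H_1$, $(1-\varepsilon)(1-\varepsilon\delta)v_8H_k$, $(1-\delta)(1-\varepsilon\delta)v_8H_\ell$; - $(1+\varepsilon)u_5H_j$, $u_5H_r$, $(1+\varepsilon\delta)u_5H_s$; - $(1-a_0)(1-\varepsilon)v_1u_5H_j$,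 $(1-a_0)(1-\varepsilon\delta)v_1u_5H_s$; - $(1-\varepsilon)v_4u_5H_j$, $(1-\varepsilon)(1-\varepsilon\delta)v_4u_5H_s$; - $(1-\varepsilon)(1-\delta)v_7u_5H_j$, $(1-\delta)(1-\varepsilon\delta)v_7u_5H_s$; - $(1-\varepsilon)(1-\varepsilon\delta)v_8u_5H_j$, $(1-\varepsilon\delta)v_8u_5H_s$; - $(1+\delta)u_9H_j$, $u_9H_s$, $(1+\varepsilon\delta)u_9H_r$; - $(1-a_0)(1-\delta)v_1u_9H_j$, $(1-a_0)(1-\varepsilon\delta)v_1u_9H_r$; - $(1-\varepsilon)(1-\delta)v_4u_9H_j$, $(1-\varepsilon)(1-\varepsilon\delta)v_4u_9H_r$; - $(1-\delta)v_7u_9H_j$, $(1-\delta)(1-\varepsilon\delta)v_7u_9H_r$; - $(1-\delta)(1-\varepsilon\delta)v_8u_9H_j$, $(1-\varepsilon\delta)v_8u_9H_r$. **(3)** Let $X$ be a $C^\infty$ vector field on $\mathbb R^2\times\mathbb C^4$ with $X(0)=0$, $(dX)_0=L$, $X\phi=-\phi X$ and $X\psi=-\psi X$. Then $\dot v=X(v)$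 is formally conjugate, by a formal change of coordinates tangent to the identity, to $$\dot v=Lv+g_2(v)+g_3(v)+\cdots,\qquad g_k=\sum_\nu q_{k,\nu}J_\nu,$$ where $J_\nu$ runs over the list in (2), each $q_{k,\nu}$ is a polynomial in the functions listed in (1), and each $q_{k,\nu}J_\nu$ is homogeneous of degree $k$. (Formally conjugate: the Taylor series at the origin are conjugate as formal vector fields.) -/

import Mathlib

namespace Bireversible

open scoped ComplexConjugate Topology

/-! ### Polynomial functions and mappings, invariants and reversible-equivariants -/

section General

/-- The ring of real polynomial functions on a real vector space: the algebra generated by the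
linear functionals. -/
def polyFun (V : Type*) [AddCommGroup V] [Module ℝ V] : Subalgebra ℝ (V → ℝ) :=
  Algebra.adjoin ℝ {f | ∃ l : V →ₗ[ℝ] ℝ, f = fun v => l v}

/-- A mapping `V → V` is polynomial if all its coordinates are polynomial functions. -/
def IsPolyMap {V : Type*} [AddCommGroup V] [Module ℝ V] (g : V → V) : Prop :=
  ∀ l : V →ₗ[ℝ] ℝ, (fun v => l (g v)) ∈ polyFun V

/-- Homogeneous polynomial mappings of degree `k`. -/
def IsHomogPoly {V : Type*} [AddCommGroup V] [Module ℝ V] (k : ℕ) (g : V → V) : Prop :=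
  IsPolyMap g ∧ ∀ (t : ℝ) (v : V), g (t • v) = t ^ k • g v

/-- The ring `P(Γ)` of invariant polynomial functions, for a linear action `ρ` of a group. -/
def invariantRing {G V : Type*} [Group G] [AddCommGroup V] [Module ℝ V]
    (ρ : G →* Module.End ℝ V) : Subalgebra ℝ (V → ℝ) where
  carrier := {f | f ∈ polyFun V ∧ ∀ γ v, f (ρ γ v) = f v}
  mul_mem' := by
    rintro f g ⟨hf, hf'⟩ ⟨hg, hg'⟩
    exact ⟨mul_mem hf hg, fun γ v => by simp [hf' γ v, hg' γ v]⟩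
  add_mem' := by
    rintro f g ⟨hf, hf'⟩ ⟨hg, hg'⟩
    exact ⟨add_mem hf hg, fun γ v => by simp [hf' γ v, hg' γ v]⟩
  algebraMap_mem' r := ⟨Subalgebra.algebraMap_mem _ r, fun _ _ => rfl⟩

/-- The module, over the ring `P(Γ)`, of `Γ`-reversible-equivariant polynomial mappings:
`g (γ v) = σ(γ) γ g(v)`. -/
def revEquivariants {G V : Type*} [Group G] [AddCommGroup V] [Module ℝ V]
    (ρ : G →* Module.End ℝ V) (σ : G →* ℤˣ) : Submodule (invariantRing ρ) (V → V) where
  carrier := {g | IsPolyMap g ∧ ∀ γ v, g (ρ γ v) = (((σ γ : ℤˣ) : ℤ) : ℝ) • ρ γ (g v)}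
  zero_mem' := ⟨fun l => by
    have e : (fun v => l ((0 : V → V) v)) = 0 := by funext v; simp
    rw [e]; exact zero_mem _, fun γ v => by simp⟩
  add_mem' := by
    rintro f g ⟨hf, hf'⟩ ⟨hg, hg'⟩
    refine ⟨fun l => ?_, fun γ v => by simp [hf' γ v, hg' γ v]⟩
    have h := add_mem (hf l) (hg l)
    have e : (fun v => l ((f + g) v)) = (fun v => l (f v)) + fun v => l (g v) := by
      funext v; simp
    rw [e]; exact h
  smul_mem' := by
    rintro ⟨p, hp, hp'⟩ g ⟨hg, hg'⟩
    refine ⟨fun l => ?_, fun γ v => ?_⟩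
    · have h := mul_mem hp (hg l)
      have e : (fun v => l (((⟨p, hp, hp'⟩ : invariantRing ρ) • g) v))
          = p * fun v => l (g v) := by
        funext v
        change l (p v • g v) = p v * l (g v)
        simp
      rw [e]; exact h
    · change p (ρ γ v) • g (ρ γ v) = _ • ρ γ (p v • g v)
      rw [hp' γ v, hg' γ v, map_smul, smul_comm]

/-- The homomorphism from `Z₂ = {1, -1}` determined by an involution. -/
def involutionHom {M : Type*} [Monoid M] (τ : M) (h : τ * τ = 1) : ℤˣ →* M where
  toFun e := if e = 1 then 1 else τ
  map_one' := by simp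
  map_mul' a b := by
    rcases Int.units_eq_one_or a with rfl | rfl <;> rcases Int.units_eq_one_or b with rfl | rfl <;>
      simp [h]

/-- A smooth vector field `X` near the origin is formally conjugate to the formal vector field
`∑ₖ Y k` (with `Y k` homogeneous polynomial of degree `k`): there is a formal change of coordinates
`Φ = id + Φ₂ + Φ₃ + ⋯` with `DΦ(y) Y(y) = X(Φ(y))` as formal power series at `0`.
The last identity is expressed by saying that the two sides have the same Taylor polynomial of
every degree `N`; terms of `Φ` and `Y` of degree greater than `N` do not contribute to it. -/
def FormallyConjugate {V : Type*} [NormedAddCommGroup V] [NormedSpace ℝ V]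
    (X : V → V) (Y : ℕ → V → V) : Prop :=
  (∀ k, IsHomogPoly k (Y k)) ∧
  ∃ Φ : ℕ → V → V, (∀ k, IsHomogPoly k (Φ k)) ∧ Φ 0 = 0 ∧ Φ 1 = id ∧
    ∀ N : ℕ, Asymptotics.IsLittleO (𝓝 (0 : V))
      (fun y => fderiv ℝ (∑ k ∈ Finset.range (N + 1), Φ k) y
            ((∑ k ∈ Finset.range (N + 1), Y k) y)
          - X ((∑ k ∈ Finset.range (N + 1), Φ k) y))
      (fun y => ‖y‖ ^ N)

/-- The formal vector field `L + g 2 + g 3 + ⋯`. -/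
def formalField {V : Type*} [AddCommGroup V] (L : V → V) (g : ℕ → V → V) : ℕ → V → V
  | 0 => 0
  | 1 => L
  | k + 2 => g (k + 2)

end General

/-! ### The space `ℝ² × ℂ⁴`, the linear part and the group -/

/-- `ℝ² × ℂ⁴`; the coordinates `x₁, x₂` are `v.1 0, v.1 1` and `z₁, …, z₄` are
`v.2 0, …, v.2 3`. -/
abbrev E : Type := (Fin 2 → ℝ) × (Fin 4 → ℂ)

/-- The linear part `L (x₁, x₂, z) = (x₂, 0, -i ω₁ z₁, …, -i ω₄ z₄)`, i.e. the block diagonal matrix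
with blocks `(0 1; 0 0)` and `(0 ωⱼ; -ωⱼ 0)`. -/
noncomputable def linPart (ω : Fin 4 → ℝ) : E →ₗ[ℝ] E where
  toFun v := (![v.1 1, 0], fun j => -(Complex.I * (ω j : ℂ) * v.2 j))
  map_add' v w := by
    ext j
    · fin_cases j <;> simp
    · simp; ring
  map_smul' t v := by
    ext j
    · fin_cases j <;> simp
    · simp; ring

/-- The involution `(x₁, x₂, z) ↦ (a₀ x₁, -a₀ x₂, a₁ z̄₁, …, a₄ z̄₄)`, where `aᵢ = ±1`. -/
noncomputable def psi (a : Fin 5 → ℤˣ) : Module.End ℝ E where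
  toFun v := (![((a 0 : ℤ) : ℝ) * v.1 0, -((a 0 : ℤ) : ℝ) * v.1 1],
    fun j => ((a j.succ : ℤ) : ℂ) * conj (v.2 j))
  map_add' v w := by
    ext j
    · fin_cases j <;> simp <;> ring
    · simp; ring
  map_smul' t v := by
    ext j
    · fin_cases j <;> simp <;> ring
    · simp; ring

/-- The involution `(x₁, x₂, z) ↦ (x₁, -x₂, z̄₁, …, z̄₄)`. -/
noncomputable def phi : Module.End ℝ E := psi 1

theorem psi_mul_psi (a : Fin 5 → ℤˣ) : psi a * psi a = 1 := by
  have h : ∀ i, (((a i : ℤˣ) : ℤ) : ℝ) * (((a i : ℤˣ) : ℤ) : ℝ) = 1 := fun i => by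
    rcases Int.units_eq_one_or (a i) with h | h <;> simp [h]
  have h' : ∀ i, (((a i : ℤˣ) : ℤ) : ℂ) * (((a i : ℤˣ) : ℤ) : ℂ) = 1 := fun i => by
    rcases Int.units_eq_one_or (a i) with h | h <;> simp [h]
  refine LinearMap.ext fun v => ?_
  ext j
  · fin_cases j <;> simp [psi, ← mul_assoc, h]
  · simp [psi, ← mul_assoc, h']

theorem psi_comm (a b : Fin 5 → ℤˣ) : Commute (psi a) (psi b) := by
  refine LinearMap.ext fun v => ?_
  ext j
  · fin_cases j <;> simp [psi] <;> ring
  · simp [psi]; ring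

/-- The group `S = ℜ × T²`. -/
abbrev S : Type := Multiplicative ℝ × (Circle × Circle)

/-- The element of `T⁴` by which `(θ₁, θ₂) ∈ T²` acts on `ℂ⁴`. -/
noncomputable def torusElt (n₁ n₂ m₁ m₂ : ℕ) : Circle × Circle →* (Fin 4 → Circle) where
  toFun θ := ![θ.1 ^ n₁, θ.1 ^ n₂, θ.2 ^ m₁, θ.2 ^ m₂]
  map_one' := by ext j; fin_cases j <;> simp
  map_mul' a b := by ext j; fin_cases j <;> simp [mul_pow]

/-- The action of `S = ℜ × T²` on `ℝ² × ℂ⁴`: `s ∈ ℜ` acts by `(x₁, x₂) ↦ (x₁, s x₁ + x₂)` and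
`(θ₁, θ₂)` by `(e^{i n₁ θ₁} z₁, e^{i n₂ θ₁} z₂, e^{i m₁ θ₂} z₃, e^{i m₂ θ₂} z₄)`. -/
noncomputable def repS (n₁ n₂ m₁ m₂ : ℕ) : S →* Module.End ℝ E where
  toFun g :=
    { toFun := fun v => (![v.1 0, g.1.toAdd * v.1 0 + v.1 1],
        fun j => (torusElt n₁ n₂ m₁ m₂ g.2 j : ℂ) * v.2 j)
      map_add' := fun v w => by
        ext j
        · fin_cases j <;> simp; ring
        · simp; ring
      map_smul' := fun t v => by
        ext j
        · fin_cases j <;> simp; ring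
        · simp; ring }
  map_one' := by
    refine LinearMap.ext fun v => ?_
    ext j
    · fin_cases j <;> simp
    · simp
  map_mul' g h := by
    refine LinearMap.ext fun v => ?_
    ext j
    · fin_cases j <;> simp; ring
    · simp; ring

/-- The action of `Z₂^φ × Z₂^ψ`, the generators `(-1, 1)` and `(1, -1)` acting by `φ` and `ψ`. -/
noncomputable def repZ (a : Fin 5 → ℤˣ) : ℤˣ × ℤˣ →* Module.End ℝ E :=
  MonoidHom.noncommCoprod (involutionHom phi (psi_mul_psi 1)) (involutionHom (psi a) (psi_mul_psi a))
    (by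
      intro x y
      have h : Commute phi (psi a) := psi_comm 1 a
      by_cases hx : x = 1 <;> by_cases hy : y = 1 <;> simp [involutionHom, hx, hy, h])

/-- `σ` on `Z₂^φ × Z₂^ψ`: the homomorphism with `σ(φ) = σ(ψ) = -1`. -/
def sigmaZ : ℤˣ × ℤˣ →* ℤˣ := MonoidHom.coprod (MonoidHom.id ℤˣ) (MonoidHom.id ℤˣ)

/-- The action of `Z₂^φ × Z₂^ψ` on `S` by automorphisms: `φ` and `ψ` both act by inversion. -/
noncomputable def conjS : ℤˣ × ℤˣ →* MulAut S :=
  (involutionHom (MulEquiv.inv S : MulAut S) (by ext1 g; exact inv_inv g)).comp sigmaZ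

/-- The group `S ⋊ (Z₂^φ × Z₂^ψ)`. -/
abbrev Gam : Type := S ⋊[conjS] (ℤˣ × ℤˣ)

/-- `σ` on `S ⋊ (Z₂^φ × Z₂^ψ)`: trivial on `S`, and `-1` on `φ` and on `ψ`. -/
noncomputable def sigma : Gam →* ℤˣ := sigmaZ.comp SemidirectProduct.rightHom

theorem psi_mul_repS (a : Fin 5 → ℤˣ) (n₁ n₂ m₁ m₂ : ℕ) (s : S) :
    psi a * repS n₁ n₂ m₁ m₂ s = repS n₁ n₂ m₁ m₂ s⁻¹ * psi a := by
  refine LinearMap.ext fun v => ?_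
  ext j
  · fin_cases j <;> simp [psi, repS]; ring
  · simp [psi, repS, ← Circle.coe_inv_eq_conj]; ring

theorem repZ_mul_repS (a : Fin 5 → ℤˣ) (n₁ n₂ m₁ m₂ : ℕ) (g : ℤˣ × ℤˣ) (s : S) :
    repZ a g * repS n₁ n₂ m₁ m₂ s = repS n₁ n₂ m₁ m₂ (conjS g s) * repZ a g := by
  obtain ⟨x, y⟩ := g
  have hψ := psi_mul_repS a n₁ n₂ m₁ m₂
  have hφ : ∀ s, phi * repS n₁ n₂ m₁ m₂ s = repS n₁ n₂ m₁ m₂ s⁻¹ * phi :=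
    psi_mul_repS 1 n₁ n₂ m₁ m₂
  rcases Int.units_eq_one_or x with rfl | rfl <;> rcases Int.units_eq_one_or y with rfl | rfl
  · simp [repZ, conjS, sigmaZ, involutionHom]
  · simp [repZ, conjS, sigmaZ, involutionHom, hψ]
  · simp [repZ, conjS, sigmaZ, involutionHom, hφ]
  · simp [repZ, conjS, sigmaZ, involutionHom]
    rw [mul_assoc, hψ, ← mul_assoc, hφ, inv_inv, mul_assoc]

/-- The action `(s, γ) v = s (γ v)` of `S ⋊ (Z₂^φ × Z₂^ψ)` on `ℝ² × ℂ⁴`. -/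
noncomputable def rep (a : Fin 5 → ℤˣ) (n₁ n₂ m₁ m₂ : ℕ) : Gam →* Module.End ℝ E where
  toFun g := repS n₁ n₂ m₁ m₂ g.left * repZ a g.right
  map_one' := by simp
  map_mul' g h := by
    simp only [SemidirectProduct.mul_left, SemidirectProduct.mul_right, map_mul]
    rw [mul_assoc, ← mul_assoc (repS _ _ _ _ (conjS g.right h.left)), ← repZ_mul_repS]
    simp only [mul_assoc]

/-! ### The explicit lists of generators -/

/-- The `S`-invariants `u₁, …, u₉`. -/
noncomputable def u (n₁ n₂ m₁ m₂ : ℕ) : ℕ → E → ℝ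
  | 1 => fun v => v.1 0
  | 2 => fun v => Complex.normSq (v.2 0)
  | 3 => fun v => Complex.normSq (v.2 1)
  | 4 => fun v => (v.2 0 ^ n₂ * conj (v.2 1) ^ n₁).re
  | 5 => fun v => (v.2 0 ^ n₂ * conj (v.2 1) ^ n₁).im
  | 6 => fun v => Complex.normSq (v.2 2)
  | 7 => fun v => Complex.normSq (v.2 3)
  | 8 => fun v => (v.2 2 ^ m₂ * conj (v.2 3) ^ m₁).re
  | 9 => fun v => (v.2 2 ^ m₂ * conj (v.2 3) ^ m₁).im
  | _ => 0

/-- The `S ⋊ Z₂^φ`-invariants `v₁, …, v₈`. -/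
noncomputable def w (n₁ n₂ m₁ m₂ : ℕ) : ℕ → E → ℝ
  | 1 => u n₁ n₂ m₁ m₂ 1
  | 2 => u n₁ n₂ m₁ m₂ 2
  | 3 => u n₁ n₂ m₁ m₂ 3
  | 4 => u n₁ n₂ m₁ m₂ 4
  | 5 => u n₁ n₂ m₁ m₂ 6
  | 6 => u n₁ n₂ m₁ m₂ 7
  | 7 => u n₁ n₂ m₁ m₂ 8
  | 8 => u n₁ n₂ m₁ m₂ 5 * u n₁ n₂ m₁ m₂ 9
  | _ => 0

/-- The `S`-equivariants `H₀, …, H₁₇`. -/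
noncomputable def H (n₁ n₂ m₁ m₂ : ℕ) : ℕ → E → E
  | 0 => fun v => (v.1, 0)
  | 1 => fun _ => (![0, 1], 0)
  | 2 => fun v => (0, ![v.2 0, 0, 0, 0])
  | 3 => fun v => (0, ![Complex.I * v.2 0, 0, 0, 0])
  | 4 => fun v => (0, ![conj (v.2 0) ^ (n₂ - 1) * v.2 1 ^ n₁, 0, 0, 0])
  | 5 => fun v => (0, ![Complex.I * (conj (v.2 0) ^ (n₂ - 1) * v.2 1 ^ n₁), 0, 0, 0])
  | 6 => fun v => (0, ![0, v.2 1, 0, 0])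
  | 7 => fun v => (0, ![0, Complex.I * v.2 1, 0, 0])
  | 8 => fun v => (0, ![0, v.2 0 ^ n₂ * conj (v.2 1) ^ (n₁ - 1), 0, 0])
  | 9 => fun v => (0, ![0, Complex.I * (v.2 0 ^ n₂ * conj (v.2 1) ^ (n₁ - 1)), 0, 0])
  | 10 => fun v => (0, ![0, 0, v.2 2, 0])
  | 11 => fun v => (0, ![0, 0, Complex.I * v.2 2, 0])
  | 12 => fun v => (0, ![0, 0, conj (v.2 2) ^ (m₂ - 1) * v.2 3 ^ m₁, 0])
  | 13 => fun v => (0, ![0, 0, Complex.I * (conj (v.2 2) ^ (m₂ - 1) * v.2 3 ^ m₁), 0])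
  | 14 => fun v => (0, ![0, 0, 0, v.2 3])
  | 15 => fun v => (0, ![0, 0, 0, Complex.I * v.2 3])
  | 16 => fun v => (0, ![0, 0, 0, v.2 2 ^ m₂ * conj (v.2 3) ^ (m₁ - 1)])
  | 17 => fun v => (0, ![0, 0, 0, Complex.I * (v.2 2 ^ m₂ * conj (v.2 3) ^ (m₁ - 1))])
  | _ => 0

/-- `a₀` as a real number. -/
def al (a : Fin 5 → ℤˣ) : ℝ := ((a 0 : ℤ) : ℝ)

/-- `a₁^{n₂} a₂^{n₁}` as a real number. -/
def ep (a : Fin 5 → ℤˣ) (n₁ n₂ : ℕ) : ℝ := ((a 1 : ℤ) : ℝ) ^ n₂ * ((a 2 : ℤ) : ℝ) ^ n₁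

/-- `a₃^{m₂} a₄^{m₁}` as a real number. -/
def de (a : Fin 5 → ℤˣ) (m₁ m₂ : ℕ) : ℝ := ((a 3 : ℤ) : ℝ) ^ m₂ * ((a 4 : ℤ) : ℝ) ^ m₁

/-- The Hilbert basis of `P(S ⋊ (Z₂^φ × Z₂^ψ))`. -/
noncomputable def hilbertBasis (a : Fin 5 → ℤˣ) (n₁ n₂ m₁ m₂ : ℕ) : List (E → ℝ) :=
  let v := w n₁ n₂ m₁ m₂
  let α := al a
  let ε := ep a n₁ n₂
  let δ := de a m₁ m₂
  [ (1 + α) • v 1, v 2, v 3, (1 + ε) • v 4, v 5, v 6, (1 + δ) • v 7, (1 + ε * δ) • v 8,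
    (1 - α) • v 1 ^ 2, (1 - ε) • v 4 ^ 2, (1 - δ) • v 7 ^ 2, (1 - ε * δ) • v 8 ^ 2,
    ((1 - α) * (1 - ε)) • (v 1 * v 4),
    ((1 - α) * (1 - δ)) • (v 1 * v 7),
    ((1 - α) * (1 - ε * δ)) • (v 1 * v 8),
    ((1 - ε) * (1 - δ)) • (v 4 * v 7),
    ((1 - ε) * (1 - ε * δ)) • (v 4 * v 8),
    ((1 - δ) * (1 - ε * δ)) • (v 7 * v 8) ]

/-- The rows of the list of generators of the reversible-equivariants: a row `(c, p, ks)` stands for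
the mappings `c p H_k` with `k ∈ ks`. -/
noncomputable def genRows (a : Fin 5 → ℤˣ) (n₁ n₂ m₁ m₂ : ℕ) : List (ℝ × (E → ℝ) × List ℕ) :=
  let v := w n₁ n₂ m₁ m₂
  let u₅ := u n₁ n₂ m₁ m₂ 5
  let u₉ := u n₁ n₂ m₁ m₂ 9
  let α := al a
  let ε := ep a n₁ n₂
  let δ := de a m₁ m₂
  let is := [3, 7, 11, 15]
  let js := [0, 2, 6, 10, 14]
  let ks := [5, 9]
  let ls := [13, 17]
  let rs := [4, 8]
  let ss := [12, 16]
  [ (1 + α, 1, [1]), (1, 1, is), (1 + ε, 1, ks), (1 + δ, 1, ls),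
    (1 - α, v 1, [1]),
    ((1 - α) * (1 - ε), v 1, ks),
    ((1 - α) * (1 - δ), v 1, ls),
    ((1 - α) * (1 - ε), v 4, [1]),
    (1 - ε, v 4, ks),
    ((1 - ε) * (1 - δ), v 4, ls),
    ((1 - α) * (1 - δ), v 7, [1]),
    ((1 - ε) * (1 - δ), v 7, ks),
    (1 - δ, v 7, ls),
    ((1 - α) * (1 - ε * δ), v 8, [1]),
    ((1 - ε) * (1 - ε * δ), v 8, ks),
    ((1 - δ) * (1 - ε * δ), v 8, ls),
    (1 + ε, u₅, js), (1, u₅, rs), (1 + ε * δ, u₅, ss),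
    ((1 - α) * (1 - ε), v 1 * u₅, js),
    ((1 - α) * (1 - ε * δ), v 1 * u₅, ss),
    (1 - ε, v 4 * u₅, js),
    ((1 - ε) * (1 - ε * δ), v 4 * u₅, ss),
    ((1 - ε) * (1 - δ), v 7 * u₅, js),
    ((1 - δ) * (1 - ε * δ), v 7 * u₅, ss),
    ((1 - ε) * (1 - ε * δ), v 8 * u₅, js),
    (1 - ε * δ, v 8 * u₅, ss),
    (1 + δ, u₉, js), (1, u₉, ss), (1 + ε * δ, u₉, rs),
    ((1 - α) * (1 - δ), v 1 * u₉, js),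
    ((1 - α) * (1 - ε * δ), v 1 * u₉, rs),
    ((1 - ε) * (1 - δ), v 4 * u₉, js),
    ((1 - ε) * (1 - ε * δ), v 4 * u₉, rs),
    (1 - δ, v 7 * u₉, js),
    ((1 - δ) * (1 - ε * δ), v 7 * u₉, rs),
    ((1 - δ) * (1 - ε * δ), v 8 * u₉, js),
    (1 - ε * δ, v 8 * u₉, rs) ]

/-- The generators `J̃` of the module of reversible-equivariants. -/
noncomputable def generators (a : Fin 5 → ℤˣ) (n₁ n₂ m₁ m₂ : ℕ) : List (E → E) :=
  (genRows a n₁ n₂ m₁ m₂).flatMap fun r =>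
    r.2.2.map fun k => fun x => (r.1 * r.2.1 x) • H n₁ n₂ m₁ m₂ k x

end Bireversible

/-! Write `L = N + D` with `N` nilpotent on the `x`-plane and `D` semisimple. The shears in `S` are
the maps `exp (s Nᵀ)`. The relations between the `ωⱼ` and the rational independence of `ω₁, ω₃` make
the flow of `D` dense in the torus `T²`. The density is used in arithmetic form: the `D`-frequency
of a monomial determines its `T²`-weight (`freq_eq_of_weight`, `weight_eq_of_eq`).

Invariants and equivariants of `S`. Shear invariance removes `x₂`, and independence of torus
characters leaves only monomials of one weight. Coprimality writes those of weight zero as products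
of `x₁`, the `|zⱼ|²` and the two resonant monomials with their conjugates. Hence the `S`-invariants
are polynomials in `u₁, …, u₉` (`mem_sRing_of_invariant`). A similar analysis by components, where
division by `x₁` handles the `x`-plane, yields `H₀, …, H₁₇` for the equivariants
(`mem_sModule_of_equivariant`).

Passing to `Γ`. Both `φ` and `ψ` act on these generators by signs. Since `u₅²`, `u₉²` and `u₅u₉` are
polynomials in the `v`'s, the `S`-invariants are spanned by `1, u₅, u₉` over the polynomials in the
`v`'s. These in turn split into a `ψ`-even part and multiples of those of `v₁, v₄, v₇, v₈` that `ψ`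
negates. Invariants are what survives both parities (`mem_hilbertAlgebra_of_invariant`). A
reversible-equivariant `g` equals one quarter of its image under the two operators `g ↦ g - φgφ` and
`g ↦ g - ψgψ`. On multiples of the `H_k` these operators produce exactly combinations of the listed
generators (`revSum_revSum_mem_genSpan`).

Normal form. An explicit computation on monomials shows that every homogeneous field is an
`S`-equivariant field plus an element of the image of `Φ ↦ DΦ·L - LΦ`
(`mem_solvable_of_isHomogPoly`). Averaging over `φ` and `ψ` makes `Φ` equivariant and the remaining
field reversible (`exists_averaged`). The conjugacy is then built degree by degree
(`IsPartialConjugacy.exists_succ`), and the module theorem is applied to each homogeneous term of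
the normal form. Since all the generators are homogeneous, the coefficients can be chosen so that
every term has the right degree (`mem_homogSpan`). -/

namespace Bireversible

open scoped ComplexConjugate Topology
open Filter Asymptotics

/-! ### Closure properties of polynomial and homogeneous polynomial maps. -/

section PolynomialMaps

variable {V : Type*} [AddCommGroup V] [Module ℝ V]

theorem linear_mem_polyFun (l : V →ₗ[ℝ] ℝ) : (fun v => l v) ∈ polyFun V :=
  Algebra.subset_adjoin ⟨l, rfl⟩

theorem polyFun_comp_linear {f : V → ℝ} (hf : f ∈ polyFun V) (A : V →ₗ[ℝ] V) :
    (fun v => f (A v)) ∈ polyFun V := by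
  induction hf using Algebra.adjoin_induction with
  | mem f hf =>
    obtain ⟨l, rfl⟩ := hf
    exact linear_mem_polyFun (l ∘ₗ A)
  | algebraMap r => exact Subalgebra.algebraMap_mem _ r
  | add f g _ _ hf hg => exact add_mem hf hg
  | mul f g _ _ hf hg => exact mul_mem hf hg

theorem IsPolyMap.add {f g : V → V} (hf : IsPolyMap f) (hg : IsPolyMap g) :
    IsPolyMap (fun v => f v + g v) := fun l => by
  simpa only [map_add] using! add_mem (hf l) (hg l)

theorem IsPolyMap.zero : IsPolyMap (fun _ : V => (0 : V)) := fun l => by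
  simpa only [map_zero] using! zero_mem (polyFun V)

theorem IsPolyMap.mul_smul {p : V → ℝ} {g : V → V} (hp : p ∈ polyFun V) (hg : IsPolyMap g) :
    IsPolyMap (fun v => p v • g v) := fun l => by
  simpa only [map_smul] using! mul_mem hp (hg l)

theorem IsPolyMap.linear_comp {g : V → V} (hg : IsPolyMap g) (A : V →ₗ[ℝ] V) :
    IsPolyMap (fun v => A (g v)) := fun l => hg (l ∘ₗ A)

theorem IsPolyMap.comp_linear {g : V → V} (hg : IsPolyMap g) (A : V →ₗ[ℝ] V) :
    IsPolyMap (fun v => g (A v)) := fun l => polyFun_comp_linear (hg l) A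

theorem IsPolyMap.linear (A : V →ₗ[ℝ] V) : IsPolyMap (fun v => A v) := fun l =>
  linear_mem_polyFun (l ∘ₗ A)

theorem IsHomogPoly.add {k : ℕ} {f g : V → V} (hf : IsHomogPoly k f) (hg : IsHomogPoly k g) :
    IsHomogPoly k (fun v => f v + g v) :=
  ⟨hf.1.add hg.1, fun t v => by simp only [hf.2, hg.2, smul_add]⟩

theorem IsHomogPoly.zero (k : ℕ) : IsHomogPoly k (fun _ : V => (0 : V)) :=
  ⟨.zero, fun t v => by simp⟩

theorem IsHomogPoly.linear_comp {k : ℕ} {g : V → V} (hg : IsHomogPoly k g) (A : V →ₗ[ℝ] V) :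
    IsHomogPoly k (fun v => A (g v)) :=
  ⟨hg.1.linear_comp A, fun t v => by simp only [hg.2, map_smul]⟩

theorem IsHomogPoly.comp_linear {k : ℕ} {g : V → V} (hg : IsHomogPoly k g) (A : V →ₗ[ℝ] V) :
    IsHomogPoly k (fun v => g (A v)) :=
  ⟨hg.1.comp_linear A, fun t v => by simp only [hg.2, map_smul]⟩

theorem IsHomogPoly.const_smul {k : ℕ} {g : V → V} (hg : IsHomogPoly k g) (r : ℝ) :
    IsHomogPoly k (fun v => r • g v) :=
  hg.linear_comp (r • LinearMap.id)

theorem IsHomogPoly.sum {k : ℕ} {ι : Type*} (s : Finset ι) {g : ι → V → V}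
    (hg : ∀ i ∈ s, IsHomogPoly k (g i)) : IsHomogPoly k (∑ i ∈ s, g i) := by
  induction s using Finset.cons_induction with
  | empty => exact IsHomogPoly.zero k
  | cons a s ha ih =>
    rw [Finset.sum_cons]
    exact (hg a (by simp)).add (ih fun i hi => hg i (by simp [hi]))

/-- The diagonal of a multilinear map is a homogeneous polynomial map. -/
theorem isHomogPoly_multilinear [Module.Finite ℝ V] {k : ℕ}
    (m : MultilinearMap ℝ (fun _ : Fin k => V) V) : IsHomogPoly k (fun v => m fun _ => v) := by
  refine ⟨fun l => ?_, fun t v => ?_⟩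
  · classical
    let b := Module.finBasis ℝ V
    have e : (fun v => l (m fun _ => v)) = ∑ r : Fin k → Fin (Module.finrank ℝ V),
        (l (m fun i => b (r i))) • ∏ i, (fun v => b.coord (r i) v) := by
      funext v
      have h1 : (fun _ : Fin k => v) = fun _ => ∑ j, b.coord j v • b j := by
        funext _; exact (b.sum_repr v).symm
      rw [h1, m.map_sum, map_sum, Finset.sum_apply]
      refine Finset.sum_congr rfl fun r _ => ?_
      rw [m.map_smul_univ, map_smul, Pi.smul_apply, Finset.prod_apply]
      simp [mul_comm]
    rw [e]
    exact sum_mem fun r _ => Subalgebra.smul_mem _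
      (prod_mem fun i _ => linear_mem_polyFun (b.coord (r i))) _
  · have := m.map_smul_univ (fun _ => t) (fun _ => v)
    simpa using this

end PolynomialMaps

/-! ### Independence of characters and gradings. -/

section Grading

/-- Eigenfunctions for distinct characters are independent: an eigenfunction lying in a sum of
isotypic submodules lies in the corresponding summand. -/
theorem mem_of_mem_iSup_of_eigen {G V K ι : Type*} [MulOneClass G] [CommRing K] [IsDomain K]
    (ρ : G → V → V) (χ : ι → G →* K) (hχ : Function.Injective χ)
    {R : Type*} [Semiring R] [Module R K] (M : ι → Submodule R (V → K))
    (hM : ∀ i, ∀ f ∈ M i, ∀ g v, f (ρ g v) = χ i g * f v)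
    {j : ι} {f : V → K} (hf : f ∈ ⨆ i, M i) (hfj : ∀ g v, f (ρ g v) = χ j g * f v) :
    f ∈ M j := by
  classical
  obtain ⟨c, hc, rfl⟩ := (Submodule.mem_iSup_iff_exists_finsupp M f).1 hf
  set F := c.sum fun _ x => x with hF
  have key : ∀ v, F v = c j v := by
    intro v
    have hval : ∀ w, F w = ∑ i ∈ c.support, c i w := fun w => by
      rw [hF, Finsupp.sum, Finset.sum_apply]
    have hli := (linearIndependent_monoidHom G K).comp χ hχ
    rw [linearIndependent_iff'] at hli
    -- Dedekind independence at fixed `v`: the function `g ↦ F (ρ g v)` is both `∑ c i v • χ i` and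
    -- `F v • χ j`, so all coefficients of the difference vanish. The coefficient at `j` gives the
    -- claim.
    have := hli (insert j c.support) (fun i => c i v - if i = j then F v else 0) (by
      funext g
      simp only [Function.comp, Finset.sum_apply, Pi.smul_apply, smul_eq_mul, sub_mul, ite_mul,
        zero_mul, Finset.sum_sub_distrib, Finset.sum_ite_eq', Finset.mem_insert_self, if_true,
        Pi.zero_apply]
      have h1 : ∑ i ∈ insert j c.support, c i v * χ i g = ∑ i ∈ c.support, c i v * χ i g := by
        refine (Finset.sum_subset (Finset.subset_insert _ _) fun i _ hi => ?_).symm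
        simp [Finsupp.notMem_support_iff.1 hi]
      rw [h1, sub_eq_zero, mul_comm (F v), ← hfj, hval]
      exact Finset.sum_congr rfl fun i _ => by rw [hM i _ (hc i), mul_comm])
      j (Finset.mem_insert_self _ _)
    simp only [if_true] at this
    exact (sub_eq_zero.1 this).symm
  have : F = c j := funext key
  rw [this]; exact hc j

theorem powMonoidHom_injective : Function.Injective fun d : ℕ => (powMonoidHom d : ℝ →* ℝ) := by
  intro d e h
  have := DFunLike.congr_fun h (2 : ℝ)
  simp only [powMonoidHom_apply] at this
  exact Nat.pow_right_injective le_rfl (by exact_mod_cast this)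

end Grading

/-! ### Taylor expansion and growth of homogeneous maps at the origin. -/

section Analysis

variable {V : Type*} [NormedAddCommGroup V] [NormedSpace ℝ V]
  {W : Type*} [NormedAddCommGroup W] [NormedSpace ℝ W]

theorem contDiff_of_mem_polyFun [FiniteDimensional ℝ V] {f : V → ℝ} (hf : f ∈ polyFun V) :
    ContDiff ℝ (⊤ : ℕ∞) f := by
  induction hf using Algebra.adjoin_induction with
  | mem f hf =>
    obtain ⟨l, rfl⟩ := hf
    exact (LinearMap.toContinuousLinearMap l).contDiff
  | algebraMap r => exact contDiff_const
  | add f g _ _ hf hg => exact hf.add hg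
  | mul f g _ _ hf hg => exact hf.mul hg

theorem IsPolyMap.contDiff [FiniteDimensional ℝ V] {g : V → V} (hg : IsPolyMap g) :
    ContDiff ℝ (⊤ : ℕ∞) g := by
  let b := Module.finBasis ℝ V
  have : g = fun v => ∑ j, b.coord j (g v) • b j := funext fun v => (b.sum_repr (g v)).symm
  rw [this]
  exact ContDiff.sum fun j _ => (contDiff_of_mem_polyFun (hg (b.coord j))).smul contDiff_const

theorem IsPolyMap.differentiable [FiniteDimensional ℝ V] {g : V → V} (hg : IsPolyMap g) :
    Differentiable ℝ g :=
  hg.contDiff.differentiable (by simp)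

/-- A continuous positively homogeneous function of degree `k` is `O(‖y‖ ^ k)`. -/
theorem isBigO_of_homogeneous [FiniteDimensional ℝ V] {k : ℕ} {f : V → W} (hf : Continuous f)
    (h : ∀ t : ℝ, 0 < t → ∀ v, f (t • v) = t ^ k • f v) :
    f =O[𝓝 0] fun y => ‖y‖ ^ k := by
  obtain ⟨C, hC⟩ := (isCompact_closedBall (0 : V) 1).exists_bound_of_continuousOn hf.continuousOn
  refine IsBigO.of_bound C (Eventually.of_forall fun y => ?_)
  rw [norm_pow, norm_norm]
  rcases eq_or_ne y 0 with rfl | hy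
  · rcases Nat.eq_zero_or_pos k with rfl | hk
    · simpa using hC 0 (by simp)
    · have h2 := h 2 (by norm_num) 0
      rw [smul_zero] at h2
      have h3 : ((2 : ℝ) ^ k - 1) • f 0 = 0 := by rw [sub_smul, ← h2, one_smul, sub_self]
      have h4 : (2 : ℝ) ^ k - 1 ≠ 0 := by
        have := one_lt_pow₀ (by norm_num : (1 : ℝ) < 2) hk.ne'
        linarith
      rw [(smul_eq_zero.1 h3).resolve_left h4]
      simp [hk.ne']
  · have hy' : 0 < ‖y‖ := norm_pos_iff.2 hy
    have h1 : f y = ‖y‖ ^ k • f (‖y‖⁻¹ • y) := by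
      rw [← h _ hy', smul_smul, mul_inv_cancel₀ hy'.ne', one_smul]
    have h2 := hC (‖y‖⁻¹ • y) (by simp [norm_smul, hy'.ne'])
    rw [h1, norm_smul, norm_pow, norm_norm, mul_comm]
    gcongr

theorem IsHomogPoly.isBigO [FiniteDimensional ℝ V] {k : ℕ} {g : V → V} (hg : IsHomogPoly k g) :
    g =O[𝓝 0] fun y => ‖y‖ ^ k :=
  isBigO_of_homogeneous hg.1.contDiff.continuous fun t _ v => hg.2 t v

/-- Differentiating `g (t • v) = t ^ (k + 1) • g v` in `v` and cancelling one factor `t > 0` shows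
that the derivative is homogeneous of degree `k`, so the compactness bound applies to it. -/
theorem IsHomogPoly.fderiv_isBigO [FiniteDimensional ℝ V] {k : ℕ} {g : V → V}
    (hg : IsHomogPoly (k + 1) g) : fderiv ℝ g =O[𝓝 0] fun y => ‖y‖ ^ k := by
  refine isBigO_of_homogeneous (hg.1.contDiff.continuous_fderiv (by simp)) fun t ht v => ?_
  have h1 : fderiv ℝ (fun v => g (t • v)) v = t • fderiv ℝ g (t • v) := fderiv_comp_smul _
  have h2 : (fun v => g (t • v)) = fun v => t ^ (k + 1) • g v := funext (hg.2 t)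
  rw [h2, fderiv_fun_const_smul (hg.1.differentiable v), pow_succ', mul_smul] at h1
  exact (smul_right_injective _ ht.ne' h1).symm

/-- A homogeneous function of degree `k` which is `o(‖y‖ ^ k)` vanishes. -/
theorem eq_zero_of_isLittleO_of_homogeneous {k : ℕ} {f : V → W}
    (h : ∀ (t : ℝ) (v : V), f (t • v) = t ^ k • f v)
    (ho : f =o[𝓝 0] fun y => ‖y‖ ^ k) (v : V) : f v = 0 := by
  by_contra hv
  have hv' : 0 < ‖f v‖ := norm_pos_iff.2 hv
  have hc : 0 < ‖f v‖ / (2 * (‖v‖ ^ k + 1)) := by positivity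
  have h1 := ho.bound hc
  have h2 : Tendsto (fun t : ℝ => t • v) (𝓝[>] 0) (𝓝 0) := by
    have : Continuous fun t : ℝ => t • v := by fun_prop
    simpa using (this.tendsto 0).mono_left nhdsWithin_le_nhds
  obtain ⟨t, ht, ht0⟩ := ((h2.eventually h1).and self_mem_nhdsWithin).exists
  have ht0 : 0 < t := ht0
  rw [h, norm_smul, norm_pow, norm_pow, norm_norm, norm_smul, mul_pow, Real.norm_of_nonneg ht0.le,
    mul_left_comm] at ht
  have h3 := le_of_mul_le_mul_left ht (by positivity)
  rw [div_mul_eq_mul_div, le_div_iff₀ (by positivity)] at h3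
  have := pow_nonneg (norm_nonneg v) k
  nlinarith

theorem isBigO_norm_pow_of_le {V : Type*} [NormedAddCommGroup V] {m n : ℕ} (h : m ≤ n) :
    (fun y : V => ‖y‖ ^ n) =O[𝓝 0] fun y => ‖y‖ ^ m := by
  rcases h.eq_or_lt with rfl | h
  · exact isBigO_refl _ _
  · exact (isLittleO_norm_pow_norm_pow h).isBigO

/-- If a sum of homogeneous functions of degrees at most `k` is `o(‖y‖ ^ k)`, all of them vanish. -/
theorem eq_zero_of_sum_isLittleO (k : ℕ) {a : ℕ → V → W}
    (ha : ∀ i (t : ℝ) v, a i (t • v) = t ^ i • a i v)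
    (hO : ∀ i, a i =O[𝓝 0] fun y => ‖y‖ ^ i)
    (ho : (fun v => ∑ i ∈ Finset.range (k + 1), a i v) =o[𝓝 0] fun y => ‖y‖ ^ k) :
    ∀ i ≤ k, ∀ v, a i v = 0 := by
  intro i
  induction i using Nat.strong_induction_on with
  | _ i ih =>
    intro hi
    apply eq_zero_of_isLittleO_of_homogeneous (ha i)
    -- Lower terms vanish by induction, so `a i` is the full sum minus the terms of higher degree,
    -- and both are `o(‖y‖ ^ i)`.
    have h1 : a i = fun v => (∑ j ∈ Finset.range (k + 1), a j v)
        - ∑ j ∈ Finset.Ico (i + 1) (k + 1), a j v := by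
      funext v
      rw [eq_sub_iff_add_eq, Finset.range_eq_Ico,
        ← Finset.sum_Ico_consecutive _ (Nat.zero_le i) (by omega : i ≤ k + 1),
        Finset.sum_eq_zero (s := Finset.Ico 0 i), zero_add,
        Finset.sum_eq_sum_Ico_succ_bot (by omega : i < k + 1)]
      intro j hj
      rw [Finset.mem_Ico] at hj
      exact ih j hj.2 (by omega) v
    rw [h1]
    refine (ho.trans_isBigO (isBigO_norm_pow_of_le hi)).sub ?_
    refine IsLittleO.fun_sum fun j hj => ?_
    rw [Finset.mem_Ico] at hj
    exact (hO j).trans_isLittleO (isLittleO_norm_pow_norm_pow (by omega))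

/-- Integral form of the remainder. The derivative of order `n + 1` is bounded on the compact unit
ball, which contains the segment from `0` to `y` once `‖y‖ ≤ 1`. -/
theorem taylor_remainder_isBigO [FiniteDimensional ℝ V] [CompleteSpace W] {f : V → W}
    (hf : ContDiff ℝ (⊤ : ℕ∞) f) (n : ℕ) :
    (fun y => f y - ∑ k ∈ Finset.range (n + 1),
      ((k.factorial : ℝ)⁻¹) • iteratedFDeriv ℝ k f 0 (fun _ => y)) =O[𝓝 0]
      fun y => ‖y‖ ^ (n + 1) := by
  have hc : Continuous (iteratedFDeriv ℝ (n + 1) f) :=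
    hf.continuous_iteratedFDeriv (by exact_mod_cast le_top)
  obtain ⟨C, hC⟩ := (isCompact_closedBall (0 : V) 1).exists_bound_of_continuousOn hc.continuousOn
  have hC0 : 0 ≤ C := (norm_nonneg _).trans (hC 0 (by simp))
  refine IsBigO.of_bound ((n.factorial : ℝ)⁻¹ * C) ?_
  filter_upwards [Metric.closedBall_mem_nhds (0 : V) one_pos] with y hy
  have hT := map_add_eq_sum_add_integral_iteratedFDeriv (f := f) (x := 0) (y := y) (n := n)
    fun t _ => (hf.of_le (by exact_mod_cast le_top)).contDiffAt
  rw [zero_add] at hT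
  rw [hT, add_sub_cancel_left, norm_smul, norm_pow, norm_norm, mul_assoc, norm_inv,
    Real.norm_natCast]
  gcongr
  have := intervalIntegral.norm_integral_le_of_norm_le_const (a := 0) (b := 1)
    (f := fun t : ℝ => (1 - t) ^ n • iteratedFDeriv ℝ (n + 1) f (0 + t • y) fun _ => y)
    (C := C * ‖y‖ ^ (n + 1)) (by
      intro t ht
      rw [Set.uIoc_of_le zero_le_one] at ht
      have h1 : ‖(1 - t) ^ n‖ ≤ 1 := by
        rw [norm_pow, Real.norm_of_nonneg (by linarith [ht.2])]
        exact pow_le_one₀ (by linarith [ht.2]) (by linarith [ht.1])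
      have h2 : t • y ∈ Metric.closedBall (0 : V) 1 := by
        rw [mem_closedBall_zero_iff, norm_smul, Real.norm_of_nonneg ht.1.le]
        rw [mem_closedBall_zero_iff] at hy
        exact mul_le_one₀ ht.2 (norm_nonneg _) hy
      have h3 := (iteratedFDeriv ℝ (n + 1) f (0 + t • y)).le_opNorm fun _ => y
      rw [Finset.prod_const, Finset.card_univ, Fintype.card_fin] at h3
      rw [norm_smul]
      calc _ ≤ 1 * (‖iteratedFDeriv ℝ (n + 1) f (0 + t • y)‖ * ‖y‖ ^ (n + 1)) := by gcongr
        _ ≤ _ := by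
          rw [one_mul, zero_add]
          gcongr
          exact hC _ h2)
  simpa using this

/-- A smooth map which is `o(‖y‖ ^ k)` is homogeneous polynomial of degree `k + 1` up to
`o(‖y‖ ^ (k + 1))`. -/
theorem exists_leading_isHomogPoly [FiniteDimensional ℝ V] {k : ℕ} {f : V → V}
    (hf : ContDiff ℝ (⊤ : ℕ∞) f) (ho : f =o[𝓝 0] fun y => ‖y‖ ^ k) :
    ∃ R, IsHomogPoly (k + 1) R ∧ (fun y => f y - R y) =o[𝓝 0] fun y => ‖y‖ ^ (k + 1) := by
  have := FiniteDimensional.complete ℝ V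
  let a : ℕ → V → V := fun i y => ((i.factorial : ℝ)⁻¹) • iteratedFDeriv ℝ i f 0 (fun _ => y)
  have hom : ∀ i, IsHomogPoly i (a i) := fun i =>
    (isHomogPoly_multilinear (iteratedFDeriv ℝ i f 0).toMultilinearMap).const_smul _
  have h0 : ∀ i ≤ k, ∀ v, a i v = 0 := by
    refine eq_zero_of_sum_isLittleO k (fun i => (hom i).2) (fun i => (hom i).isBigO) ?_
    have := ho.sub ((taylor_remainder_isBigO hf k).trans_isLittleO
      (isLittleO_norm_pow_norm_pow k.lt_succ_self))
    simpa [a] using this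
  refine ⟨a (k + 1), hom _, ?_⟩
  have := (taylor_remainder_isBigO hf (k + 1)).trans_isLittleO
      (isLittleO_norm_pow_norm_pow (k + 1).lt_succ_self)
  refine this.congr_left fun y => ?_
  rw [Finset.sum_range_succ, Finset.sum_eq_zero, zero_add]
  intro i hi
  exact h0 i (by simpa [Nat.lt_succ_iff] using hi) y

end Analysis

/-! ### Degree-by-degree construction of a formal conjugacy. -/

section NormalForm

variable {V : Type*} [NormedAddCommGroup V] [NormedSpace ℝ V] [FiniteDimensional ℝ V]

/-- `G` solves the conjugation equation `DF G = X ∘ F` up to order `k`, where `F` is an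
equivariant near-identity polynomial map and `G` is a reversible polynomial field with
linear part `L`. -/
structure IsPartialConjugacy {ι : Type*} (X : V → V) (L : V →ₗ[ℝ] V) (τ : ι → V →ₗ[ℝ] V) (k : ℕ)
    (F G : V → V) : Prop where
  poly_left : IsPolyMap F
  poly_right : IsPolyMap G
  map_zero : F 0 = 0
  hasFDerivAt_left : HasFDerivAt F (ContinuousLinearMap.id ℝ V) 0
  hasFDerivAt_right : HasFDerivAt G (LinearMap.toContinuousLinearMap L) 0
  map_zero_right : G 0 = 0
  equivariant : ∀ i v, F (τ i v) = τ i (F v)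
  reversible : ∀ i v, G (τ i v) = -τ i (G v)
  isLittleO : (fun y => fderiv ℝ F y (G y) - X (F y)) =o[𝓝 0] fun y => ‖y‖ ^ k

theorem IsHomogPoly.hasFDerivAt_zero {k : ℕ} {g : V → V} (hg : IsHomogPoly (k + 2) g) :
    HasFDerivAt g (0 : V →L[ℝ] V) 0 := by
  have h0 : g 0 = 0 := by simpa using hg.2 0 0
  rw [hasFDerivAt_iff_isLittleO_nhds_zero]
  simp only [zero_add, h0, sub_zero, zero_apply]
  refine hg.isBigO.trans_isLittleO ?_
  exact ((isLittleO_norm_pow_norm_pow (E' := V) (by omega : 1 < k + 2)).congr_right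
    fun y => pow_one ‖y‖).of_norm_right

theorem fderiv_comp_linear {F : V → V} (hF : Differentiable ℝ F) (A : V →ₗ[ℝ] V) (v w : V) :
    fderiv ℝ (fun y => F (A y)) v w = fderiv ℝ F (A v) (A w) := by
  have h := (hF (A v)).hasFDerivAt.comp v (LinearMap.toContinuousLinearMap A).hasFDerivAt
  exact congrArg (fun T : V →L[ℝ] V => T w) h.fderiv


theorem fderiv_linear_comp {U W : Type*} [NormedAddCommGroup U] [NormedSpace ℝ U]
    [NormedAddCommGroup W] [NormedSpace ℝ W]
    [FiniteDimensional ℝ W]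
    {W' : Type*} [NormedAddCommGroup W'] [NormedSpace ℝ W'] {F : U → W}
    (hF : Differentiable ℝ F) (A : W →ₗ[ℝ] W') (v w : U) :
    fderiv ℝ (fun y => A (F y)) v w = A (fderiv ℝ F v w) := by
  have h := (LinearMap.toContinuousLinearMap A).hasFDerivAt.comp v (hF v).hasFDerivAt
  exact congrArg (fun T : U →L[ℝ] W' => T w) h.fderiv

/-- One step of the normalisation. The leading part `R`, of degree `k + 2`, of the residual `X ∘ F -
DF·G` is reversible. Solving `Y + DΦ·L - LΦ = R` and replacing `F, G` by `F + Φ, G + Y` removes it,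
and corrections of this degree do not disturb lower orders. Equivariance of `F` and reversibility of
`G` are carried along because they make the next residual reversible. -/
theorem IsPartialConjugacy.exists_succ {ι : Type*} {X : V → V} {L : V →ₗ[ℝ] V}
    {τ : ι → V →ₗ[ℝ] V} (hX : ContDiff ℝ (⊤ : ℕ∞) X)
    (hXL : HasFDerivAt X (LinearMap.toContinuousLinearMap L) 0)
    (hXτ : ∀ i v, X (τ i v) = -τ i (X v)) (N : ℕ → Set (V → V))
    (hN : ∀ k, ∀ Y ∈ N k, IsHomogPoly k Y ∧ ∀ i v, Y (τ i v) = -τ i (Y v))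
    (hsol : ∀ k R, IsHomogPoly k R → (∀ i v, R (τ i v) = -τ i (R v)) →
      ∃ Φ Y, IsHomogPoly k Φ ∧ (∀ i v, Φ (τ i v) = τ i (Φ v)) ∧ Y ∈ N k ∧
        ∀ v, Y v + fderiv ℝ Φ v (L v) - L (Φ v) = R v)
    {k : ℕ} {F G : V → V} (h : IsPartialConjugacy X L τ (k + 1) F G) :
    ∃ F' G', IsPartialConjugacy X L τ (k + 2) F' G' ∧
      IsHomogPoly (k + 2) (fun v => F' v - F v) ∧ (fun v => G' v - G v) ∈ N (k + 2) := by
  set f : V → V := fun y => X (F y) - fderiv ℝ F y (G y) with hf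
  have hfs : ContDiff ℝ (⊤ : ℕ∞) f :=
    (hX.comp h.poly_left.contDiff).sub
      ((h.poly_left.contDiff.fderiv_right (m := (⊤ : ℕ∞)) (by norm_cast)).clm_apply
        h.poly_right.contDiff)
  have hfo : f =o[𝓝 0] fun y => ‖y‖ ^ (k + 1) := by
    refine h.isLittleO.neg_left.congr_left fun y => ?_
    simp [hf]
  have hfτ : ∀ i v, f (τ i v) = -τ i (f v) := fun i v => by
    have h1 : fderiv ℝ F (τ i v) (τ i (G v)) = τ i (fderiv ℝ F v (G v)) := by
      rw [← fderiv_comp_linear h.poly_left.differentiable,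
        ← fderiv_linear_comp h.poly_left.differentiable]
      simp only [h.equivariant]
    simp only [hf, h.equivariant, hXτ, h.reversible, _root_.map_neg, h1, map_sub]
    abel
  clear_value f
  obtain ⟨R, hR, hRo⟩ := exists_leading_isHomogPoly hfs hfo
  -- The leading part inherits reversibility from `f`: the map `R ∘ τ + τ ∘ R` is homogeneous of
  -- degree `k + 2` and is also `o(‖y‖ ^ (k + 2))`, hence zero.
  have hRτ : ∀ i v, R (τ i v) = -τ i (R v) := fun i v => by
    rw [← sub_eq_zero, sub_neg_eq_add]
    refine eq_zero_of_isLittleO_of_homogeneous (k := k + 2)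
      (f := fun v => R (τ i v) + τ i (R v)) (fun t v => ?_) ?_ v
    · simp only [map_smul, hR.2, smul_add]
    · have e1 : (fun y => f (τ i y) - R (τ i y)) =o[𝓝 0] fun y => ‖y‖ ^ (k + 2) := by
        have ht : Tendsto (fun y => τ i y) (𝓝 0) (𝓝 0) := by
          simpa using (LinearMap.toContinuousLinearMap (τ i)).continuous.tendsto 0
        refine (hRo.comp_tendsto ht).trans_isBigO ?_
        have := ((LinearMap.toContinuousLinearMap (τ i)).isBigO_id (𝓝 0)).norm_norm.pow (k + 2)
        exact this
      have e2 : (fun y => τ i (f y - R y)) =o[𝓝 0] fun y => ‖y‖ ^ (k + 2) :=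
        ((LinearMap.toContinuousLinearMap (τ i)).isBigO_comp (fun y => f y - R y) _).trans_isLittleO
          hRo
      refine (e1.add e2).neg_left.congr_left fun y => ?_
      rw [hfτ i y, map_sub]
      abel
  obtain ⟨Φ, Y, hΦ, hΦτ, hY, hsolv⟩ := hsol (k + 2) R hR hRτ
  obtain ⟨hYh, hYτ⟩ := hN _ _ hY
  have hF0 : Tendsto F (𝓝 0) (𝓝 0) := by
    simpa [h.map_zero] using h.poly_left.contDiff.continuous.tendsto 0
  have hΦ0 : Tendsto Φ (𝓝 0) (𝓝 0) := by
    have h0 : Φ 0 = 0 := by simpa using hΦ.2 0 0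
    simpa [h0] using hΦ.1.contDiff.continuous.tendsto 0
  refine ⟨fun v => F v + Φ v, fun v => G v + Y v, ⟨h.poly_left.add hΦ.1,
    h.poly_right.add hYh.1, ?_, ?_, ?_, ?_, fun i v => by simp only [h.equivariant, hΦτ, map_add],
    fun i v => by simp only [h.reversible, hYτ, map_add, neg_add], ?_⟩, by simpa using hΦ,
    by simpa using hY⟩
  · have h0 : Φ 0 = 0 := by simpa using hΦ.2 0 0
    simp [h.map_zero, h0]
  · exact (h.hasFDerivAt_left.add hΦ.hasFDerivAt_zero).congr_fderiv (add_zero _)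
  · exact (h.hasFDerivAt_right.add hYh.hasFDerivAt_zero).congr_fderiv (add_zero _)
  · have h0 : Y 0 = 0 := by simpa using hYh.2 0 0
    simp [h.map_zero_right, h0]
  · -- first-order expansion of `X` between `F` and `F + Φ`
    have t1 : (fun y => X (F y + Φ y) - X (F y) - L (Φ y)) =o[𝓝 0] fun y => ‖y‖ ^ (k + 2) := by
      have hs : HasStrictFDerivAt X (LinearMap.toContinuousLinearMap L) 0 :=
        hX.contDiffAt.hasStrictFDerivAt' hXL (by simp)
      have ht : Tendsto (fun y => (F y + Φ y, F y)) (𝓝 0) (𝓝 ((0 : V), (0 : V))) := by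
        simpa using (hF0.add hΦ0).prodMk_nhds hF0
      have := hs.isLittleO.comp_tendsto ht
      refine (this.congr (fun y => ?_) (fun y => ?_)).trans_isBigO hΦ.isBigO
      · simp
      · simp
    have hDF : (fun y => fderiv ℝ F y - ContinuousLinearMap.id ℝ V) =o[𝓝 0]
        fun _ => (1 : ℝ) := by
      rw [isLittleO_one_iff]
      have := (h.poly_left.contDiff.continuous_fderiv (by simp)).tendsto 0
      rw [h.hasFDerivAt_left.fderiv] at this
      simpa using this.sub_const (ContinuousLinearMap.id ℝ V)
    have t2 : (fun y => fderiv ℝ F y (Y y) - Y y) =o[𝓝 0] fun y => ‖y‖ ^ (k + 2) := by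
      have h1 : (fun y => (fderiv ℝ F y - ContinuousLinearMap.id ℝ V) (Y y)) =O[𝓝 0]
          fun y => ‖fderiv ℝ F y - ContinuousLinearMap.id ℝ V‖ * ‖Y y‖ :=
        IsBigO.of_bound 1 (Eventually.of_forall fun y => by
          rw [one_mul, norm_mul, norm_norm, norm_norm]
          exact ContinuousLinearMap.le_opNorm _ _)
      have h2 := hDF.norm_left.mul_isBigO hYh.isBigO.norm_left
      simpa using h1.trans_isLittleO h2
    have t3 : (fun y => fderiv ℝ Φ y (G y + Y y - L y)) =o[𝓝 0] fun y => ‖y‖ ^ (k + 2) := by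
      have hGL : (fun y => G y + Y y - L y) =o[𝓝 0] fun y => ‖y‖ := by
        have := (h.hasFDerivAt_right.add hYh.hasFDerivAt_zero).isLittleO
        have h0 : Y 0 = 0 := by simpa using hYh.2 0 0
        refine (this.congr_left fun y => ?_).norm_right.congr_right fun y => by simp
        simp [h.map_zero_right, h0]
      have h1 : (fun y => fderiv ℝ Φ y (G y + Y y - L y)) =O[𝓝 0]
          fun y => ‖fderiv ℝ Φ y‖ * ‖G y + Y y - L y‖ :=
        IsBigO.of_bound 1 (Eventually.of_forall fun y => by
          rw [one_mul, norm_mul, norm_norm, norm_norm]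
          exact ContinuousLinearMap.le_opNorm _ _)
      have h2 := hΦ.fderiv_isBigO.norm_left.mul_isLittleO hGL.norm_left
      exact (h1.trans_isLittleO h2).congr_right fun y => by rw [← pow_succ]
    -- The new residual is `(DF·Y - Y) + DΦ·(G + Y - L) - (X(F + Φ) - X(F) - LΦ) - (f - R)`; the
    -- terms left over cancel by the homological equation for `R`.
    refine (((t2.add t3).sub t1).sub hRo).congr_left fun y => ?_
    have hd : fderiv ℝ (fun v => F v + Φ v) y = fderiv ℝ F y + fderiv ℝ Φ y :=
      fderiv_fun_add (h.poly_left.differentiable y) (hΦ.1.differentiable y)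
    rw [hd, ← hsolv]
    simp only [hf, map_add, map_sub, add_apply]
    abel

/-- Formal normal forms: if every reversible homogeneous field is, modulo the image of the
homological operator of `L`, in the set `N k`, then `X` is formally conjugate to a field
`L + g 2 + g 3 + ⋯` with `g k ∈ N k`. -/
theorem exists_formallyConjugate {ι : Type*} {X : V → V} {L : V →ₗ[ℝ] V}
    {τ : ι → V →ₗ[ℝ] V} (hX : ContDiff ℝ (⊤ : ℕ∞) X) (hX0 : X 0 = 0)
    (hXL : HasFDerivAt X (LinearMap.toContinuousLinearMap L) 0)
    (hXτ : ∀ i v, X (τ i v) = -τ i (X v)) (hLτ : ∀ i v, L (τ i v) = -τ i (L v))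
    (N : ℕ → Set (V → V))
    (hN : ∀ k, ∀ Y ∈ N k, IsHomogPoly k Y ∧ ∀ i v, Y (τ i v) = -τ i (Y v))
    (hsol : ∀ k R, IsHomogPoly k R → (∀ i v, R (τ i v) = -τ i (R v)) →
      ∃ Φ Y, IsHomogPoly k Φ ∧ (∀ i v, Φ (τ i v) = τ i (Φ v)) ∧ Y ∈ N k ∧
        ∀ v, Y v + fderiv ℝ Φ v (L v) - L (Φ v) = R v) :
    ∃ g : ℕ → V → V, (∀ k, g (k + 2) ∈ N (k + 2)) ∧ FormallyConjugate X (formalField L g) := by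
  have base : IsPartialConjugacy X L τ 1 (fun v => v) (fun v => L v) :=
    { poly_left := IsPolyMap.linear LinearMap.id
      poly_right := IsPolyMap.linear L
      map_zero := rfl
      hasFDerivAt_left := hasFDerivAt_id 0
      hasFDerivAt_right := (LinearMap.toContinuousLinearMap L).hasFDerivAt
      map_zero_right := map_zero L
      equivariant := fun _ _ => rfl
      reversible := hLτ
      isLittleO := by
        have := hXL.isLittleO
        simp only [sub_zero, hX0] at this
        simpa using this.neg_left.norm_right }
  have step : ∀ k, ∀ s : {s : (V → V) × (V → V) // IsPartialConjugacy X L τ (k + 1) s.1 s.2},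
      ∃ s' : {s : (V → V) × (V → V) // IsPartialConjugacy X L τ (k + 2) s.1 s.2},
        IsHomogPoly (k + 2) (fun v => s'.1.1 v - s.1.1 v) ∧
          (fun v => s'.1.2 v - s.1.2 v) ∈ N (k + 2) := fun k s => by
    obtain ⟨F', G', h1, h2, h3⟩ := s.2.exists_succ hX hXL hXτ N hN hsol
    exact ⟨⟨(F', G'), h1⟩, h2, h3⟩
  choose next hnext using step
  let st : ∀ k, {s : (V → V) × (V → V) // IsPartialConjugacy X L τ (k + 1) s.1 s.2} :=
    fun k => Nat.rec ⟨(fun v => v, fun v => L v), base⟩ next k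
  let Φ : ℕ → V → V
    | 0 => 0
    | 1 => id
    | k + 2 => fun v => (st (k + 1)).1.1 v - (st k).1.1 v
  let g : ℕ → V → V
    | 0 => 0
    | 1 => 0
    | k + 2 => fun v => (st (k + 1)).1.2 v - (st k).1.2 v
  have hg : ∀ k, g (k + 2) ∈ N (k + 2) := fun k => (hnext k (st k)).2
  -- State `k` is correct to order `k + 1`, so it collects the terms of degrees `0, …, k + 1`, which
  -- is a sum over `range (k + 2)`.
  have sumΦ : ∀ k, ∑ i ∈ Finset.range (k + 2), Φ i = (st k).1.1 := fun k => by
    induction k with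
    | zero => funext v; simp [Finset.sum_range_succ, Φ, st]
    | succ k ih =>
      rw [Finset.sum_range_succ, ih]
      funext v
      simp [Φ]
  have sumY : ∀ k, ∑ i ∈ Finset.range (k + 2), formalField L g i = (st k).1.2 := fun k => by
    induction k with
    | zero => funext v; simp [Finset.sum_range_succ, formalField, st]
    | succ k ih =>
      rw [Finset.sum_range_succ, ih]
      funext v
      simp [formalField, g]
  refine ⟨g, hg, fun k => ?_, Φ, fun k => ?_, rfl, rfl, fun n => ?_⟩
  · match k with
    | 0 => exact IsHomogPoly.zero 0
    | 1 => exact ⟨IsPolyMap.linear L, fun t v => by simp [formalField]⟩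
    | k + 2 => exact (hN _ _ (hg k)).1
  · match k with
    | 0 => exact IsHomogPoly.zero 0
    | 1 => exact ⟨IsPolyMap.linear LinearMap.id, fun t v => by simp [Φ]⟩
    | k + 2 => exact (hnext k (st k)).1
  · match n with
    -- Order zero lies before the first state; there both truncations are `0` and only `X 0 = 0` is
    -- needed.
    | 0 => simp [Φ, formalField, hX0]
    | n + 1 =>
      rw [sumΦ, sumY]
      exact (st n).2.isLittleO

end NormalForm

/-! ### Complex monomials in `x₁, x₂, z, z̄` and their spans. -/

section Monomials

/-- Exponents of monomials in `x₁, x₂, z, z̄`. -/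
abbrev Expo : Type := ℕ × ℕ × (Fin 4 → ℕ) × (Fin 4 → ℕ)

/-- The monomial `x₁ ^ a x₂ ^ b z ^ c z̄ ^ d`. -/
noncomputable def mon (p : Expo) (v : E) : ℂ :=
  (v.1 0 : ℂ) ^ p.1 * (v.1 1 : ℂ) ^ p.2.1 *
    ((∏ j, v.2 j ^ p.2.2.1 j) * ∏ j, conj (v.2 j) ^ p.2.2.2 j)

/-- The degree of a monomial. -/
def Expo.deg (p : Expo) : ℕ := p.1 + p.2.1 + ((∑ j, p.2.2.1 j) + ∑ j, p.2.2.2 j)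

theorem mon_zero : mon 0 = 1 := by
  funext v; simp [mon]

theorem mon_add (p q : Expo) : mon (p + q) = mon p * mon q := by
  funext v
  simp only [mon, Prod.fst_add, Prod.snd_add, Pi.add_apply, pow_add, Finset.prod_mul_distrib,
    Pi.mul_apply]
  ring

theorem mon_smul (p : Expo) (t : ℝ) (v : E) : mon p (t • v) = (t : ℂ) ^ p.deg * mon p v := by
  simp only [mon, Expo.deg, Prod.smul_fst, Prod.smul_snd, Pi.smul_apply, smul_eq_mul,
    Complex.real_smul, map_mul, Complex.conj_ofReal, mul_pow, Finset.prod_mul_distrib,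
    Finset.prod_pow_eq_pow_sum, pow_add, Complex.ofReal_mul]
  ring

/-- Complex polynomial functions: the span of the monomials. -/
noncomputable def cpoly : Submodule ℂ (E → ℂ) := Submodule.span ℂ (Set.range mon)

theorem mon_mem_cpoly (p : Expo) : mon p ∈ cpoly := Submodule.subset_span ⟨p, rfl⟩

theorem mul_mem_cpoly {F G : E → ℂ} (hF : F ∈ cpoly) (hG : G ∈ cpoly) : F * G ∈ cpoly := by
  have h := Submodule.mul_mem_mul hF hG
  rw [cpoly, Submodule.span_mul_span] at h
  refine Submodule.span_mono ?_ h
  rintro _ ⟨_, ⟨p, rfl⟩, _, ⟨q, rfl⟩, rfl⟩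
  exact ⟨p + q, mon_add p q⟩

theorem x_mem_cpoly (i : Fin 2) : (fun v : E => (v.1 i : ℂ)) ∈ cpoly := by
  fin_cases i
  · have : (fun v : E => (v.1 0 : ℂ)) = mon (1, 0, 0, 0) := by funext v; simp [mon]
    simpa [this] using mon_mem_cpoly _
  · have : (fun v : E => (v.1 1 : ℂ)) = mon (0, 1, 0, 0) := by funext v; simp [mon]
    simpa [this] using mon_mem_cpoly _

theorem prod_pow_single (z : Fin 4 → ℂ) (j : Fin 4) :
    ∏ i, z i ^ (Pi.single j 1 : Fin 4 → ℕ) i = z j := by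
  rw [Finset.prod_eq_single j]
  · simp
  · intro i _ hi; simp [hi]
  · simp

theorem mon_z (j : Fin 4) : mon (0, 0, Pi.single j 1, 0) = fun v => v.2 j := by
  funext v; simp [mon, prod_pow_single]

theorem mon_conj_z (j : Fin 4) : mon (0, 0, 0, Pi.single j 1) = fun v => conj (v.2 j) := by
  funext v
  simp [mon, prod_pow_single (fun i => conj (v.2 i))]

theorem z_mem_cpoly (j : Fin 4) : (fun v : E => v.2 j) ∈ cpoly :=
  mon_z j ▸ mon_mem_cpoly _

theorem conj_z_mem_cpoly (j : Fin 4) : (fun v : E => conj (v.2 j)) ∈ cpoly :=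
  mon_conj_z j ▸ mon_mem_cpoly _

theorem E_eq_sum (v : E) : v = v.1 0 • ((![1, 0], 0) : E) + v.1 1 • ((![0, 1], 0) : E) +
    ∑ j, ((v.2 j).re • ((0, Pi.single j 1) : E) +
      (v.2 j).im • ((0, Pi.single j Complex.I) : E)) := by
  refine Prod.ext (funext fun i => ?_) (funext fun i => ?_)
  · fin_cases i <;> simp [Prod.fst_sum]
  · simp only [Prod.snd_add, Prod.smul_snd, Prod.snd_sum, smul_zero, zero_add, Finset.sum_apply,
      Pi.add_apply, Pi.smul_apply, Pi.zero_apply]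
    rw [Finset.sum_eq_single i]
    · simp [Complex.re_add_im]
    · intro j _ hj
      simp [hj.symm]
    · simp

theorem linear_apply_E {W : Type*} [AddCommGroup W] [Module ℝ W] (l : E →ₗ[ℝ] W) (v : E) :
    l v = v.1 0 • l (![1, 0], 0) + v.1 1 • l (![0, 1], 0) +
      ∑ j, ((v.2 j).re • l (0, Pi.single j 1) + (v.2 j).im • l (0, Pi.single j Complex.I)) := by
  conv_lhs => rw [E_eq_sum v]
  simp only [map_add, map_smul, map_sum]

theorem ofReal_mem_cpoly {f : E → ℝ} (hf : f ∈ polyFun E) : (fun v => (f v : ℂ)) ∈ cpoly := by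
  induction hf using Algebra.adjoin_induction with
  | mem f hf =>
    obtain ⟨l, rfl⟩ := hf
    have e : (fun v => ((l v : ℝ) : ℂ)) =
        (l (![1, 0], 0) : ℂ) • (fun v : E => (v.1 0 : ℂ)) +
        (l (![0, 1], 0) : ℂ) • (fun v : E => (v.1 1 : ℂ)) +
        ∑ j, ((l (0, Pi.single j 1) / 2 : ℂ) • ((fun v : E => v.2 j) + fun v : E => conj (v.2 j)) +
        ((l (0, Pi.single j Complex.I) / (2 * Complex.I) : ℂ)) •
          ((fun v : E => v.2 j) - fun v : E => conj (v.2 j))) := by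
      funext v
      rw [linear_apply_E l v]
      simp only [smul_eq_mul, Complex.ofReal_add, Complex.ofReal_mul, Complex.ofReal_sum,
        Complex.re_eq_add_conj, Complex.im_eq_sub_conj, Pi.add_apply, Pi.smul_apply,
        Finset.sum_apply, Pi.sub_apply]
      congr 1
      · ring
      · exact Finset.sum_congr rfl fun j _ => by ring
    rw [e]
    refine add_mem (add_mem (Submodule.smul_mem _ _ (x_mem_cpoly 0))
      (Submodule.smul_mem _ _ (x_mem_cpoly 1))) (sum_mem fun j _ => ?_)
    exact add_mem (Submodule.smul_mem _ _ (add_mem (z_mem_cpoly j) (conj_z_mem_cpoly j)))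
      (Submodule.smul_mem _ _ (sub_mem (z_mem_cpoly j) (conj_z_mem_cpoly j)))
  | algebraMap r =>
    have e : (fun v => ((algebraMap ℝ (E → ℝ) r v : ℝ) : ℂ)) = (r : ℂ) • mon 0 := by
      funext v; simp [mon_zero]
    rw [e]
    exact Submodule.smul_mem _ _ (mon_mem_cpoly 0)
  | add f g _ _ hf hg => simpa only [Pi.add_apply, Complex.ofReal_add] using! add_mem hf hg
  | mul f g _ _ hf hg => simpa only [Pi.mul_apply, Complex.ofReal_mul] using! mul_mem_cpoly hf hg

/-- The complex functions whose real and imaginary parts belong to a given algebra. -/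
def complexify {X : Type*} (A : Subalgebra ℝ (X → ℝ)) : Subalgebra ℂ (X → ℂ) where
  carrier := {F | (fun v => (F v).re) ∈ A ∧ (fun v => (F v).im) ∈ A}
  mul_mem' := by
    rintro F G ⟨hF, hF'⟩ ⟨hG, hG'⟩
    constructor
    · simpa only [Pi.mul_apply, Complex.mul_re] using! sub_mem (mul_mem hF hG) (mul_mem hF' hG')
    · simpa only [Pi.mul_apply, Complex.mul_im] using! add_mem (mul_mem hF hG') (mul_mem hF' hG)
  add_mem' := by
    rintro F G ⟨hF, hF'⟩ ⟨hG, hG'⟩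
    exact ⟨add_mem hF hG, add_mem hF' hG'⟩
  algebraMap_mem' c := ⟨A.algebraMap_mem c.re, A.algebraMap_mem c.im⟩

theorem ofReal_mem_complexify {X : Type*} {A : Subalgebra ℝ (X → ℝ)} {f : X → ℝ} (hf : f ∈ A) :
    (fun v => (f v : ℂ)) ∈ complexify A :=
  ⟨by simpa using hf, zero_mem A⟩

theorem conj_mem_complexify {X : Type*} {A : Subalgebra ℝ (X → ℝ)} {F : X → ℂ}
    (hF : F ∈ complexify A) : (fun v => conj (F v)) ∈ complexify A :=
  ⟨by simpa using hF.1, by simpa only [Complex.conj_im] using! neg_mem hF.2⟩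

theorem x_mem_polyFun (i : Fin 2) : (fun v : E => v.1 i) ∈ polyFun E :=
  linear_mem_polyFun ((LinearMap.proj i) ∘ₗ LinearMap.fst ℝ (Fin 2 → ℝ) (Fin 4 → ℂ))

theorem z_mem_complexify (j : Fin 4) : (fun v : E => v.2 j) ∈ complexify (polyFun E) :=
  ⟨linear_mem_polyFun (Complex.reLm ∘ₗ (LinearMap.proj j : (Fin 4 → ℂ) →ₗ[ℝ] ℂ) ∘ₗ
      LinearMap.snd ℝ (Fin 2 → ℝ) (Fin 4 → ℂ)),
    linear_mem_polyFun (Complex.imLm ∘ₗ (LinearMap.proj j : (Fin 4 → ℂ) →ₗ[ℝ] ℂ) ∘ₗ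
      LinearMap.snd ℝ (Fin 2 → ℝ) (Fin 4 → ℂ))⟩

theorem mon_mem_complexify (p : Expo) : mon p ∈ complexify (polyFun E) := by
  have e : mon p = (fun v : E => (v.1 0 : ℂ)) ^ p.1 * (fun v : E => (v.1 1 : ℂ)) ^ p.2.1 *
      ((∏ j, (fun v : E => v.2 j) ^ p.2.2.1 j) * ∏ j, (fun v : E => conj (v.2 j)) ^ p.2.2.2 j) := by
    funext v
    simp [mon, Finset.prod_apply]
  rw [e]
  exact mul_mem (mul_mem (pow_mem (ofReal_mem_complexify (x_mem_polyFun 0)) _)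
    (pow_mem (ofReal_mem_complexify (x_mem_polyFun 1)) _))
    (mul_mem (prod_mem fun j _ => pow_mem (z_mem_complexify j) _)
    (prod_mem fun j _ => pow_mem (conj_mem_complexify (z_mem_complexify j)) _))

/-- Weights are visible on complex monomials, whereas the group invariants are real functions. The
two descriptions agree because the real linear coordinates are complex combinations of `x`, `z` and
`z̄`, and conversely. -/
theorem mem_cpoly_iff {F : E → ℂ} : F ∈ cpoly ↔ F ∈ complexify (polyFun E) := by
  constructor
  · intro h
    refine (Submodule.span_le (p := (complexify (polyFun E)).toSubmodule)).2 ?_ h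
    rintro _ ⟨p, rfl⟩
    exact mon_mem_complexify p
  · rintro ⟨h1, h2⟩
    have e : F = (fun v => ((F v).re : ℂ)) + Complex.I • fun v => ((F v).im : ℂ) := by
      funext v
      simp [mul_comm Complex.I]
    rw [e]
    exact add_mem (ofReal_mem_cpoly h1) (Submodule.smul_mem _ _ (ofReal_mem_cpoly h2))

theorem span_mon_le_iSup {ι : Type*} (P : Set Expo) (w : Expo → ι) :
    Submodule.span ℂ (mon '' P) ≤ ⨆ i, Submodule.span ℂ (mon '' {p ∈ P | w p = i}) := by
  rw [Submodule.span_le]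
  rintro _ ⟨p, hp, rfl⟩
  exact Submodule.mem_iSup_of_mem (w p) (Submodule.subset_span ⟨p, ⟨hp, rfl⟩, rfl⟩)

/-- A combination of monomials which is an eigenfunction of an action diagonal on monomials
only involves monomials with the same character. -/
theorem mem_span_mon_of_eigen {G ι : Type*} [MulOneClass G] (ρ : G → E → E) (χ : ι → G →* ℂ)
    (hχ : Function.Injective χ) (w : Expo → ι)
    (hw : ∀ p g v, mon p (ρ g v) = χ (w p) g * mon p v) {P : Set Expo} {F : E → ℂ}
    (hF : F ∈ Submodule.span ℂ (mon '' P)) {i : ι} (hFi : ∀ g v, F (ρ g v) = χ i g * F v) :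
    F ∈ Submodule.span ℂ (mon '' {p ∈ P | w p = i}) := by
  refine mem_of_mem_iSup_of_eigen ρ χ hχ
    (fun i => Submodule.span ℂ (mon '' {p ∈ P | w p = i})) (fun i f hf g v => ?_)
    (span_mon_le_iSup P w hF) hFi
  induction hf using Submodule.span_induction with
  | mem f hf =>
    obtain ⟨p, ⟨_, rfl⟩, rfl⟩ := hf
    exact hw p g v
  | zero => simp
  | add f f' _ _ h h' => simp only [Pi.add_apply, h, h', mul_add]
  | smul c f _ h => simp only [Pi.smul_apply, h, smul_eq_mul]; ring

/-- Homogeneity is an eigenvalue condition for the scalings, whose characters `t ↦ t ^ d` are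
distinct, so only monomials of degree `k` can occur. -/
theorem mem_span_mon_of_homogeneous {F : E → ℂ} (hF : F ∈ cpoly) {k : ℕ}
    (hk : ∀ (t : ℝ) v, F (t • v) = (t : ℂ) ^ k * F v) :
    F ∈ Submodule.span ℂ (mon '' {p | p.deg = k}) := by
  have := mem_span_mon_of_eigen (P := Set.univ) (i := k) (fun (t : ℝ) v => t • v)
    (fun d : ℕ => (powMonoidHom d).comp (Complex.ofRealHom : ℝ →* ℂ)) (fun d e h => ?_) Expo.deg
    (fun p t v => by simpa using mon_smul p t v) (F := F)
    (by rwa [Set.image_univ]) (fun t v => by simpa using hk t v)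
  · simpa using this
  · refine powMonoidHom_injective (MonoidHom.ext fun t => ?_)
    have := DFunLike.congr_fun h t
    simpa [← Complex.ofReal_pow] using this

end Monomials

/-! ### Elimination of `x₂` by the shear. -/

section Shear

/-- A shear moves `x₂` to `0` only where `x₁ ≠ 0`; identities found there extend by continuity. -/
theorem dense_x_ne_zero : Dense {v : E | v.1 0 ≠ 0} := by
  intro v
  by_cases hv : v.1 0 = 0
  · have h1 : Tendsto (fun t : ℝ => v + t • ((![1, 0], 0) : E)) (𝓝[≠] 0) (𝓝 v) := by
      have : Continuous fun t : ℝ => v + t • ((![1, 0], 0) : E) := by fun_prop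
      simpa using (this.tendsto 0).mono_left nhdsWithin_le_nhds
    refine mem_closure_of_tendsto h1 ?_
    filter_upwards [self_mem_nhdsWithin] with t ht
    simpa [hv] using ht
  · exact subset_closure hv

theorem continuous_of_mem_cpoly {F : E → ℂ} (hF : F ∈ cpoly) : Continuous F := by
  obtain ⟨h1, h2⟩ := mem_cpoly_iff.1 hF
  have e : F = fun v => ((F v).re : ℂ) + (F v).im * Complex.I := by
    funext v; simp
  rw [e]
  have := (contDiff_of_mem_polyFun h1).continuous
  have := (contDiff_of_mem_polyFun h2).continuous
  fun_prop

/-- The projection along `x₂`. -/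
def dropX₂ (v : E) : E := (![v.1 0, 0], v.2)

theorem continuous_dropX₂ : Continuous dropX₂ := by
  unfold dropX₂
  refine Continuous.prodMk (continuous_pi fun i => ?_) continuous_snd
  fin_cases i <;> simp <;> fun_prop

theorem mon_dropX₂ (p : Expo) :
    (fun v => mon p (dropX₂ v)) = if p.2.1 = 0 then mon p else 0 := by
  funext v
  split_ifs with h <;> simp [mon, dropX₂, h]

theorem comp_dropX₂_mem_span {F : E → ℂ} (hF : F ∈ cpoly) :
    (fun v => F (dropX₂ v)) ∈ Submodule.span ℂ (mon '' {p | p.2.1 = 0}) := by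
  induction hF using Submodule.span_induction with
  | mem f hf =>
    obtain ⟨p, rfl⟩ := hf
    rw [mon_dropX₂]
    split_ifs with h
    · exact Submodule.subset_span ⟨p, h, rfl⟩
    · exact zero_mem _
  | zero => exact zero_mem _
  | add f f' _ _ h h' => exact add_mem h h'
  | smul c f _ h => exact Submodule.smul_mem _ c h

end Shear

/-! ### Torus weights of monomials. -/

section Torus

variable (n₁ n₂ m₁ m₂ : ℕ)

/-- The weight of a monomial under the torus. -/
def Expo.weight (p : Expo) : ℤ × ℤ :=
  (n₁ * ((p.2.2.1 0 : ℤ) - p.2.2.2 0) + n₂ * ((p.2.2.1 1 : ℤ) - p.2.2.2 1),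
    m₁ * ((p.2.2.1 2 : ℤ) - p.2.2.2 2) + m₂ * ((p.2.2.1 3 : ℤ) - p.2.2.2 3))

/-- The characters of the torus. -/
noncomputable def torusChar (w : ℤ × ℤ) : Circle × Circle →* ℂ :=
  Circle.coeHom.comp (MonoidHom.coprod (zpowGroupHom w.1) (zpowGroupHom w.2))

theorem torusChar_apply (w : ℤ × ℤ) (θ : Circle × Circle) :
    torusChar w θ = (θ.1 : ℂ) ^ w.1 * (θ.2 : ℂ) ^ w.2 := by
  simp [torusChar]
  rfl

/-- If `k ≠ l`, then `θ = exp (iπ / (k - l))` satisfies `θ ^ (k - l) = -1`, which contradicts the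
hypothesis. -/
theorem eq_of_forall_circle_zpow_eq {k l : ℤ} (h : ∀ θ : Circle, (θ : ℂ) ^ k = (θ : ℂ) ^ l) :
    k = l := by
  by_contra hkl
  have hd : ((k - l : ℤ) : ℝ) ≠ 0 := by exact_mod_cast sub_ne_zero.2 hkl
  have h1 := h (Circle.exp (Real.pi / (k - l : ℤ)))
  have h2 : ((Circle.exp (Real.pi / (k - l : ℤ)) : Circle) : ℂ) ^ (k - l) = 1 := by
    rw [zpow_sub₀ (Circle.coe_ne_zero _), h1, div_self (zpow_ne_zero _ (Circle.coe_ne_zero _))]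
  rw [Circle.coe_exp, ← Complex.exp_int_mul] at h2
  have h3 : ((k - l : ℤ) : ℂ) * (((Real.pi / (k - l : ℤ) : ℝ) : ℂ) * Complex.I)
      = Real.pi * Complex.I := by
    have : ((k - l : ℤ) : ℂ) ≠ 0 := by exact_mod_cast hd
    push_cast at this ⊢
    field_simp
  rw [h3, Complex.exp_pi_mul_I] at h2
  norm_num at h2

theorem torusChar_injective : Function.Injective torusChar := by
  intro w w' h
  refine Prod.ext (eq_of_forall_circle_zpow_eq fun θ => ?_)
    (eq_of_forall_circle_zpow_eq fun θ => ?_)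
  · simpa [torusChar_apply] using DFunLike.congr_fun h (θ, 1)
  · simpa [torusChar_apply] using DFunLike.congr_fun h (1, θ)

theorem pow_mul_conj_pow_circle (θ : Circle) (n c d : ℕ) (z : ℂ) :
    (((θ : ℂ) ^ n * z) ^ c) * (conj ((θ : ℂ) ^ n * z)) ^ d =
      (θ : ℂ) ^ ((n : ℤ) * ((c : ℤ) - d)) * (z ^ c * conj z ^ d) := by
  have h : (θ : ℂ) ≠ 0 := Circle.coe_ne_zero θ
  rw [map_mul, map_pow, ← Circle.coe_inv_eq_conj, Circle.coe_inv, mul_pow, mul_pow, mul_sub,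
    zpow_sub₀ h, inv_pow, inv_pow, ← pow_mul, ← pow_mul, ← Nat.cast_mul, ← Nat.cast_mul,
    zpow_natCast, zpow_natCast]
  field_simp

theorem mon_eq (p : Expo) (v : E) : mon p v = (v.1 0 : ℂ) ^ p.1 * (v.1 1 : ℂ) ^ p.2.1 *
    (((v.2 0 ^ p.2.2.1 0 * conj (v.2 0) ^ p.2.2.2 0) *
      (v.2 1 ^ p.2.2.1 1 * conj (v.2 1) ^ p.2.2.2 1)) *
    ((v.2 2 ^ p.2.2.1 2 * conj (v.2 2) ^ p.2.2.2 2) *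
      (v.2 3 ^ p.2.2.1 3 * conj (v.2 3) ^ p.2.2.2 3))) := by
  simp only [mon, Fin.prod_univ_four]
  ring

theorem mon_torus (p : Expo) (θ : Circle × Circle) (v : E) :
    mon p (repS n₁ n₂ m₁ m₂ (1, θ) v) = torusChar (p.weight n₁ n₂ m₁ m₂) θ * mon p v := by
  have h1 : (θ.1 : ℂ) ≠ 0 := Circle.coe_ne_zero _
  have h2 : (θ.2 : ℂ) ≠ 0 := Circle.coe_ne_zero _
  have e0 : (repS n₁ n₂ m₁ m₂ (1, θ) v).1 = v.1 := by
    funext i; fin_cases i <;> simp [repS]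
  have z0 : (repS n₁ n₂ m₁ m₂ (1, θ) v).2 0 = (θ.1 : ℂ) ^ n₁ * v.2 0 := by simp [repS, torusElt]
  have z1 : (repS n₁ n₂ m₁ m₂ (1, θ) v).2 1 = (θ.1 : ℂ) ^ n₂ * v.2 1 := by simp [repS, torusElt]
  have z2 : (repS n₁ n₂ m₁ m₂ (1, θ) v).2 2 = (θ.2 : ℂ) ^ m₁ * v.2 2 := by simp [repS, torusElt]
  have z3 : (repS n₁ n₂ m₁ m₂ (1, θ) v).2 3 = (θ.2 : ℂ) ^ m₂ * v.2 3 := by simp [repS, torusElt]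
  rw [torusChar_apply, mon_eq, mon_eq, e0, z0, z1, z2, z3]
  simp only [pow_mul_conj_pow_circle, Expo.weight, zpow_add₀ h1, zpow_add₀ h2]
  ring

/-- A polynomial function of weight `w` under the torus, invariant under the shear, is a combination
of monomials of weight `w` without `x₂`. -/
theorem mem_span_mon_of_equivariant {F : E → ℂ} (hF : F ∈ cpoly) {w : ℤ × ℤ}
    (hs : ∀ (s : ℝ) v, F (repS n₁ n₂ m₁ m₂ (Multiplicative.ofAdd s, 1) v) = F v)
    (hθ : ∀ θ v, F (repS n₁ n₂ m₁ m₂ (1, θ) v) = torusChar w θ * F v) :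
    F ∈ Submodule.span ℂ (mon '' {p | p.2.1 = 0 ∧ p.weight n₁ n₂ m₁ m₂ = w}) := by
  -- Where `x₁ ≠ 0`, the shear with `s = -x₂ / x₁` carries `v` to `dropX₂ v`.
  have e : (fun v => F (dropX₂ v)) = F := by
    refine Continuous.ext_on dense_x_ne_zero ((continuous_of_mem_cpoly hF).comp continuous_dropX₂)
      (continuous_of_mem_cpoly hF) fun v hv => ?_
    rw [← hs (-(v.1 1) / v.1 0) v]
    congr 1
    refine Prod.ext (funext fun i => ?_) (funext fun j => ?_)
    · have hv : v.1 0 ≠ 0 := hv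
      fin_cases i
      · simp [repS, dropX₂]
      · simp [repS, dropX₂, hv]
    · simp [repS, dropX₂]
  have h := comp_dropX₂_mem_span hF
  rw [e] at h
  exact mem_span_mon_of_eigen (fun θ v => repS n₁ n₂ m₁ m₂ (1, θ) v) torusChar
    torusChar_injective (Expo.weight n₁ n₂ m₁ m₂) (mon_torus n₁ n₂ m₁ m₂) h hθ

end Torus

/-! ### Arithmetic of resonant monomials for coprime weights. -/

section Resonance

variable {R : Type*} [CommMonoid R] (A : Submonoid R)

/-- Monomials of weight zero under the circle action with coprime weights `n₁, n₂`. -/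
theorem pow_mul_pow_mem_of_weight_zero {n₁ n₂ : ℕ} (hn₂ : n₂ ≠ 0) (hn : Nat.Coprime n₁ n₂)
    {f f' g g' : R} (hf : f * f' ∈ A) (hg : g * g' ∈ A) (h1 : f ^ n₂ * g' ^ n₁ ∈ A)
    (h2 : f' ^ n₂ * g ^ n₁ ∈ A) {c d c' d' : ℕ}
    (hw : (n₁ : ℤ) * ((c : ℤ) - d) + n₂ * ((c' : ℤ) - d') = 0) :
    (f ^ c * f' ^ d) * (g ^ c' * g' ^ d') ∈ A := by
  have hdvd : (n₂ : ℤ) ∣ (c : ℤ) - d :=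
    IsCoprime.dvd_of_dvd_mul_left (Nat.isCoprime_iff_coprime.2 hn.symm)
      (⟨(d' : ℤ) - c', by linarith⟩ : (n₂ : ℤ) ∣ n₁ * ((c : ℤ) - d))
  obtain ⟨k, hk⟩ := hdvd
  have hk' : (d' : ℤ) - c' = n₁ * k := by
    have : (n₂ : ℤ) ≠ 0 := by exact_mod_cast hn₂
    apply mul_left_cancel₀ this
    rw [hk] at hw
    linarith
  -- Now `c - d = n₂ k` and `d' - c' = n₁ k`. The sign of `k` decides whether the excess factor is a
  -- power of `f ^ n₂ g' ^ n₁` or of its counterpart `f' ^ n₂ g ^ n₁`.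
  rcases le_total 0 k with h0 | h0
  · lift k to ℕ using h0
    obtain rfl : c = d + n₂ * k := by zify; linarith
    obtain rfl : d' = c' + n₁ * k := by zify; linarith
    have e : (f ^ (d + n₂ * k) * f' ^ d) * (g ^ c' * g' ^ (c' + n₁ * k)) =
        (f * f') ^ d * (g * g') ^ c' * (f ^ n₂ * g' ^ n₁) ^ k := by
      simp only [pow_add, pow_mul, mul_pow]
      ac_rfl
    rw [e]
    exact mul_mem (mul_mem (pow_mem hf _) (pow_mem hg _)) (pow_mem h1 _)
  · obtain ⟨k, rfl⟩ : ∃ l : ℕ, k = -l := ⟨(-k).toNat, by omega⟩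
    obtain rfl : d = c + n₂ * k := by zify; linarith
    obtain rfl : c' = d' + n₁ * k := by zify; linarith
    have e : (f ^ c * f' ^ (c + n₂ * k)) * (g ^ (d' + n₁ * k) * g' ^ d') =
        (f * f') ^ c * (g * g') ^ d' * (f' ^ n₂ * g ^ n₁) ^ k := by
      simp only [pow_add, pow_mul, mul_pow]
      ac_rfl
    rw [e]
    exact mul_mem (mul_mem (pow_mem hf _) (pow_mem hg _)) (pow_mem h2 _)

/-- Monomials of weight `n₁` under the circle action with coprime weights `n₁, n₂`. -/
theorem pow_mul_pow_eq_of_weight {n₁ n₂ : ℕ} (hn₂ : n₂ ≠ 0) (hn : Nat.Coprime n₁ n₂)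
    {f f' g g' : R} (hf : f * f' ∈ A) (hg : g * g' ∈ A) (h1 : f ^ n₂ * g' ^ n₁ ∈ A)
    (h2 : f' ^ n₂ * g ^ n₁ ∈ A) {c d c' d' : ℕ}
    (hw : (n₁ : ℤ) * ((c : ℤ) - d) + n₂ * ((c' : ℤ) - d') = n₁) :
    ∃ s ∈ A, (f ^ c * f' ^ d) * (g ^ c' * g' ^ d') = s * f ∨
      (f ^ c * f' ^ d) * (g ^ c' * g' ^ d') = s * (f' ^ (n₂ - 1) * g ^ n₁) := by
  have hw' : (n₁ : ℤ) * ((c : ℤ) - d - 1) + n₂ * ((c' : ℤ) - d') = 0 := by linarith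
  have hdvd : (n₂ : ℤ) ∣ (c : ℤ) - d - 1 :=
    IsCoprime.dvd_of_dvd_mul_left (Nat.isCoprime_iff_coprime.2 hn.symm)
      (⟨(d' : ℤ) - c', by linarith⟩ : (n₂ : ℤ) ∣ n₁ * ((c : ℤ) - d - 1))
  obtain ⟨k, hk⟩ := hdvd
  have hk' : (d' : ℤ) - c' = n₁ * k := by
    have : (n₂ : ℤ) ≠ 0 := by exact_mod_cast hn₂
    apply mul_left_cancel₀ this
    rw [hk] at hw'
    linarith
  -- With `c - d - 1 = n₂ k`: for `k ≥ 0` one has `c ≥ 1` and a factor `f` splits off, leaving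
  -- weight zero. For `k < 0` there are at least `n₂ - 1` surplus factors `f'` and `n₁` surplus
  -- factors `g`; the rest has weight zero.
  rcases le_or_gt 0 k with h0 | h0
  · have : 0 ≤ (n₂ : ℤ) * k := mul_nonneg (by positivity) h0
    obtain ⟨c, rfl⟩ : ∃ e, c = e + 1 := ⟨c - 1, by omega⟩
    refine ⟨(f ^ c * f' ^ d) * (g ^ c' * g' ^ d'), ?_, Or.inl ?_⟩
    · exact pow_mul_pow_mem_of_weight_zero A hn₂ hn hf hg h1 h2
        (by push_cast at hw'; linarith)
    · rw [pow_succ]; ac_rfl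
  · obtain ⟨k, rfl⟩ : ∃ l : ℕ, k = -(l + 1 : ℕ) := ⟨(-k - 1).toNat, by omega⟩
    obtain ⟨m, rfl⟩ : ∃ m, n₂ = m + 1 := ⟨n₂ - 1, by omega⟩
    obtain rfl : d = c + m + (m + 1) * k := by zify; push_cast at hk; linarith
    obtain rfl : c' = d' + n₁ + n₁ * k := by zify; push_cast at hk'; linarith
    refine ⟨(f * f') ^ c * (g * g') ^ d' * (f' ^ (m + 1) * g ^ n₁) ^ k,
      mul_mem (mul_mem (pow_mem hf _) (pow_mem hg _)) (pow_mem h2 _), Or.inr ?_⟩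
    rw [Nat.add_sub_cancel]
    simp only [pow_add, pow_mul, mul_pow, pow_one]
    ac_rfl

end Resonance

/-! ### Invariants and equivariants of `S`. -/

section SInvariants

variable (n₁ n₂ m₁ m₂ : ℕ)

/-- The algebra generated by `u₁, …, u₉`. -/
noncomputable def sRing : Subalgebra ℝ (E → ℝ) := Algebra.adjoin ℝ (Set.range (u n₁ n₂ m₁ m₂))

theorem u_mem_sRing (i : ℕ) : u n₁ n₂ m₁ m₂ i ∈ sRing n₁ n₂ m₁ m₂ :=
  Algebra.subset_adjoin ⟨i, rfl⟩

theorem z_mul_conj_z_mem (j : Fin 4) :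
    (fun v : E => v.2 j) * (fun v : E => conj (v.2 j)) ∈ complexify (sRing n₁ n₂ m₁ m₂) := by
  have h : ∀ j : Fin 4, (fun v : E => v.2 j) * (fun v : E => conj (v.2 j)) =
      fun v : E => ((Complex.normSq (v.2 j) : ℝ) : ℂ) := fun j => by
    funext v; simp [Complex.mul_conj]
  rw [h]
  apply ofReal_mem_complexify
  fin_cases j
  · exact u_mem_sRing n₁ n₂ m₁ m₂ 2
  · exact u_mem_sRing n₁ n₂ m₁ m₂ 3
  · exact u_mem_sRing n₁ n₂ m₁ m₂ 6
  · exact u_mem_sRing n₁ n₂ m₁ m₂ 7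

theorem resonant₁_mem : (fun v : E => v.2 0) ^ n₂ * (fun v : E => conj (v.2 1)) ^ n₁ ∈
    complexify (sRing n₁ n₂ m₁ m₂) :=
  ⟨u_mem_sRing n₁ n₂ m₁ m₂ 4, u_mem_sRing n₁ n₂ m₁ m₂ 5⟩

theorem resonant₂_mem : (fun v : E => v.2 2) ^ m₂ * (fun v : E => conj (v.2 3)) ^ m₁ ∈
    complexify (sRing n₁ n₂ m₁ m₂) :=
  ⟨u_mem_sRing n₁ n₂ m₁ m₂ 8, u_mem_sRing n₁ n₂ m₁ m₂ 9⟩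

theorem conj_resonant₁_mem : (fun v : E => conj (v.2 0)) ^ n₂ * (fun v : E => v.2 1) ^ n₁ ∈
    complexify (sRing n₁ n₂ m₁ m₂) := by
  have := conj_mem_complexify (resonant₁_mem n₁ n₂ m₁ m₂)
  simpa only [Pi.mul_apply, Pi.pow_apply, map_mul, map_pow, Complex.conj_conj] using! this

theorem conj_resonant₂_mem : (fun v : E => conj (v.2 2)) ^ m₂ * (fun v : E => v.2 3) ^ m₁ ∈
    complexify (sRing n₁ n₂ m₁ m₂) := by
  have := conj_mem_complexify (resonant₂_mem n₁ n₂ m₁ m₂)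
  simpa only [Pi.mul_apply, Pi.pow_apply, map_mul, map_pow, Complex.conj_conj] using! this

theorem mon_eq_of_x₂_free {p : Expo} (hp : p.2.1 = 0) :
    mon p = (fun v : E => (v.1 0 : ℂ)) ^ p.1 *
      ((((fun v : E => v.2 0) ^ p.2.2.1 0 * (fun v : E => conj (v.2 0)) ^ p.2.2.2 0) *
      ((fun v : E => v.2 1) ^ p.2.2.1 1 * (fun v : E => conj (v.2 1)) ^ p.2.2.2 1)) *
      (((fun v : E => v.2 2) ^ p.2.2.1 2 * (fun v : E => conj (v.2 2)) ^ p.2.2.2 2) *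
      ((fun v : E => v.2 3) ^ p.2.2.1 3 * (fun v : E => conj (v.2 3)) ^ p.2.2.2 3))) := by
  funext v
  rw [mon_eq, hp]
  simp

variable {n₁ n₂ m₁ m₂}

theorem pair₁_mem (hn₂ : n₂ ≠ 0) (hn : Nat.Coprime n₁ n₂) {c d c' d' : ℕ}
    (hw : (n₁ : ℤ) * ((c : ℤ) - d) + n₂ * ((c' : ℤ) - d') = 0) :
    (((fun v : E => v.2 0) ^ c * (fun v : E => conj (v.2 0)) ^ d) *
      ((fun v : E => v.2 1) ^ c' * (fun v : E => conj (v.2 1)) ^ d')) ∈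
      complexify (sRing n₁ n₂ m₁ m₂) :=
  pow_mul_pow_mem_of_weight_zero (complexify (sRing n₁ n₂ m₁ m₂)).toSubmonoid hn₂ hn
    (z_mul_conj_z_mem _ _ _ _ 0) (z_mul_conj_z_mem _ _ _ _ 1) (resonant₁_mem _ _ _ _)
    (conj_resonant₁_mem _ _ _ _) hw

theorem pair₂_mem (hm₂ : m₂ ≠ 0) (hm : Nat.Coprime m₁ m₂) {c d c' d' : ℕ}
    (hw : (m₁ : ℤ) * ((c : ℤ) - d) + m₂ * ((c' : ℤ) - d') = 0) :
    (((fun v : E => v.2 2) ^ c * (fun v : E => conj (v.2 2)) ^ d) *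
      ((fun v : E => v.2 3) ^ c' * (fun v : E => conj (v.2 3)) ^ d')) ∈
      complexify (sRing n₁ n₂ m₁ m₂) :=
  pow_mul_pow_mem_of_weight_zero (complexify (sRing n₁ n₂ m₁ m₂)).toSubmonoid hm₂ hm
    (z_mul_conj_z_mem _ _ _ _ 2) (z_mul_conj_z_mem _ _ _ _ 3) (resonant₂_mem _ _ _ _)
    (conj_resonant₂_mem _ _ _ _) hw

theorem x₁_mem (k : ℕ) :
    (fun v : E => (v.1 0 : ℂ)) ^ k ∈ complexify (sRing n₁ n₂ m₁ m₂) :=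
  pow_mem (ofReal_mem_complexify (u_mem_sRing n₁ n₂ m₁ m₂ 1)) k

theorem mon_mem_of_weight_zero (hn₂ : n₂ ≠ 0) (hm₂ : m₂ ≠ 0) (hn : Nat.Coprime n₁ n₂)
    (hm : Nat.Coprime m₁ m₂) {p : Expo} (hp : p.2.1 = 0) (hw : p.weight n₁ n₂ m₁ m₂ = 0) :
    mon p ∈ complexify (sRing n₁ n₂ m₁ m₂) := by
  rw [mon_eq_of_x₂_free hp]
  obtain ⟨h1, h2⟩ := Prod.ext_iff.1 hw
  exact mul_mem (x₁_mem _) (mul_mem (pair₁_mem hn₂ hn h1) (pair₂_mem hm₂ hm h2))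

/-- Polynomial functions invariant under `S` are polynomials in `u₁, …, u₉`. -/
theorem mem_sRing_of_invariant (hn₂ : n₂ ≠ 0) (hm₂ : m₂ ≠ 0) (hn : Nat.Coprime n₁ n₂)
    (hm : Nat.Coprime m₁ m₂) {f : E → ℝ} (hf : f ∈ polyFun E)
    (hs : ∀ s v, f (repS n₁ n₂ m₁ m₂ s v) = f v) : f ∈ sRing n₁ n₂ m₁ m₂ := by
  have h := mem_span_mon_of_equivariant n₁ n₂ m₁ m₂ (w := 0) (ofReal_mem_cpoly hf)
    (fun s v => by rw [hs]) (fun θ v => by rw [hs]; simp [torusChar_apply])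
  have h' : (fun v => (f v : ℂ)) ∈ complexify (sRing n₁ n₂ m₁ m₂) := by
    refine (Submodule.span_le (p := (complexify (sRing n₁ n₂ m₁ m₂)).toSubmodule)).2 ?_ h
    rintro _ ⟨p, ⟨hp, hw⟩, rfl⟩
    exact mon_mem_of_weight_zero hn₂ hm₂ hn hm hp hw
  simpa using h'.1

/-- Passes from generation on monomials to generation on their span, by collecting separately the
coefficients of `f` and of `q`. -/
theorem exists_mul_add_mul {P : Set Expo} {F f q : E → ℂ} {A : Subalgebra ℂ (E → ℂ)}
    (hF : F ∈ Submodule.span ℂ (mon '' P))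
    (hP : ∀ p ∈ P, ∃ s ∈ A, mon p = s * f ∨ mon p = s * q) :
    ∃ a ∈ A, ∃ b ∈ A, F = a * f + b * q := by
  induction hF using Submodule.span_induction with
  | mem F hF =>
    obtain ⟨p, hp, rfl⟩ := hF
    obtain ⟨s, hs, h | h⟩ := hP p hp
    · exact ⟨s, hs, 0, zero_mem _, by simp [h]⟩
    · exact ⟨0, zero_mem _, s, hs, by simp [h]⟩
  | zero => exact ⟨0, zero_mem _, 0, zero_mem _, by simp⟩
  | add F G _ _ h h' =>
    obtain ⟨a, ha, b, hb, rfl⟩ := h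
    obtain ⟨a', ha', b', hb', rfl⟩ := h'
    exact ⟨a + a', add_mem ha ha', b + b', add_mem hb hb', by ring⟩
  | smul c F _ h =>
    obtain ⟨a, ha, b, hb, rfl⟩ := h
    exact ⟨c • a, A.smul_mem ha c, c • b, A.smul_mem hb c, by simp⟩

/-- The weight of the coordinate `z_j`. -/
def zWeight (n₁ n₂ m₁ m₂ : ℕ) : Fin 4 → ℤ × ℤ := ![(n₁, 0), (n₂, 0), (0, m₁), (0, m₂)]

/-- The second generator of the module of equivariant `j`-th components. -/
noncomputable def zResonant (n₁ n₂ m₁ m₂ : ℕ) : Fin 4 → E → ℂ :=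
  ![fun v => conj (v.2 0) ^ (n₂ - 1) * v.2 1 ^ n₁, fun v => v.2 0 ^ n₂ * conj (v.2 1) ^ (n₁ - 1),
    fun v => conj (v.2 2) ^ (m₂ - 1) * v.2 3 ^ m₁, fun v => v.2 2 ^ m₂ * conj (v.2 3) ^ (m₁ - 1)]

theorem mon_eq_of_zWeight (hn₁ : n₁ ≠ 0) (hn₂ : n₂ ≠ 0) (hm₁ : m₁ ≠ 0) (hm₂ : m₂ ≠ 0)
    (hn : Nat.Coprime n₁ n₂) (hm : Nat.Coprime m₁ m₂) (j : Fin 4) {p : Expo} (hp : p.2.1 = 0)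
    (hw : p.weight n₁ n₂ m₁ m₂ = zWeight n₁ n₂ m₁ m₂ j) :
    ∃ s ∈ complexify (sRing n₁ n₂ m₁ m₂),
      mon p = s * (fun v => v.2 j) ∨ mon p = s * zResonant n₁ n₂ m₁ m₂ j := by
  obtain ⟨h1, h2⟩ := Prod.ext_iff.1 hw
  rw [mon_eq_of_x₂_free hp]
  let A := (complexify (sRing n₁ n₂ m₁ m₂)).toSubmonoid
  fin_cases j
  · obtain ⟨s, hs, h⟩ := pow_mul_pow_eq_of_weight A hn₂ hn (z_mul_conj_z_mem _ _ _ _ 0)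
      (z_mul_conj_z_mem _ _ _ _ 1) (resonant₁_mem _ _ _ _) (conj_resonant₁_mem _ _ _ _) h1
    refine ⟨_, mul_mem (x₁_mem p.1) (mul_mem hs (pair₂_mem hm₂ hm h2)), h.imp ?_ ?_⟩
    · intro h; rw [h]; simp only [Fin.zero_eta]; ring
    · intro h; rw [h]
      change _ = _ * ((fun v : E => conj (v.2 0)) ^ (n₂ - 1) * (fun v : E => v.2 1) ^ n₁)
      ring
  -- The second coordinate of a resonant pair is treated by exchanging the roles of the two
  -- coordinates and of `n₁, n₂`.
  · obtain ⟨s, hs, h⟩ := pow_mul_pow_eq_of_weight A hn₁ hn.symm (z_mul_conj_z_mem _ _ _ _ 1)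
      (z_mul_conj_z_mem _ _ _ _ 0) (by rw [mul_comm]; exact conj_resonant₁_mem _ _ _ _)
      (by rw [mul_comm]; exact resonant₁_mem _ _ _ _) ((add_comm _ _).trans h1)
    refine ⟨_, mul_mem (x₁_mem p.1) (mul_mem hs (pair₂_mem hm₂ hm h2)), h.imp ?_ ?_⟩
    · intro h; rw [mul_comm (_ * _) (_ ^ p.2.2.1 1 * _), h]; simp only [Fin.mk_one]; ring
    · intro h; rw [mul_comm (_ * _) (_ ^ p.2.2.1 1 * _), h]
      change _ = _ * ((fun v : E => v.2 0) ^ n₂ * (fun v : E => conj (v.2 1)) ^ (n₁ - 1))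
      ring
  · obtain ⟨s, hs, h⟩ := pow_mul_pow_eq_of_weight A hm₂ hm (z_mul_conj_z_mem _ _ _ _ 2)
      (z_mul_conj_z_mem _ _ _ _ 3) (resonant₂_mem _ _ _ _) (conj_resonant₂_mem _ _ _ _) h2
    refine ⟨_, mul_mem (x₁_mem p.1) (mul_mem (pair₁_mem hn₂ hn h1) hs), h.imp ?_ ?_⟩
    · intro h; rw [h]; change _ = _ * (fun v : E => v.2 2); ring
    · intro h; rw [h]
      change _ = _ * ((fun v : E => conj (v.2 2)) ^ (m₂ - 1) * (fun v : E => v.2 3) ^ m₁)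
      ring
  · obtain ⟨s, hs, h⟩ := pow_mul_pow_eq_of_weight A hm₁ hm.symm (z_mul_conj_z_mem _ _ _ _ 3)
      (z_mul_conj_z_mem _ _ _ _ 2) (by rw [mul_comm]; exact conj_resonant₂_mem _ _ _ _)
      (by rw [mul_comm]; exact resonant₂_mem _ _ _ _) ((add_comm _ _).trans h2)
    refine ⟨_, mul_mem (x₁_mem p.1) (mul_mem (pair₁_mem hn₂ hn h1) hs), h.imp ?_ ?_⟩
    · intro h; rw [mul_comm (_ * _) (_ ^ p.2.2.1 3 * _), h]
      change _ = _ * (fun v : E => v.2 3); ring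
    · intro h; rw [mul_comm (_ * _) (_ ^ p.2.2.1 3 * _), h]
      change _ = _ * ((fun v : E => v.2 2) ^ m₂ * (fun v : E => conj (v.2 3)) ^ (m₁ - 1))
      ring

variable (n₁ n₂ m₁ m₂) in
/-- The combinations of `H₀, …, H₁₇` with coefficients in the ring generated by `u₁, …, u₉`. -/
noncomputable def sModule : Submodule ℝ (E → E) :=
  Submodule.span ℝ {g | ∃ p ∈ sRing n₁ n₂ m₁ m₂, ∃ j, g = fun v => p v • H n₁ n₂ m₁ m₂ j v}

theorem smul_H_mem {p : E → ℝ} (hp : p ∈ sRing n₁ n₂ m₁ m₂) (j : ℕ) :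
    (fun v => p v • H n₁ n₂ m₁ m₂ j v) ∈ sModule n₁ n₂ m₁ m₂ :=
  Submodule.subset_span ⟨p, hp, j, rfl⟩

/-- A complex coefficient `F` acts on `f` as `Re F · f + Im F · (I f)`, and consecutive indices
carry exactly `f` and `I f`. -/
theorem single_mul_mem {j : Fin 4} {f F : E → ℂ} {k : ℕ}
    (hk : H n₁ n₂ m₁ m₂ k = fun v => (0, Pi.single j (f v)))
    (hk' : H n₁ n₂ m₁ m₂ (k + 1) = fun v => (0, Pi.single j (Complex.I * f v)))
    (hF : F ∈ complexify (sRing n₁ n₂ m₁ m₂)) :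
    (fun v => ((0, Pi.single j ((F * f) v)) : E)) ∈ sModule n₁ n₂ m₁ m₂ := by
  have e : (fun v => ((0, Pi.single j ((F * f) v)) : E)) =
      (fun v => (F v).re • H n₁ n₂ m₁ m₂ k v) + fun v => (F v).im • H n₁ n₂ m₁ m₂ (k + 1) v := by
    funext v
    rw [hk, hk']
    refine Prod.ext (by simp) ?_
    simp only [Pi.add_apply, Prod.snd_add, Prod.smul_snd, ← Pi.single_smul, ← Pi.single_add,
      Pi.mul_apply]
    congr 1
    conv_lhs => rw [← Complex.re_add_im (F v)]
    simp only [Complex.real_smul]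
    ring
  rw [e]
  exact add_mem (smul_H_mem hF.1 k) (smul_H_mem hF.2 (k + 1))

theorem H_z (j : Fin 4) : H n₁ n₂ m₁ m₂ (4 * j + 2) = (fun v => (0, Pi.single j (v.2 j))) ∧
    H n₁ n₂ m₁ m₂ (4 * j + 2 + 1) = (fun v => (0, Pi.single j (Complex.I * v.2 j))) := by
  constructor <;> funext v <;> refine Prod.ext ?_ (funext fun i => ?_) <;> fin_cases j <;>
    first | rfl | (fin_cases i <;> simp [H])

theorem H_zResonant (j : Fin 4) :
    H n₁ n₂ m₁ m₂ (4 * j + 4) = (fun v => (0, Pi.single j (zResonant n₁ n₂ m₁ m₂ j v))) ∧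
    H n₁ n₂ m₁ m₂ (4 * j + 4 + 1) =
      (fun v => (0, Pi.single j (Complex.I * zResonant n₁ n₂ m₁ m₂ j v))) := by
  constructor <;> funext v <;> refine Prod.ext ?_ (funext fun i => ?_) <;> fin_cases j <;>
    first | rfl | (fin_cases i <;> simp [H, zResonant])

/-- Every function in the ring of `S`-invariants is affine in `x₁` up to a multiple of `x₁`. -/
theorem sRing_split {f : E → ℝ} (hf : f ∈ sRing n₁ n₂ m₁ m₂) :
    ∃ q ∈ sRing n₁ n₂ m₁ m₂, ∀ v : E, f v = v.1 0 * q v + f (![0, v.1 1], v.2) := by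
  suffices h : ∃ q ∈ sRing n₁ n₂ m₁ m₂, (∀ v : E, f v = v.1 0 * q v + f (![0, v.1 1], v.2)) ∧
      (fun v : E => f (![0, v.1 1], v.2)) ∈ sRing n₁ n₂ m₁ m₂ by
    obtain ⟨q, hq, h, _⟩ := h
    exact ⟨q, hq, h⟩
  induction hf using Algebra.adjoin_induction with
  | mem f hf =>
    obtain ⟨i, rfl⟩ := hf
    by_cases hi : i = 1
    · subst hi
      exact ⟨1, one_mem _, fun v => by simp [u], zero_mem (sRing n₁ n₂ m₁ m₂)⟩
    · have e : ∀ v : E, u n₁ n₂ m₁ m₂ i (![0, v.1 1], v.2) = u n₁ n₂ m₁ m₂ i v := fun v => by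
        unfold u
        split <;> first | rfl | exact absurd rfl hi
      refine ⟨0, zero_mem _, fun v => by simp [e], ?_⟩
      simp only [e]
      exact u_mem_sRing _ _ _ _ i
  | algebraMap r =>
    exact ⟨0, zero_mem _, fun v => by simp, Subalgebra.algebraMap_mem (sRing n₁ n₂ m₁ m₂) r⟩
  | add f g _ _ hf hg =>
    obtain ⟨q, hq, h, h0⟩ := hf
    obtain ⟨q', hq', h', h0'⟩ := hg
    refine ⟨q + q', add_mem hq hq', fun v => ?_, add_mem h0 h0'⟩
    simp only [Pi.add_apply]
    linarith [h v, h' v]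
  | mul f g _ hg0 hf hg =>
    obtain ⟨q, hq, h, h0⟩ := hf
    obtain ⟨q', hq', h', h0'⟩ := hg
    refine ⟨q * g + (fun v : E => f (![0, v.1 1], v.2)) * q',
      add_mem (mul_mem hq hg0) (mul_mem h0 hq'), fun v => ?_, mul_mem h0 h0'⟩
    simp only [Pi.add_apply, Pi.mul_apply]
    rw [h v]
    conv_lhs => rw [h' v]
    conv_rhs => rw [h' v]
    ring

/-- The `j`-th component is a shear-invariant scalar polynomial with the torus weight of `z_j`. The
monomials of that weight are `S`-invariant multiples of `z_j` or of the resonant monomial. -/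
theorem z_component_mem_sModule (hn₁ : n₁ ≠ 0) (hn₂ : n₂ ≠ 0) (hm₁ : m₁ ≠ 0) (hm₂ : m₂ ≠ 0)
    (hn : Nat.Coprime n₁ n₂) (hm : Nat.Coprime m₁ m₂) {g : E → E} (hg : IsPolyMap g)
    (hs : ∀ s v, g (repS n₁ n₂ m₁ m₂ s v) = repS n₁ n₂ m₁ m₂ s (g v)) (j : Fin 4) :
    (fun v => ((0, Pi.single j ((g v).2 j)) : E)) ∈ sModule n₁ n₂ m₁ m₂ := by
  have hF : (fun v => (g v).2 j) ∈ cpoly := mem_cpoly_iff.2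
    ⟨hg (Complex.reLm ∘ₗ (LinearMap.proj j : (Fin 4 → ℂ) →ₗ[ℝ] ℂ) ∘ₗ
      LinearMap.snd ℝ (Fin 2 → ℝ) (Fin 4 → ℂ)),
    hg (Complex.imLm ∘ₗ (LinearMap.proj j : (Fin 4 → ℂ) →ₗ[ℝ] ℂ) ∘ₗ
      LinearMap.snd ℝ (Fin 2 → ℝ) (Fin 4 → ℂ))⟩
  have h := mem_span_mon_of_equivariant n₁ n₂ m₁ m₂ (w := zWeight n₁ n₂ m₁ m₂ j) hF
    (fun s v => by rw [hs]; simp [repS])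
    (fun θ v => by
      rw [hs, torusChar_apply]
      fin_cases j <;> simp [repS, torusElt, zWeight])
  obtain ⟨a, ha, b, hb, e⟩ := exists_mul_add_mul h
    fun p hp => mon_eq_of_zWeight hn₁ hn₂ hm₁ hm₂ hn hm j hp.1 hp.2
  have e' : (fun v => ((0, Pi.single j ((g v).2 j)) : E)) =
      (fun v => ((0, Pi.single j ((a * fun v : E => v.2 j) v)) : E)) +
      fun v => ((0, Pi.single j ((b * zResonant n₁ n₂ m₁ m₂ j) v)) : E) := by
    funext v
    refine Prod.ext (by simp) ?_
    simp only [Pi.add_apply, Prod.snd_add, ← Pi.single_add]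
    congr 1
    exact congrFun e v
  rw [e']
  exact add_mem (single_mul_mem (H_z j).1 (H_z j).2 ha)
    (single_mul_mem (H_zResonant j).1 (H_zResonant j).2 hb)

theorem eq_of_eq_of_x₁_ne_zero {f g : E → ℝ} (hf : Continuous f) (hg : Continuous g)
    (h : ∀ v : E, v.1 0 ≠ 0 → f v = g v) (v : E) : f v = g v :=
  congrFun (Continuous.ext_on dense_x_ne_zero hf hg fun v hv => h v hv) v

/-- Let `(g₁, g₂)` be the `x`-components. Equivariance under shears forces `g₁` to be divisible by
`x₁`. If `g₁ = x₁ q`, then `g₂ = g₂(x₁, 0, z) + x₂ q`, so the pair is `q H₀ + g₂(x₁, 0, z) H₁`. -/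
theorem x_component_mem_sModule (hn₂ : n₂ ≠ 0) (hm₂ : m₂ ≠ 0)
    (hn : Nat.Coprime n₁ n₂) (hm : Nat.Coprime m₁ m₂) {g : E → E} (hg : IsPolyMap g)
    (hs : ∀ s v, g (repS n₁ n₂ m₁ m₂ s v) = repS n₁ n₂ m₁ m₂ s (g v)) :
    (fun v => (((g v).1, 0) : E)) ∈ sModule n₁ n₂ m₁ m₂ := by
  have hp : ∀ i, (fun v => (g v).1 i) ∈ polyFun E := fun i =>
    hg ((LinearMap.proj i) ∘ₗ LinearMap.fst ℝ (Fin 2 → ℝ) (Fin 4 → ℂ))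
  have hs0 : ∀ s v, (g (repS n₁ n₂ m₁ m₂ s v)).1 0 = (g v).1 0 := fun s v => by
    rw [hs]; simp [repS]
  have hs1 : ∀ s v, (g (repS n₁ n₂ m₁ m₂ s v)).1 1 = s.1.toAdd * (g v).1 0 + (g v).1 1 :=
    fun s v => by rw [hs]; simp [repS]
  obtain ⟨q, hq, hq'⟩ := sRing_split (mem_sRing_of_invariant hn₂ hm₂ hn hm (hp 0) hs0)
  have hcont : ∀ {f : E → ℝ}, f ∈ polyFun E → Continuous f := fun hf =>
    (contDiff_of_mem_polyFun hf).continuous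
  have hgc : ∀ i, Continuous fun v => (g v).1 i := fun i => hcont (hp i)
  have hx : ∀ i, Continuous fun v : E => v.1 i := fun i => by fun_prop
  have hshear : ∀ v : E, v.1 0 ≠ 0 →
      repS n₁ n₂ m₁ m₂ (Multiplicative.ofAdd (-(v.1 1) / v.1 0), 1) v = dropX₂ v :=
    fun v hv => by
      refine Prod.ext (funext fun i => ?_) (funext fun j => ?_)
      · fin_cases i <;> simp [repS, dropX₂, hv]
      · simp [repS, dropX₂]
  -- The shear with `s = -x₂ / x₁`, cleared of denominators so that the identity also holds on `x₁ =
  -- 0`.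
  have hmul : ∀ v, v.1 0 * (g v).1 1 = v.1 0 * (g (dropX₂ v)).1 1 + v.1 1 * (g v).1 0 := by
    refine eq_of_eq_of_x₁_ne_zero (f := fun v => v.1 0 * (g v).1 1)
      (g := fun v => v.1 0 * (g (dropX₂ v)).1 1 + v.1 1 * (g v).1 0)
      ((hx 0).mul (hgc 1)) (((hx 0).mul ((hgc 1).comp continuous_dropX₂)).add
      ((hx 1).mul (hgc 0))) fun v hv => ?_
    · have := hs1 (Multiplicative.ofAdd (-(v.1 1) / v.1 0), 1) v
      rw [hshear v hv, toAdd_ofAdd] at this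
      rw [this]
      field_simp
      ring
  -- On `x₁ = 0` the identity `hmul` reads `0 = x₂ g₁`. Taking `x₂ = 1` suffices, because `g₁` does
  -- not depend on `x₂`.
  have h00 : ∀ v : E, (g (![0, v.1 1], v.2)).1 0 = 0 := by
    have hind : ∀ v, (g v).1 0 = (g (dropX₂ v)).1 0 := by
      refine eq_of_eq_of_x₁_ne_zero (f := fun v => (g v).1 0) (g := fun v => (g (dropX₂ v)).1 0)
        (hgc 0) ((hgc 0).comp continuous_dropX₂) fun v hv => ?_
      rw [← hshear v hv, hs0]
    intro v
    have h1 := hmul (![0, 1], v.2)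
    have h2 := hind (![0, 1], v.2)
    have h3 := hind (![0, v.1 1], v.2)
    simp only [dropX₂, Matrix.cons_val_zero, Matrix.cons_val_one, zero_mul, zero_add,
      one_mul] at h1 h2 h3
    rw [h3, ← h2, ← h1]
  have hg0 : ∀ v, (g v).1 0 = v.1 0 * q v := fun v => by rw [hq' v, h00, add_zero]
  have hdp : (fun v => (g (dropX₂ v)).1 1) ∈ polyFun E := by
    let A : E →ₗ[ℝ] E :=
      { toFun := dropX₂
        map_add' := fun v w => by
          refine Prod.ext (funext fun i => ?_) rfl
          fin_cases i <;> simp [dropX₂]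
        map_smul' := fun t v => by
          refine Prod.ext (funext fun i => ?_) rfl
          fin_cases i <;> simp [dropX₂] }
    exact polyFun_comp_linear (hp 1) A
  -- After the projection only the torus part of `S` acts, and it fixes the `x`-plane.
  have hr : (fun v => (g (dropX₂ v)).1 1) ∈ sRing n₁ n₂ m₁ m₂ := by
    refine mem_sRing_of_invariant hn₂ hm₂ hn hm hdp fun s v => ?_
    have : dropX₂ (repS n₁ n₂ m₁ m₂ s v) = repS n₁ n₂ m₁ m₂ (1, s.2) (dropX₂ v) := by
      refine Prod.ext (funext fun i => ?_) (funext fun j => ?_)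
      · fin_cases i <;> simp [repS, dropX₂]
      · simp [repS, dropX₂]
    rw [this, hs1]
    simp
  have hqc : Continuous q := by
    refine Algebra.adjoin_induction (p := fun f _ => Continuous f) ?_ ?_ ?_ ?_ hq
    · rintro _ ⟨i, rfl⟩
      unfold u
      split <;> fun_prop
    · intro r; exact continuous_const
    · intro f g _ _ hf hg; exact hf.add hg
    · intro f g _ _ hf hg; exact hf.mul hg
  have hg1 : ∀ v, (g v).1 1 = (g (dropX₂ v)).1 1 + v.1 1 * q v := by
    refine eq_of_eq_of_x₁_ne_zero (f := fun v => (g v).1 1)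
      (g := fun v => (g (dropX₂ v)).1 1 + v.1 1 * q v)
      (hgc 1) ((hcont hdp).add ((hx 1).mul hqc)) fun v hv => mul_left_cancel₀ hv ?_
    rw [hmul v, hg0]
    ring
  have e : (fun v => (((g v).1, 0) : E)) = (fun v => q v • H n₁ n₂ m₁ m₂ 0 v) +
      fun v => (g (dropX₂ v)).1 1 • H n₁ n₂ m₁ m₂ 1 v := by
    funext v
    refine Prod.ext (funext fun i => ?_) (by simp [H])
    fin_cases i
    · change (g v).1 0 = q v * v.1 0 + (g (dropX₂ v)).1 1 * 0
      rw [hg0]; ring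
    · change (g v).1 1 = q v * v.1 1 + (g (dropX₂ v)).1 1 * 1
      rw [hg1]; ring
  rw [e]
  exact add_mem (smul_H_mem hq 0) (smul_H_mem hr 1)

/-- Polynomial mappings equivariant under `S` are combinations of `H₀, …, H₁₇`. -/
theorem mem_sModule_of_equivariant (hn₁ : n₁ ≠ 0) (hn₂ : n₂ ≠ 0) (hm₁ : m₁ ≠ 0) (hm₂ : m₂ ≠ 0)
    (hn : Nat.Coprime n₁ n₂) (hm : Nat.Coprime m₁ m₂) {g : E → E} (hg : IsPolyMap g)
    (hs : ∀ s v, g (repS n₁ n₂ m₁ m₂ s v) = repS n₁ n₂ m₁ m₂ s (g v)) :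
    g ∈ sModule n₁ n₂ m₁ m₂ := by
  have e : g = (fun v => (((g v).1, 0) : E)) +
      ∑ j : Fin 4, fun v => ((0, Pi.single j ((g v).2 j)) : E) := by
    funext v
    rw [Pi.add_apply, Finset.sum_apply]
    refine Prod.ext (by simp [Prod.fst_sum]) ?_
    simp only [Prod.snd_add, Prod.snd_sum, zero_add]
    exact (Finset.univ_sum_single _).symm
  rw [e]
  exact add_mem (x_component_mem_sModule hn₂ hm₂ hn hm hg hs)
    (sum_mem fun j _ => z_component_mem_sModule hn₁ hn₂ hm₁ hm₂ hn hm hg hs j)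

end SInvariants

/-! ### Signs of the generators under the involutions. -/

section Signs

variable (a : Fin 5 → ℤˣ) (n₁ n₂ m₁ m₂ : ℕ)

theorem unit_cast_sq (e : ℤˣ) : (((e : ℤ) : ℝ)) * ((e : ℤ) : ℝ) = 1 := by
  rcases Int.units_eq_one_or e with h | h <;> simp [h]

theorem al_sq : al a * al a = 1 := unit_cast_sq (a 0)

theorem ep_sq : ep a n₁ n₂ * ep a n₁ n₂ = 1 := by
  have h1 := unit_cast_sq (a 1)
  have h2 := unit_cast_sq (a 2)
  rw [ep, mul_mul_mul_comm, ← mul_pow, ← mul_pow, h1, h2, one_pow, one_pow, one_mul]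

theorem de_sq : de a m₁ m₂ * de a m₁ m₂ = 1 := by
  have h1 := unit_cast_sq (a 3)
  have h2 := unit_cast_sq (a 4)
  rw [de, mul_mul_mul_comm, ← mul_pow, ← mul_pow, h1, h2, one_pow, one_pow, one_mul]

theorem psi_apply_z (v : E) (j : Fin 4) : (psi a v).2 j = ((a j.succ : ℤ) : ℂ) * conj (v.2 j) := rfl

theorem psi_resonant₁ (v : E) : (psi a v).2 0 ^ n₂ * conj ((psi a v).2 1) ^ n₁ =
    (ep a n₁ n₂ : ℂ) * conj (v.2 0 ^ n₂ * conj (v.2 1) ^ n₁) := by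
  simp only [psi_apply_z, ep, map_mul, map_pow, mul_pow, Complex.conj_conj]
  simp
  ring

theorem psi_resonant₂ (v : E) : (psi a v).2 2 ^ m₂ * conj ((psi a v).2 3) ^ m₁ =
    (de a m₁ m₂ : ℂ) * conj (v.2 2 ^ m₂ * conj (v.2 3) ^ m₁) := by
  simp only [psi_apply_z, de, map_mul, map_pow, mul_pow, Complex.conj_conj]
  simp [show Fin.succ (2 : Fin 4) = 3 from rfl, show Fin.succ (3 : Fin 4) = 4 from rfl]
  ring

theorem normSq_psi (v : E) (j : Fin 4) :
    Complex.normSq ((psi a v).2 j) = Complex.normSq (v.2 j) := by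
  rw [psi_apply_z, map_mul, Complex.normSq_conj]
  rcases Int.units_eq_one_or (a j.succ) with h | h <;> simp [h]

theorem u_psi (v : E) : u n₁ n₂ m₁ m₂ 1 (psi a v) = al a * u n₁ n₂ m₁ m₂ 1 v ∧
    u n₁ n₂ m₁ m₂ 2 (psi a v) = u n₁ n₂ m₁ m₂ 2 v ∧
    u n₁ n₂ m₁ m₂ 3 (psi a v) = u n₁ n₂ m₁ m₂ 3 v ∧
    u n₁ n₂ m₁ m₂ 4 (psi a v) = ep a n₁ n₂ * u n₁ n₂ m₁ m₂ 4 v ∧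
    u n₁ n₂ m₁ m₂ 5 (psi a v) = -ep a n₁ n₂ * u n₁ n₂ m₁ m₂ 5 v ∧
    u n₁ n₂ m₁ m₂ 6 (psi a v) = u n₁ n₂ m₁ m₂ 6 v ∧
    u n₁ n₂ m₁ m₂ 7 (psi a v) = u n₁ n₂ m₁ m₂ 7 v ∧
    u n₁ n₂ m₁ m₂ 8 (psi a v) = de a m₁ m₂ * u n₁ n₂ m₁ m₂ 8 v ∧
    u n₁ n₂ m₁ m₂ 9 (psi a v) = -de a m₁ m₂ * u n₁ n₂ m₁ m₂ 9 v := by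
  refine ⟨rfl, normSq_psi a v 0, normSq_psi a v 1, ?_, ?_, normSq_psi a v 2, normSq_psi a v 3,
    ?_, ?_⟩ <;> simp only [u, psi_resonant₁, psi_resonant₂, Complex.re_ofReal_mul,
      Complex.im_ofReal_mul, Complex.conj_re, Complex.conj_im] <;> ring

/-- The eigenvalues of `H_k` under `H ↦ -ψ H ψ`. -/
def hSign : ℕ → ℝ
  | 0 => -1
  | 1 => al a
  | 2 => -1
  | 3 => 1
  | 4 => -ep a n₁ n₂
  | 5 => ep a n₁ n₂
  | 6 => -1
  | 7 => 1
  | 8 => -ep a n₁ n₂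
  | 9 => ep a n₁ n₂
  | 10 => -1
  | 11 => 1
  | 12 => -de a m₁ m₂
  | 13 => de a m₁ m₂
  | 14 => -1
  | 15 => 1
  | 16 => -de a m₁ m₂
  | 17 => de a m₁ m₂
  | _ => 1

theorem psi_single (j : Fin 4) (F : ℂ) :
    psi a (0, Pi.single j F) = (0, Pi.single j (((a j.succ : ℤ) : ℂ) * conj F)) := by
  refine Prod.ext (funext fun i => ?_) (funext fun i => ?_)
  · fin_cases i <;> simp [psi]
  · by_cases h : i = j
    · subst h; simp [psi]
    · simp [psi, h]

theorem unit_cast_sq_complex (e : ℤˣ) : (((e : ℤ) : ℂ)) * ((e : ℤ) : ℂ) = 1 := by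
  rcases Int.units_eq_one_or e with h | h <;> simp [h]

/-- The sign of the resonant generator of the `j`-th components. -/
def zSign : Fin 4 → ℝ := ![ep a n₁ n₂, ep a n₁ n₂, de a m₁ m₂, de a m₁ m₂]

variable {n₁ n₂ m₁ m₂}

theorem zResonant_psi (hn₁ : n₁ ≠ 0) (hn₂ : n₂ ≠ 0) (hm₁ : m₁ ≠ 0) (hm₂ : m₂ ≠ 0) (j : Fin 4)
    (v : E) : ((a j.succ : ℤ) : ℂ) * conj (zResonant n₁ n₂ m₁ m₂ j (psi a v)) =
      (zSign a n₁ n₂ m₁ m₂ j : ℂ) * zResonant n₁ n₂ m₁ m₂ j v := by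
  obtain ⟨n₁, rfl⟩ := Nat.exists_eq_succ_of_ne_zero hn₁
  obtain ⟨n₂, rfl⟩ := Nat.exists_eq_succ_of_ne_zero hn₂
  obtain ⟨m₁, rfl⟩ := Nat.exists_eq_succ_of_ne_zero hm₁
  obtain ⟨m₂, rfl⟩ := Nat.exists_eq_succ_of_ne_zero hm₂
  fin_cases j
  all_goals
    simp [zResonant, zSign, psi_apply_z, ep, de, mul_pow, Fin.succ]
    ring

/-- Since `ψ` is antilinear on each `z`-axis, a factor `I` reverses the sign, so each axis carries
the four signs `-1, 1, -s, s` with `s` the sign of its resonant monomial. `H₀` commutes with `ψ`,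
whence `-1`, and `ψ` multiplies the constant vector `H₁` by `-a₀`, whence `a₀`. The case `a = 1`
gives the signs under `φ`. -/
theorem neg_psi_H (hn₁ : n₁ ≠ 0) (hn₂ : n₂ ≠ 0) (hm₁ : m₁ ≠ 0) (hm₂ : m₂ ≠ 0) {k : ℕ}
    (hk : k ≤ 17) (v : E) : -psi a (H n₁ n₂ m₁ m₂ k (psi a v)) =
      hSign a n₁ n₂ m₁ m₂ k • H n₁ n₂ m₁ m₂ k v := by
  have hzz : ∀ j : Fin 4, -psi a (0, Pi.single j ((psi a v).2 j)) =
      (-1 : ℝ) • ((0, Pi.single j (v.2 j)) : E) := fun j => by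
    rw [psi_single, psi_apply_z, map_mul, Complex.conj_conj]
    simp [← mul_assoc, unit_cast_sq_complex]
  have hiz : ∀ j : Fin 4, -psi a (0, Pi.single j (Complex.I * (psi a v).2 j)) =
      (1 : ℝ) • ((0, Pi.single j (Complex.I * v.2 j)) : E) := fun j => by
    rw [psi_single, psi_apply_z, map_mul, map_mul, Complex.conj_conj, one_smul]
    have : ((a j.succ : ℤ) : ℂ) * (conj Complex.I * (conj ((a j.succ : ℤ) : ℂ) * v.2 j)) =
        -(Complex.I * v.2 j) := by
      have := unit_cast_sq_complex (a j.succ)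
      simp only [Complex.conj_I, map_intCast]
      linear_combination (-Complex.I * v.2 j) * this
    rw [this, Pi.single_neg]
    simp
  have hr : ∀ j : Fin 4, -psi a (0, Pi.single j (zResonant n₁ n₂ m₁ m₂ j (psi a v))) =
      (-zSign a n₁ n₂ m₁ m₂ j) • ((0, Pi.single j (zResonant n₁ n₂ m₁ m₂ j v)) : E) := fun j => by
    rw [psi_single, zResonant_psi a hn₁ hn₂ hm₁ hm₂, neg_smul]
    simp [← Pi.single_smul]
  have hir : ∀ j : Fin 4, -psi a (0, Pi.single j (Complex.I * zResonant n₁ n₂ m₁ m₂ j (psi a v))) =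
      (zSign a n₁ n₂ m₁ m₂ j) • ((0, Pi.single j (Complex.I * zResonant n₁ n₂ m₁ m₂ j v)) : E) :=
    fun j => by
    rw [psi_single, map_mul, mul_left_comm, zResonant_psi a hn₁ hn₂ hm₁ hm₂]
    have : conj Complex.I * ((zSign a n₁ n₂ m₁ m₂ j : ℂ) * zResonant n₁ n₂ m₁ m₂ j v) =
        -(zSign a n₁ n₂ m₁ m₂ j • (Complex.I * zResonant n₁ n₂ m₁ m₂ j v)) := by
      rw [Complex.conj_I, Complex.real_smul]; ring
    rw [this, Pi.single_neg]
    simp [← Pi.single_smul]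
  have key : ∀ j : Fin 4, ∀ w : E,
      H n₁ n₂ m₁ m₂ (4 * j + 2) w = (0, Pi.single j (w.2 j)) ∧
      H n₁ n₂ m₁ m₂ (4 * j + 3) w = (0, Pi.single j (Complex.I * w.2 j)) ∧
      H n₁ n₂ m₁ m₂ (4 * j + 4) w = (0, Pi.single j (zResonant n₁ n₂ m₁ m₂ j w)) ∧
      H n₁ n₂ m₁ m₂ (4 * j + 5) w = (0, Pi.single j (Complex.I * zResonant n₁ n₂ m₁ m₂ j w)) :=
    fun j w => ⟨congrFun (H_z j).1 w, congrFun (H_z j).2 w, congrFun (H_zResonant j).1 w,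
      congrFun (H_zResonant j).2 w⟩
  have h0 : -psi a (H n₁ n₂ m₁ m₂ 0 (psi a v)) =
      hSign a n₁ n₂ m₁ m₂ 0 • H n₁ n₂ m₁ m₂ 0 v := by
    have := al_sq a
    rw [al] at this
    refine Prod.ext (funext fun i => ?_) (funext fun i => ?_)
    · fin_cases i <;> simp [psi, H, hSign, ← mul_assoc, this]
    · simp [psi, H]
  have h1 : -psi a (H n₁ n₂ m₁ m₂ 1 (psi a v)) =
      hSign a n₁ n₂ m₁ m₂ 1 • H n₁ n₂ m₁ m₂ 1 v := by
    refine Prod.ext (funext fun i => ?_) (funext fun i => ?_)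
    · fin_cases i <;> simp [psi, H, hSign, al]
    · simp [psi, H]
  have fam : ∀ j : Fin 4, ∀ i ∈ ({2, 3, 4, 5} : Finset ℕ),
      -psi a (H n₁ n₂ m₁ m₂ (4 * j + i) (psi a v)) =
      (if i = 2 then -1 else if i = 3 then 1 else if i = 4 then -zSign a n₁ n₂ m₁ m₂ j
        else zSign a n₁ n₂ m₁ m₂ j) • H n₁ n₂ m₁ m₂ (4 * j + i) v := by
    intro j i hi
    obtain ⟨p2, p3, p4, p5⟩ := key j (psi a v)
    obtain ⟨q2, q3, q4, q5⟩ := key j v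
    simp only [Finset.mem_insert, Finset.mem_singleton] at hi
    rcases hi with rfl | rfl | rfl | rfl
    · rw [p2, q2, hzz]; simp
    · rw [p3, q3, hiz]; simp
    · rw [p4, q4, hr]; simp
    · rw [p5, q5, hir]; simp
  match k, hk with
  | 0, _ => exact h0
  | 1, _ => exact h1
  | 2, _ => exact fam 0 2 (by simp)
  | 3, _ => exact fam 0 3 (by simp)
  | 4, _ => exact fam 0 4 (by simp)
  | 5, _ => exact fam 0 5 (by simp)
  | 6, _ => exact fam 1 2 (by simp)
  | 7, _ => exact fam 1 3 (by simp)
  | 8, _ => exact fam 1 4 (by simp)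
  | 9, _ => exact fam 1 5 (by simp)
  | 10, _ => exact fam 2 2 (by simp)
  | 11, _ => exact fam 2 3 (by simp)
  | 12, _ => exact fam 2 4 (by simp)
  | 13, _ => exact fam 2 5 (by simp)
  | 14, _ => exact fam 3 2 (by simp)
  | 15, _ => exact fam 3 3 (by simp)
  | 16, _ => exact fam 3 4 (by simp)
  | 17, _ => exact fam 3 5 (by simp)
  | k + 18, hk => omega

end Signs

/-! ### Even and odd parts of the ring of `S`-invariants. -/

section Parity

variable (a : Fin 5 → ℤˣ) (n₁ n₂ m₁ m₂ : ℕ)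

/-- The algebra generated by the functions of the list `hilbertBasis`. -/
noncomputable def hilbertAlgebra : Subalgebra ℝ (E → ℝ) :=
  Algebra.adjoin ℝ {f | f ∈ hilbertBasis a n₁ n₂ m₁ m₂}

/-- The functions among `v₁, v₄, v₇, v₈` on which `ψ` acts by `-1`, the others being replaced
by `0`. -/
noncomputable def oddGens : Fin 4 → E → ℝ :=
  ![(1 - al a) • w n₁ n₂ m₁ m₂ 1, (1 - ep a n₁ n₂) • w n₁ n₂ m₁ m₂ 4,
    (1 - de a m₁ m₂) • w n₁ n₂ m₁ m₂ 7, (1 - ep a n₁ n₂ * de a m₁ m₂) • w n₁ n₂ m₁ m₂ 8]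

variable {a n₁ n₂ m₁ m₂}

theorem mem_hilbertAlgebra {f : E → ℝ} (i : ℕ) (r : ℝ) (hi : i < 18)
    (h : ∀ v, f v = r * ((hilbertBasis a n₁ n₂ m₁ m₂)[i]'hi) v) :
    f ∈ hilbertAlgebra a n₁ n₂ m₁ m₂ := by
  rw [show f = r • ((hilbertBasis a n₁ n₂ m₁ m₂)[i]'hi) from funext h]
  have hmem : (hilbertBasis a n₁ n₂ m₁ m₂)[i]'hi ∈ {f | f ∈ hilbertBasis a n₁ n₂ m₁ m₂} :=
    List.getElem_mem hi
  exact Subalgebra.smul_mem _ (Algebra.subset_adjoin hmem) r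

/-- A sign `χ` satisfies `(1 - χ)² = 2(1 - χ)`, so the square of an odd generator is twice an
element of the Hilbert basis. Products of two different ones are themselves elements of it. -/
theorem oddGens_mul_mem (i j : Fin 4) :
    oddGens a n₁ n₂ m₁ m₂ i * oddGens a n₁ n₂ m₁ m₂ j ∈ hilbertAlgebra a n₁ n₂ m₁ m₂ := by
  have hα := al_sq a
  have hε := ep_sq a n₁ n₂
  have hδ := de_sq a m₁ m₂
  wlog hij : i ≤ j generalizing i j
  · rw [mul_comm]; exact this j i (le_of_not_ge hij)
  set f := oddGens a n₁ n₂ m₁ m₂ i * oddGens a n₁ n₂ m₁ m₂ j with hf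
  have hfv : ∀ v, f v = oddGens a n₁ n₂ m₁ m₂ i v * oddGens a n₁ n₂ m₁ m₂ j v := fun _ => rfl
  clear_value f
  fin_cases i <;> fin_cases j <;> first
    | exact absurd hij (by decide)
    | simp only [oddGens, Fin.zero_eta, Fin.mk_one, Fin.reduceFinMk, Matrix.cons_val_zero,
        Matrix.cons_val_one, Matrix.cons_val, Pi.smul_apply, smul_eq_mul] at hfv
  · refine mem_hilbertAlgebra 8 2 (by norm_num) fun v => ?_
    simp only [hfv, hilbertBasis, List.getElem_cons_succ, List.getElem_cons_zero, Pi.smul_apply,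
      Pi.pow_apply, smul_eq_mul]
    linear_combination (w n₁ n₂ m₁ m₂ 1 v) ^ 2 * hα
  · refine mem_hilbertAlgebra 12 1 (by norm_num) fun v => ?_
    simp only [hfv, hilbertBasis, List.getElem_cons_succ, List.getElem_cons_zero, Pi.smul_apply,
      Pi.mul_apply, smul_eq_mul]
    ring
  · refine mem_hilbertAlgebra 13 1 (by norm_num) fun v => ?_
    simp only [hfv, hilbertBasis, List.getElem_cons_succ, List.getElem_cons_zero, Pi.smul_apply,
      Pi.mul_apply, smul_eq_mul]
    ring
  · refine mem_hilbertAlgebra 14 1 (by norm_num) fun v => ?_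
    simp only [hfv, hilbertBasis, List.getElem_cons_succ, List.getElem_cons_zero, Pi.smul_apply,
      Pi.mul_apply, smul_eq_mul]
    ring
  · refine mem_hilbertAlgebra 9 2 (by norm_num) fun v => ?_
    simp only [hfv, hilbertBasis, List.getElem_cons_succ, List.getElem_cons_zero, Pi.smul_apply,
      Pi.pow_apply, smul_eq_mul]
    linear_combination (w n₁ n₂ m₁ m₂ 4 v) ^ 2 * hε
  · refine mem_hilbertAlgebra 15 1 (by norm_num) fun v => ?_
    simp only [hfv, hilbertBasis, List.getElem_cons_succ, List.getElem_cons_zero, Pi.smul_apply,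
      Pi.mul_apply, smul_eq_mul]
    ring
  · refine mem_hilbertAlgebra 16 1 (by norm_num) fun v => ?_
    simp only [hfv, hilbertBasis, List.getElem_cons_succ, List.getElem_cons_zero, Pi.smul_apply,
      Pi.mul_apply, smul_eq_mul]
    ring
  · refine mem_hilbertAlgebra 10 2 (by norm_num) fun v => ?_
    simp only [hfv, hilbertBasis, List.getElem_cons_succ, List.getElem_cons_zero, Pi.smul_apply,
      Pi.pow_apply, smul_eq_mul]
    linear_combination (w n₁ n₂ m₁ m₂ 7 v) ^ 2 * hδ
  · refine mem_hilbertAlgebra 17 1 (by norm_num) fun v => ?_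
    simp only [hfv, hilbertBasis, List.getElem_cons_succ, List.getElem_cons_zero, Pi.smul_apply,
      Pi.mul_apply, smul_eq_mul]
    ring
  · refine mem_hilbertAlgebra 11 2 (by norm_num) fun v => ?_
    simp only [hfv, hilbertBasis, List.getElem_cons_succ, List.getElem_cons_zero, Pi.smul_apply,
      Pi.pow_apply, smul_eq_mul]
    linear_combination (w n₁ n₂ m₁ m₂ 8 v) ^ 2 *
      (hε * (de a m₁ m₂ * de a m₁ m₂) + hδ)

variable (a n₁ n₂ m₁ m₂) in
/-- The functions `p₀ + ∑ᵢ pᵢ wᵢ` with `p₀, pᵢ` in the Hilbert algebra and `wᵢ` the odd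
generators. -/
noncomputable def phiRing : Subalgebra ℝ (E → ℝ) where
  carrier := {f | ∃ p ∈ hilbertAlgebra a n₁ n₂ m₁ m₂, ∃ q : Fin 4 → E → ℝ,
    (∀ i, q i ∈ hilbertAlgebra a n₁ n₂ m₁ m₂) ∧ f = p + ∑ i, q i * oddGens a n₁ n₂ m₁ m₂ i}
  add_mem' := by
    rintro _ _ ⟨p, hp, q, hq, rfl⟩ ⟨p', hp', q', hq', rfl⟩
    refine ⟨p + p', add_mem hp hp', q + q', fun i => add_mem (hq i) (hq' i), ?_⟩
    simp only [Pi.add_apply, add_mul, Finset.sum_add_distrib]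
    ring
  mul_mem' := by
    rintro _ _ ⟨p, hp, q, hq, rfl⟩ ⟨p', hp', q', hq', rfl⟩
    refine ⟨p * p' + ∑ i, ∑ j, q i * q' j * (oddGens a n₁ n₂ m₁ m₂ i * oddGens a n₁ n₂ m₁ m₂ j),
      add_mem (mul_mem hp hp') (sum_mem fun i _ => sum_mem fun j _ =>
        mul_mem (mul_mem (hq i) (hq' j)) (oddGens_mul_mem i j)),
      fun i => p * q' i + q i * p', fun i => add_mem (mul_mem hp (hq' i)) (mul_mem (hq i) hp'), ?_⟩
    rw [add_mul, mul_add, mul_add, Finset.sum_mul_sum]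
    simp only [add_mul, Finset.sum_add_distrib, Finset.mul_sum, Finset.sum_mul]
    have h1 : ∀ i, p * (q' i * oddGens a n₁ n₂ m₁ m₂ i) = p * q' i * oddGens a n₁ n₂ m₁ m₂ i :=
      fun i => by ring
    have h2 : ∀ i, q i * oddGens a n₁ n₂ m₁ m₂ i * p' = q i * p' * oddGens a n₁ n₂ m₁ m₂ i :=
      fun i => by ring
    have h3 : ∀ i j, q i * oddGens a n₁ n₂ m₁ m₂ i * (q' j * oddGens a n₁ n₂ m₁ m₂ j) =
        q i * q' j * (oddGens a n₁ n₂ m₁ m₂ i * oddGens a n₁ n₂ m₁ m₂ j) := fun i j => by ring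
    simp only [h1, h2, h3]
    ring
  algebraMap_mem' r := ⟨algebraMap ℝ _ r, Subalgebra.algebraMap_mem _ r, 0,
    fun _ => zero_mem _, by simp⟩

theorem hilbertAlgebra_le_phiRing : hilbertAlgebra a n₁ n₂ m₁ m₂ ≤ phiRing a n₁ n₂ m₁ m₂ :=
  fun f hf => ⟨f, hf, 0, fun _ => zero_mem _, by simp⟩

theorem oddGens_mem (i : Fin 4) : oddGens a n₁ n₂ m₁ m₂ i ∈ phiRing a n₁ n₂ m₁ m₂ := by
  refine ⟨0, zero_mem _, Pi.single i 1, fun j => ?_, ?_⟩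
  · by_cases h : j = i
    · subst h; simp
    · simp [h]
  · rw [Finset.sum_eq_single i] <;> simp +contextual

/-- Each of `v₁, v₄, v₇, v₈` is half of `(1 + χ) v + (1 - χ) v`, a basis element plus an odd
generator; this needs no case distinction on the sign `χ`. -/
theorem w_mem_phiRing (i : ℕ) : w n₁ n₂ m₁ m₂ i ∈ phiRing a n₁ n₂ m₁ m₂ := by
  have even : ∀ {i} j (r : ℝ) (hj : j < 18),
      (∀ v, w n₁ n₂ m₁ m₂ i v = r * ((hilbertBasis a n₁ n₂ m₁ m₂)[j]'hj) v) →
      w n₁ n₂ m₁ m₂ i ∈ phiRing a n₁ n₂ m₁ m₂ :=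
    fun j r hj h => hilbertAlgebra_le_phiRing (mem_hilbertAlgebra j r hj h)
  have mixed : ∀ {i} j (hj : j < 18) (l : Fin 4), (∀ v, w n₁ n₂ m₁ m₂ i v =
      2⁻¹ * (((hilbertBasis a n₁ n₂ m₁ m₂)[j]'hj) v + oddGens a n₁ n₂ m₁ m₂ l v)) →
      w n₁ n₂ m₁ m₂ i ∈ phiRing a n₁ n₂ m₁ m₂ := fun {i} j hj l h => by
    rw [show w n₁ n₂ m₁ m₂ i = (2⁻¹ : ℝ) • ((hilbertBasis a n₁ n₂ m₁ m₂)[j]'hj +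
      oddGens a n₁ n₂ m₁ m₂ l) from funext h]
    exact Subalgebra.smul_mem _ (add_mem (hilbertAlgebra_le_phiRing
      (mem_hilbertAlgebra j 1 hj (by simp))) (oddGens_mem l)) _
  match i with
  | 0 => exact zero_mem (phiRing a n₁ n₂ m₁ m₂)
  | 1 => exact mixed 0 (by norm_num) 0 fun v => by simp [hilbertBasis, oddGens]; ring
  | 2 => exact even 1 1 (by norm_num) fun v => by simp [hilbertBasis]
  | 3 => exact even 2 1 (by norm_num) fun v => by simp [hilbertBasis]
  | 4 => exact mixed 3 (by norm_num) 1 fun v => by simp [hilbertBasis, oddGens]; ring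
  | 5 => exact even 4 1 (by norm_num) fun v => by simp [hilbertBasis]
  | 6 => exact even 5 1 (by norm_num) fun v => by simp [hilbertBasis]
  | 7 => exact mixed 6 (by norm_num) 2 fun v => by simp [hilbertBasis, oddGens]; ring
  | 8 => exact mixed 7 (by norm_num) 3 fun v => by simp [hilbertBasis, oddGens]; ring
  | i + 9 => exact zero_mem (phiRing a n₁ n₂ m₁ m₂)

/-- The identity `|Z|² = (Re Z)² + (Im Z)²` for a resonant monomial `Z`. It expresses `u₅²` and
`u₉²` through the `v`'s. -/
theorem sq_add_sq_eq (z z' : ℂ) (k l : ℕ) : ((z ^ k * conj z' ^ l).im) ^ 2 =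
    Complex.normSq z ^ k * Complex.normSq z' ^ l - ((z ^ k * conj z' ^ l).re) ^ 2 := by
  have h : Complex.normSq (z ^ k * conj z' ^ l) =
      Complex.normSq z ^ k * Complex.normSq z' ^ l := by
    simp [map_mul, map_pow]
  rw [← h, Complex.normSq_apply]
  ring

/-- The ring of `S`-invariants is generated by `1, u₅, u₉` over the ring of invariants of `φ`. -/
theorem exists_of_mem_sRing {f : E → ℝ} (hf : f ∈ sRing n₁ n₂ m₁ m₂) :
    ∃ p ∈ phiRing a n₁ n₂ m₁ m₂, ∃ q ∈ phiRing a n₁ n₂ m₁ m₂, ∃ r ∈ phiRing a n₁ n₂ m₁ m₂,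
      f = p + q * u n₁ n₂ m₁ m₂ 5 + r * u n₁ n₂ m₁ m₂ 9 := by
  have hw := fun i => w_mem_phiRing (a := a) (n₁ := n₁) (n₂ := n₂) (m₁ := m₁) (m₂ := m₂) i
  induction hf using Algebra.adjoin_induction with
  | mem f hf =>
    obtain ⟨i, rfl⟩ := hf
    have basic : ∀ j, u n₁ n₂ m₁ m₂ i = w n₁ n₂ m₁ m₂ j →
        ∃ p ∈ phiRing a n₁ n₂ m₁ m₂, ∃ q ∈ phiRing a n₁ n₂ m₁ m₂, ∃ r ∈ phiRing a n₁ n₂ m₁ m₂,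
      u n₁ n₂ m₁ m₂ i = p + q * u n₁ n₂ m₁ m₂ 5 + r * u n₁ n₂ m₁ m₂ 9 := fun j h =>
      ⟨_, hw j, 0, zero_mem _, 0, zero_mem _, by simp [h]⟩
    match i with
    | 0 => exact basic 0 rfl
    | 1 => exact basic 1 rfl
    | 2 => exact basic 2 rfl
    | 3 => exact basic 3 rfl
    | 4 => exact basic 4 rfl
    | 5 => exact ⟨0, zero_mem _, 1, one_mem _, 0, zero_mem _, by simp⟩
    | 6 => exact basic 5 rfl
    | 7 => exact basic 6 rfl
    | 8 => exact basic 7 rfl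
    | 9 => exact ⟨0, zero_mem _, 0, zero_mem _, 1, one_mem _, by simp⟩
    | i + 10 => exact basic 0 rfl
  | algebraMap r =>
    exact ⟨_, Subalgebra.algebraMap_mem _ r, 0, zero_mem _, 0, zero_mem _, by simp⟩
  | add f g _ _ hf hg =>
    obtain ⟨p, hp, q, hq, r, hr, rfl⟩ := hf
    obtain ⟨p', hp', q', hq', r', hr', rfl⟩ := hg
    exact ⟨p + p', add_mem hp hp', q + q', add_mem hq hq', r + r', add_mem hr hr', by ring⟩
  | mul f g _ _ hf hg =>
    obtain ⟨p, hp, q, hq, r, hr, rfl⟩ := hf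
    obtain ⟨p', hp', q', hq', r', hr', rfl⟩ := hg
    -- These three relations make the combinations of `1, u₅, u₉` over `phiRing` closed under
    -- multiplication.
    have h5 : u n₁ n₂ m₁ m₂ 5 ^ 2 =
        w n₁ n₂ m₁ m₂ 2 ^ n₂ * w n₁ n₂ m₁ m₂ 3 ^ n₁ - w n₁ n₂ m₁ m₂ 4 ^ 2 :=
      funext fun v => sq_add_sq_eq (v.2 0) (v.2 1) n₂ n₁
    have h9 : u n₁ n₂ m₁ m₂ 9 ^ 2 =
        w n₁ n₂ m₁ m₂ 5 ^ m₂ * w n₁ n₂ m₁ m₂ 6 ^ m₁ - w n₁ n₂ m₁ m₂ 7 ^ 2 :=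
      funext fun v => sq_add_sq_eq (v.2 2) (v.2 3) m₂ m₁
    have h59 : u n₁ n₂ m₁ m₂ 5 * u n₁ n₂ m₁ m₂ 9 = w n₁ n₂ m₁ m₂ 8 := rfl
    refine ⟨p * p' + q * q' * (w n₁ n₂ m₁ m₂ 2 ^ n₂ * w n₁ n₂ m₁ m₂ 3 ^ n₁ - w n₁ n₂ m₁ m₂ 4 ^ 2)
      + r * r' * (w n₁ n₂ m₁ m₂ 5 ^ m₂ * w n₁ n₂ m₁ m₂ 6 ^ m₁ - w n₁ n₂ m₁ m₂ 7 ^ 2)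
      + (q * r' + r * q') * w n₁ n₂ m₁ m₂ 8, ?_, p * q' + q * p',
      add_mem (mul_mem hp hq') (mul_mem hq hp'), p * r' + r * p',
      add_mem (mul_mem hp hr') (mul_mem hr hp'), ?_⟩
    · exact add_mem (add_mem (add_mem (mul_mem hp hp') (mul_mem (mul_mem hq hq')
        (sub_mem (mul_mem (pow_mem (hw 2) _) (pow_mem (hw 3) _)) (pow_mem (hw 4) _))))
        (mul_mem (mul_mem hr hr')
        (sub_mem (mul_mem (pow_mem (hw 5) _) (pow_mem (hw 6) _)) (pow_mem (hw 7) _))))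
        (mul_mem (add_mem (mul_mem hq hr') (mul_mem hr hq')) (hw 8))
    · rw [← h5, ← h9, ← h59]
      ring

end Parity

/-! ### Invariance under `φ` and `ψ` of functions already invariant under `S`. -/

section InvariantBehaviour

variable {a : Fin 5 → ℤˣ} {n₁ n₂ m₁ m₂ : ℕ}

theorem w_psi (v : E) (i : ℕ) : w n₁ n₂ m₁ m₂ i (psi a v) =
    (if i = 1 then al a else if i = 4 then ep a n₁ n₂ else if i = 7 then de a m₁ m₂ else
      if i = 8 then ep a n₁ n₂ * de a m₁ m₂ else 1) * w n₁ n₂ m₁ m₂ i v := by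
  obtain ⟨h1, h2, h3, h4, h5, h6, h7, h8, h9⟩ := u_psi a n₁ n₂ m₁ m₂ v
  match i with
  | 0 => simp [w]
  | 1 => simpa [w] using h1
  | 2 => simpa [w] using h2
  | 3 => simpa [w] using h3
  | 4 => simpa [w] using h4
  | 5 => simpa [w] using h6
  | 6 => simpa [w] using h7
  | 7 => simpa [w] using h8
  | 8 => simp [w, h5, h9]; ring
  | i + 9 => simp [w]

theorem psi_one : psi 1 = phi := rfl

theorem al_one : al 1 = 1 := by simp [al]

theorem ep_one : ep 1 n₁ n₂ = 1 := by simp [ep]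

theorem de_one : de 1 m₁ m₂ = 1 := by simp [de]

theorem w_phi (v : E) (i : ℕ) : w n₁ n₂ m₁ m₂ i (phi v) = w n₁ n₂ m₁ m₂ i v := by
  have := w_psi (a := 1) (n₁ := n₁) (n₂ := n₂) (m₁ := m₁) (m₂ := m₂) v i
  rw [psi_one, al_one, ep_one, de_one] at this
  simpa using this

theorem hilbertAlgebra_induction {p : (E → ℝ) → Prop} (h : ∀ f ∈ hilbertBasis a n₁ n₂ m₁ m₂, p f)
    (hc : ∀ r : ℝ, p (fun _ => r)) (hadd : ∀ f g, p f → p g → p (f + g))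
    (hmul : ∀ f g, p f → p g → p (f * g)) {f : E → ℝ} (hf : f ∈ hilbertAlgebra a n₁ n₂ m₁ m₂) :
    p f :=
  Algebra.adjoin_induction (p := fun f _ => p f) h hc (fun f g _ _ => hadd f g)
    (fun f g _ _ => hmul f g) hf

theorem eq_one_or_neg_one_of_mul_self {x : ℝ} (h : x * x = 1) : x = 1 ∨ x = -1 :=
  mul_self_eq_one_iff.1 h

/-- A factor `1 + χ` vanishes unless `ψ` fixes the function. A product `(1 - χ)(1 - χ')` vanishes
unless `ψ` negates both functions, in which case the two signs cancel. Squares are always fixed. -/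
theorem hilbertBasis_psi {f : E → ℝ} (hf : f ∈ hilbertBasis a n₁ n₂ m₁ m₂) (v : E) :
    f (psi a v) = f v := by
  have hw := fun i => w_psi (a := a) (n₁ := n₁) (n₂ := n₂) (m₁ := m₁) (m₂ := m₂) v i
  simp only [hilbertBasis, List.mem_cons, List.not_mem_nil, or_false] at hf
  rcases eq_one_or_neg_one_of_mul_self (al_sq a) with hα | hα <;>
  rcases eq_one_or_neg_one_of_mul_self (ep_sq a n₁ n₂) with hε | hε <;>
  rcases eq_one_or_neg_one_of_mul_self (de_sq a m₁ m₂) with hδ | hδ <;>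
  rw [hα, hε, hδ] at hf <;> simp only [hα, hε, hδ] at hw <;>
  rcases hf with h | h | h | h | h | h | h | h | h | h | h | h | h | h | h | h | h | h <;>
  simp [h, hw]

theorem hilbertBasis_phi {f : E → ℝ} (hf : f ∈ hilbertBasis a n₁ n₂ m₁ m₂) (v : E) :
    f (phi v) = f v := by
  simp only [hilbertBasis, List.mem_cons, List.not_mem_nil, or_false] at hf
  rcases hf with h | h | h | h | h | h | h | h | h | h | h | h | h | h | h | h | h | h <;>
  simp [h, w_phi]

theorem hilbertAlgebra_psi {f : E → ℝ} (hf : f ∈ hilbertAlgebra a n₁ n₂ m₁ m₂) :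
    ∀ v, f (psi a v) = f v :=
  hilbertAlgebra_induction (p := fun f => ∀ v, f (psi a v) = f v) (fun _ => hilbertBasis_psi)
    (fun _ _ => rfl) (fun f g hf hg v => by simp [hf v, hg v])
    (fun f g hf hg v => by simp [hf v, hg v]) hf

theorem hilbertAlgebra_phi {f : E → ℝ} (hf : f ∈ hilbertAlgebra a n₁ n₂ m₁ m₂) :
    ∀ v, f (phi v) = f v :=
  hilbertAlgebra_induction (p := fun f => ∀ v, f (phi v) = f v) (fun _ => hilbertBasis_phi)
    (fun _ _ => rfl) (fun f g hf hg v => by simp [hf v, hg v])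
    (fun f g hf hg v => by simp [hf v, hg v]) hf

theorem oddGens_psi (i : Fin 4) (v : E) :
    oddGens a n₁ n₂ m₁ m₂ i (psi a v) = -oddGens a n₁ n₂ m₁ m₂ i v := by
  have hα := al_sq a
  have hε := ep_sq a n₁ n₂
  have hδ := de_sq a m₁ m₂
  fin_cases i
  · simp [oddGens, w_psi]
    linear_combination (-w n₁ n₂ m₁ m₂ 1 v) * hα
  · simp [oddGens, w_psi]
    linear_combination (-w n₁ n₂ m₁ m₂ 4 v) * hε
  · simp [oddGens, w_psi]
    linear_combination (-w n₁ n₂ m₁ m₂ 7 v) * hδ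
  · simp [oddGens, w_psi]
    linear_combination (-w n₁ n₂ m₁ m₂ 8 v) * (hε * (de a m₁ m₂ * de a m₁ m₂) + hδ)

theorem oddGens_phi (i : Fin 4) (v : E) :
    oddGens a n₁ n₂ m₁ m₂ i (phi v) = oddGens a n₁ n₂ m₁ m₂ i v := by
  fin_cases i <;> simp [oddGens, w_phi]

theorem phiRing_phi {f : E → ℝ} (hf : f ∈ phiRing a n₁ n₂ m₁ m₂) (v : E) : f (phi v) = f v := by
  obtain ⟨p, hp, q, hq, rfl⟩ := hf
  simp only [Pi.add_apply, Finset.sum_apply, Pi.mul_apply, hilbertAlgebra_phi hp,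
    hilbertAlgebra_phi (hq _), oddGens_phi]

theorem u_phi_five (v : E) : u n₁ n₂ m₁ m₂ 5 (phi v) = -u n₁ n₂ m₁ m₂ 5 v := by
  have := (u_psi 1 n₁ n₂ m₁ m₂ v).2.2.2.2.1
  rwa [ep_one, neg_one_mul] at this

theorem u_phi_nine (v : E) : u n₁ n₂ m₁ m₂ 9 (phi v) = -u n₁ n₂ m₁ m₂ 9 v := by
  have := (u_psi 1 n₁ n₂ m₁ m₂ v).2.2.2.2.2.2.2.2
  rwa [de_one, neg_one_mul] at this

/-- Write `f = p + q u₅ + r u₉`. As `φ` fixes `p, q, r` and negates `u₅, u₉`, invariance under `φ`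
leaves `p`. Then `ψ` negates the odd generators appearing in `p`, so invariance under `ψ` leaves its
even part. -/
theorem mem_hilbertAlgebra_of_invariant {f : E → ℝ} (hf : f ∈ sRing n₁ n₂ m₁ m₂)
    (hφ : ∀ v, f (phi v) = f v) (hψ : ∀ v, f (psi a v) = f v) :
    f ∈ hilbertAlgebra a n₁ n₂ m₁ m₂ := by
  obtain ⟨p, hp, q, hq, r, hr, rfl⟩ := exists_of_mem_sRing (a := a) hf
  have h1 : ∀ v, q v * u n₁ n₂ m₁ m₂ 5 v + r v * u n₁ n₂ m₁ m₂ 9 v = 0 := fun v => by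
    have := hφ v
    simp only [Pi.add_apply, Pi.mul_apply, phiRing_phi hp, phiRing_phi hq, phiRing_phi hr,
      u_phi_five, u_phi_nine] at this
    linarith
  have h2 : p + q * u n₁ n₂ m₁ m₂ 5 + r * u n₁ n₂ m₁ m₂ 9 = p := by
    funext v
    simp only [Pi.add_apply, Pi.mul_apply]
    linarith [h1 v]
  rw [h2] at hψ ⊢
  obtain ⟨p, hp, q, hq, rfl⟩ := hp
  have h3 : p + ∑ i, q i * oddGens a n₁ n₂ m₁ m₂ i = p := by
    funext v
    have := hψ v
    simp only [Pi.add_apply, Finset.sum_apply, Pi.mul_apply, hilbertAlgebra_psi hp,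
      hilbertAlgebra_psi (hq _), oddGens_psi, mul_neg, Finset.sum_neg_distrib] at this ⊢
    linarith
  rwa [h3]

end InvariantBehaviour

/-! ### The Hilbert basis of `P(Γ)`. -/

section InvariantRing

variable {a : Fin 5 → ℤˣ} {n₁ n₂ m₁ m₂ : ℕ}

theorem repS_z (s : S) (v : E) (j : Fin 4) :
    (repS n₁ n₂ m₁ m₂ s v).2 j = (torusElt n₁ n₂ m₁ m₂ s.2 j : ℂ) * v.2 j := rfl

theorem resonant_torus (θ : Circle) (k l : ℕ) (z z' : ℂ) :
    (((θ ^ k : Circle) : ℂ) * z) ^ l * conj (((θ ^ l : Circle) : ℂ) * z') ^ k =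
      z ^ l * conj z' ^ k := by
  have h : (θ : ℂ) * conj (θ : ℂ) = 1 := by
    rw [Complex.mul_conj, Circle.normSq_coe, Complex.ofReal_one]
  calc _ = ((θ : ℂ) * conj (θ : ℂ)) ^ (k * l) * (z ^ l * conj z' ^ k) := by
        simp only [Circle.coe_pow, map_mul, map_pow, mul_pow, ← pow_mul, mul_comm l k]
        ring
    _ = _ := by rw [h, one_pow, one_mul]

theorem u_repS (s : S) (v : E) (i : ℕ) :
    u n₁ n₂ m₁ m₂ i (repS n₁ n₂ m₁ m₂ s v) = u n₁ n₂ m₁ m₂ i v := by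
  have hn : ∀ j, Complex.normSq ((repS n₁ n₂ m₁ m₂ s v).2 j) = Complex.normSq (v.2 j) := fun j => by
    rw [repS_z, map_mul, Circle.normSq_coe, one_mul]
  have h1 : (repS n₁ n₂ m₁ m₂ s v).2 0 ^ n₂ * conj ((repS n₁ n₂ m₁ m₂ s v).2 1) ^ n₁ =
      v.2 0 ^ n₂ * conj (v.2 1) ^ n₁ := resonant_torus s.2.1 n₁ n₂ (v.2 0) (v.2 1)
  have h2 : (repS n₁ n₂ m₁ m₂ s v).2 2 ^ m₂ * conj ((repS n₁ n₂ m₁ m₂ s v).2 3) ^ m₁ =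
      v.2 2 ^ m₂ * conj (v.2 3) ^ m₁ := resonant_torus s.2.2 m₁ m₂ (v.2 2) (v.2 3)
  unfold u
  split <;> first | rfl | exact hn _ | simp only [h1, h2]

theorem sRing_repS {f : E → ℝ} (hf : f ∈ sRing n₁ n₂ m₁ m₂) :
    ∀ s v, f (repS n₁ n₂ m₁ m₂ s v) = f v := by
  induction hf using Algebra.adjoin_induction with
  | mem f hf =>
    obtain ⟨i, rfl⟩ := hf
    exact fun s v => u_repS s v i
  | algebraMap r => exact fun _ _ => rfl
  | add f g _ _ hf hg => exact fun s v => by simp [hf s v, hg s v]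
  | mul f g _ _ hf hg => exact fun s v => by simp [hf s v, hg s v]

theorem sRing_le_polyFun : sRing n₁ n₂ m₁ m₂ ≤ polyFun E := by
  refine Algebra.adjoin_le ?_
  rintro _ ⟨i, rfl⟩
  have hz := z_mem_complexify
  have hn : ∀ j, (fun v : E => Complex.normSq (v.2 j)) ∈ polyFun E := fun j => by
    simp only [Complex.normSq_apply]
    exact add_mem (mul_mem (hz j).1 (hz j).1) (mul_mem (hz j).2 (hz j).2)
  have hr : ∀ (i j : Fin 4) (k l : ℕ), (fun v : E => v.2 i ^ k * conj (v.2 j) ^ l) ∈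
      complexify (polyFun E) := fun i j k l =>
    mul_mem (pow_mem (hz i) k) (pow_mem (conj_mem_complexify (hz j)) l)
  match i with
  | 0 => exact zero_mem (polyFun E)
  | 1 => exact x_mem_polyFun 0
  | 2 => exact hn 0
  | 3 => exact hn 1
  | 4 => exact (hr 0 1 n₂ n₁).1
  | 5 => exact (hr 0 1 n₂ n₁).2
  | 6 => exact hn 2
  | 7 => exact hn 3
  | 8 => exact (hr 2 3 m₂ m₁).1
  | 9 => exact (hr 2 3 m₂ m₁).2
  | i + 10 => exact zero_mem (polyFun E)

theorem hilbertAlgebra_le_sRing : hilbertAlgebra a n₁ n₂ m₁ m₂ ≤ sRing n₁ n₂ m₁ m₂ := by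
  have hw : ∀ i, w n₁ n₂ m₁ m₂ i ∈ sRing n₁ n₂ m₁ m₂ := fun i => by
    unfold w
    split <;> first | exact u_mem_sRing _ _ _ _ _ | exact zero_mem _ |
      exact mul_mem (u_mem_sRing _ _ _ _ _) (u_mem_sRing _ _ _ _ _)
  refine Algebra.adjoin_le fun f hf => ?_
  simp only [hilbertBasis, Set.mem_ofPred_eq, List.mem_cons, List.not_mem_nil, or_false] at hf
  rcases hf with rfl | rfl | rfl | rfl | rfl | rfl | rfl | rfl | rfl | rfl | rfl | rfl | rfl | rfl |
    rfl | rfl | rfl | rfl <;>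
  first
    | exact hw _
    | exact Subalgebra.smul_mem _ (hw _) _
    | exact Subalgebra.smul_mem _ (pow_mem (hw _) _) _
    | exact Subalgebra.smul_mem _ (mul_mem (hw _) (hw _)) _

theorem rep_inl (s : S) : rep a n₁ n₂ m₁ m₂ (SemidirectProduct.inl s) = repS n₁ n₂ m₁ m₂ s := by
  simp [rep]

theorem rep_phi : rep a n₁ n₂ m₁ m₂ (SemidirectProduct.inr (-1, 1)) = phi := by
  simp [rep, repZ, involutionHom]

theorem rep_psi : rep a n₁ n₂ m₁ m₂ (SemidirectProduct.inr (1, -1)) = psi a := by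
  simp [rep, repZ, involutionHom]

/-- A function transforming correctly under `S`, `φ` and `ψ` transforms correctly under `Γ`. -/
theorem forall_gam_iff {W : Type*} [AddCommGroup W] [Module ℝ W] (T : Gam →* Module.End ℝ W)
    (g : E → W) : (∀ γ v, g (rep a n₁ n₂ m₁ m₂ γ v) = T γ (g v)) ↔
      (∀ s v, g (repS n₁ n₂ m₁ m₂ s v) = T (SemidirectProduct.inl s) (g v)) ∧
      (∀ v, g (phi v) = T (SemidirectProduct.inr (-1, 1)) (g v)) ∧
      ∀ v, g (psi a v) = T (SemidirectProduct.inr (1, -1)) (g v) := by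
  constructor
  · intro h
    refine ⟨fun s v => ?_, fun v => ?_, fun v => ?_⟩
    · rw [← h, rep_inl]
    · rw [← h, rep_phi]
    · rw [← h, rep_psi]
  · rintro ⟨hs, hφ, hψ⟩ γ v
    have mul : ∀ {x y : Gam}, (∀ v, g (rep a n₁ n₂ m₁ m₂ x v) = T x (g v)) →
        (∀ v, g (rep a n₁ n₂ m₁ m₂ y v) = T y (g v)) →
        ∀ v, g (rep a n₁ n₂ m₁ m₂ (x * y) v) = T (x * y) (g v) := fun hx hy v => by
      rw [map_mul, map_mul, Module.End.mul_apply, Module.End.mul_apply, hx, hy]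
    have hz : ∀ z : ℤˣ × ℤˣ, ∀ v, g (rep a n₁ n₂ m₁ m₂ (SemidirectProduct.inr z) v) =
        T (SemidirectProduct.inr z) (g v) := by
      have h1 : ∀ v, g (rep a n₁ n₂ m₁ m₂ (SemidirectProduct.inr (-1, 1)) v) =
        T (SemidirectProduct.inr (-1, 1)) (g v) := fun v => by rw [rep_phi, hφ]
      have h2 : ∀ v, g (rep a n₁ n₂ m₁ m₂ (SemidirectProduct.inr (1, -1)) v) =
        T (SemidirectProduct.inr (1, -1)) (g v) := fun v => by rw [rep_psi, hψ]
      rintro ⟨x, y⟩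
      rcases Int.units_eq_one_or x with rfl | rfl <;> rcases Int.units_eq_one_or y with rfl | rfl
      · intro v; rw [show ((1, 1) : ℤˣ × ℤˣ) = 1 from rfl]; simp
      · exact h2
      · exact h1
      · have := mul h1 h2
        rwa [← map_mul, Prod.mk_mul_mk, mul_one, one_mul] at this
    have := mul (x := SemidirectProduct.inl γ.left) (y := SemidirectProduct.inr γ.right)
      (fun v => by rw [rep_inl, hs]) (hz _) v
    rwa [SemidirectProduct.inl_left_mul_inr_right] at this

theorem mem_invariantRing_iff {f : E → ℝ} : f ∈ invariantRing (rep a n₁ n₂ m₁ m₂) ↔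
    f ∈ polyFun E ∧ (∀ s v, f (repS n₁ n₂ m₁ m₂ s v) = f v) ∧ (∀ v, f (phi v) = f v) ∧
      ∀ v, f (psi a v) = f v :=
  and_congr_right fun _ => by simpa using! forall_gam_iff (a := a) 1 f

theorem hilbertAlgebra_eq_invariantRing (hn₂ : n₂ ≠ 0) (hm₂ : m₂ ≠ 0) (hn : Nat.Coprime n₁ n₂)
    (hm : Nat.Coprime m₁ m₂) :
    hilbertAlgebra a n₁ n₂ m₁ m₂ = invariantRing (rep a n₁ n₂ m₁ m₂) := by
  refine le_antisymm (fun f hf => mem_invariantRing_iff.2 ?_) fun f hf => ?_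
  · exact ⟨sRing_le_polyFun (hilbertAlgebra_le_sRing hf), sRing_repS (hilbertAlgebra_le_sRing hf),
      hilbertAlgebra_phi hf, hilbertAlgebra_psi hf⟩
  · obtain ⟨hp, hs, hφ, hψ⟩ := mem_invariantRing_iff.1 hf
    exact mem_hilbertAlgebra_of_invariant (mem_sRing_of_invariant hn₂ hm₂ hn hm hp hs) hφ hψ

end InvariantRing

/-! ### Projection of multiples of an eigenvector onto the reversible mappings. -/

section Generators

variable {a : Fin 5 → ℤˣ} {n₁ n₂ m₁ m₂ : ℕ}

variable (a n₁ n₂ m₁ m₂) in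
/-- The combinations of the generators with coefficients in the Hilbert algebra. -/
noncomputable def genSpan : Submodule ℝ (E → E) :=
  Submodule.span ℝ {g | ∃ p ∈ hilbertAlgebra a n₁ n₂ m₁ m₂, ∃ J ∈ generators a n₁ n₂ m₁ m₂,
    g = fun v => p v • J v}

theorem mem_genSpan_of_row {c r : ℝ} {p q f : E → ℝ} {ks : List ℕ} {k : ℕ}
    (h : (c, p, ks) ∈ genRows a n₁ n₂ m₁ m₂) (hk : k ∈ ks)
    (hq : q ∈ hilbertAlgebra a n₁ n₂ m₁ m₂) (hf : ∀ v, f v = q v * (r * (c * p v))) :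
    (fun v => f v • H n₁ n₂ m₁ m₂ k v) ∈ genSpan a n₁ n₂ m₁ m₂ := by
  refine Submodule.subset_span ⟨r • q, Subalgebra.smul_mem _ hq r,
    fun v => (c * p v) • H n₁ n₂ m₁ m₂ k v, ?_, ?_⟩
  · exact List.mem_flatMap.2 ⟨_, h, List.mem_map.2 ⟨k, hk, rfl⟩⟩
  · funext v
    rw [hf, smul_smul, Pi.smul_apply, smul_eq_mul]
    ring_nf

variable (a n₁ n₂ m₁ m₂) in
/-- `K` is an eigenvector of `g ↦ -ψ g ψ` for the eigenvalue `t`, and the even part of its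
multiples by functions in `phiRing` are combinations of the generators. -/
structure IsReduced (K : E → E) (t : ℝ) : Prop where
  sign : ∀ v, -psi a (K (psi a v)) = t • K v
  even : ∀ q ∈ hilbertAlgebra a n₁ n₂ m₁ m₂,
    (fun v => (q v * (1 + t)) • K v) ∈ genSpan a n₁ n₂ m₁ m₂
  odd : ∀ i, ∀ q ∈ hilbertAlgebra a n₁ n₂ m₁ m₂,
    (fun v => (q v * ((1 - t) * oddGens a n₁ n₂ m₁ m₂ i v)) • K v) ∈ genSpan a n₁ n₂ m₁ m₂

/-- Write `f = p + ∑ qᵢ oᵢ` with `p, qᵢ` fixed by `ψ` and the `oᵢ` negated. Since `-ψKψ = tK`, the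
combination is `p (1 + t) K + ∑ qᵢ (1 - t) oᵢ K`, which is exactly what the fields `even` and `odd`
cover. -/
theorem IsReduced.mem_genSpan {K : E → E} {t : ℝ} (h : IsReduced a n₁ n₂ m₁ m₂ K t) {f : E → ℝ}
    (hf : f ∈ phiRing a n₁ n₂ m₁ m₂) :
    (fun v => f v • K v - psi a (f (psi a v) • K (psi a v))) ∈ genSpan a n₁ n₂ m₁ m₂ := by
  obtain ⟨p, hp, q, hq, rfl⟩ := hf
  have e : (fun v => (p + ∑ i, q i * oddGens a n₁ n₂ m₁ m₂ i) v • K v -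
      psi a ((p + ∑ i, q i * oddGens a n₁ n₂ m₁ m₂ i) (psi a v) • K (psi a v))) =
      (fun v => (p v * (1 + t)) • K v) +
      ∑ i, fun v => (q i v * ((1 - t) * oddGens a n₁ n₂ m₁ m₂ i v)) • K v := by
    funext v
    rw [map_smul, sub_eq_add_neg, ← smul_neg, h.sign]
    simp only [Pi.add_apply, Finset.sum_apply, Pi.mul_apply, hilbertAlgebra_psi hp,
      hilbertAlgebra_psi (hq _), oddGens_psi, ← Finset.sum_smul, smul_smul, ← add_smul]
    congr 1
    simp only [mul_neg, Finset.sum_neg_distrib]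
    have : ∑ i, q i v * ((1 - t) * oddGens a n₁ n₂ m₁ m₂ i v) =
        (1 - t) * ∑ i, q i v * oddGens a n₁ n₂ m₁ m₂ i v := by
      rw [Finset.mul_sum]
      exact Finset.sum_congr rfl fun i _ => by ring
    rw [this]
    ring
  rw [e]
  exact add_mem (h.even p hp) (sum_mem fun i _ => h.odd i (q i) (hq i))

variable (a n₁ n₂ m₁ m₂) in
/-- The signs of `v₁, v₄, v₇, v₈` under `ψ`. -/
def vSign : Fin 4 → ℝ := ![al a, ep a n₁ n₂, de a m₁ m₂, ep a n₁ n₂ * de a m₁ m₂]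

/-- The indices of `v₁, v₄, v₇, v₈`. -/
def vIndex : Fin 4 → ℕ := ![1, 4, 7, 8]

theorem oddGens_apply (i : Fin 4) (v : E) : oddGens a n₁ n₂ m₁ m₂ i v =
    (1 - vSign a n₁ n₂ m₁ m₂ i) * w n₁ n₂ m₁ m₂ (vIndex i) v := by
  fin_cases i <;> rfl

/-- Reduces the two span conditions to finding rows of the table whose coefficients are proportional
to `1 + t` and to `(1 - t)(1 - χᵢ)`, with `χᵢ` the signs of `v₁, v₄, v₇, v₈`. For `t = 1` the second
family vanishes, and no row is required. -/
theorem isReduced_of_rows (hn₁ : n₁ ≠ 0) (hn₂ : n₂ ≠ 0) (hm₁ : m₁ ≠ 0) (hm₂ : m₂ ≠ 0)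
    {m : E → ℝ} {ks : List ℕ} {s t : ℝ} (hm : ∀ v, m (psi a v) = s * m v)
    (hks : ∀ k ∈ ks, k ≤ 17 ∧ s * hSign a n₁ n₂ m₁ m₂ k = t)
    (heven : ∃ c r, (c, m, ks) ∈ genRows a n₁ n₂ m₁ m₂ ∧ 1 + t = r * c)
    (hodd : t = 1 ∨ ∀ i, ∃ c r, (c, w n₁ n₂ m₁ m₂ (vIndex i) * m, ks) ∈ genRows a n₁ n₂ m₁ m₂ ∧
      (1 - t) * (1 - vSign a n₁ n₂ m₁ m₂ i) = r * c) {k : ℕ} (hk : k ∈ ks) :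
    IsReduced a n₁ n₂ m₁ m₂ (fun v => m v • H n₁ n₂ m₁ m₂ k v) t where
  sign v := by
    rw [map_smul, ← smul_neg, neg_psi_H a hn₁ hn₂ hm₁ hm₂ (hks k hk).1, hm, smul_smul, smul_smul,
      ← (hks k hk).2]
    congr 1
    ring
  even q hq := by
    obtain ⟨c, r, hrow, h⟩ := heven
    simp only [smul_smul]
    exact mem_genSpan_of_row hrow hk hq fun v => by rw [h]; ring
  odd i q hq := by
    rcases hodd with rfl | hodd
    · have e : (fun v => (q v * ((1 - 1) * oddGens a n₁ n₂ m₁ m₂ i v)) •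
          (m v • H n₁ n₂ m₁ m₂ k v)) = 0 := by funext v; simp
      rw [e]
      exact zero_mem _
    · obtain ⟨c, r, hrow, h⟩ := hodd i
      simp only [smul_smul]
      refine mem_genSpan_of_row (r := r) hrow hk hq fun v => ?_
      rw [oddGens_apply, ← mul_assoc (1 - t), h, Pi.mul_apply]
      ring

end Generators

/-! ### Matching the table of generators with the eigenvalues, block by block. -/

section Rows

variable (a : Fin 5 → ℤˣ) {n₁ n₂ m₁ m₂ : ℕ}

theorem forall_fin_four {P : Fin 4 → Prop} (h0 : P 0) (h1 : P 1) (h2 : P 2) (h3 : P 3) :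
    ∀ i, P i := by
  intro i; fin_cases i <;> assumption

/-- Here the eigenvalue coincides with the sign of `v₁`. For that index `(1 - t)²` equals `2(1 -
t)`, which explains the simpler coefficient in the table and the witness `2`. The other blocks with
`t ≠ 1` formally have one such coincidence as well. -/
theorem isReduced_H_one (hn₁ : n₁ ≠ 0) (hn₂ : n₂ ≠ 0) (hm₁ : m₁ ≠ 0) (hm₂ : m₂ ≠ 0) :
    ∀ k ∈ [1], IsReduced a n₁ n₂ m₁ m₂
      (fun v => (1 : E → ℝ) v • H n₁ n₂ m₁ m₂ k v) (al a) := by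
  have hα := al_sq a
  refine fun k hk => isReduced_of_rows (s := 1) hn₁ hn₂ hm₁ hm₂ (fun v => by simp)
    (fun k hk => ?_) ⟨1 + al a, 1, by simp [genRows], by ring⟩
    (Or.inr (forall_fin_four ⟨1 - al a, 2, by simp [genRows, vIndex], by
        simp only [vSign, Matrix.cons_val]; linear_combination hα⟩
      ⟨(1 - al a) * (1 - ep a n₁ n₂), 1,
        by simp [genRows, vIndex], by simp only [vSign, Matrix.cons_val]; ring⟩
      ⟨(1 - al a) * (1 - de a m₁ m₂), 1,
        by simp [genRows, vIndex], by simp only [vSign, Matrix.cons_val]; ring⟩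
      ⟨(1 - al a) * (1 - ep a n₁ n₂ * de a m₁ m₂), 1,
        by simp [genRows, vIndex], by simp only [vSign, Matrix.cons_val]; ring⟩)) hk
  fin_cases hk <;> exact ⟨by norm_num, by simp only [hSign]; ring1⟩

theorem isReduced_H_iz (hn₁ : n₁ ≠ 0) (hn₂ : n₂ ≠ 0) (hm₁ : m₁ ≠ 0) (hm₂ : m₂ ≠ 0) :
    ∀ k ∈ [3, 7, 11, 15], IsReduced a n₁ n₂ m₁ m₂
      (fun v => (1 : E → ℝ) v • H n₁ n₂ m₁ m₂ k v) (1) := by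
  refine fun k hk => isReduced_of_rows (s := 1) hn₁ hn₂ hm₁ hm₂ (fun v => by simp)
    (fun k hk => ?_) ⟨1, 2, by simp [genRows], by norm_num⟩ (Or.inl rfl) hk
  fin_cases hk <;> exact ⟨by norm_num, by simp only [hSign]; ring1⟩

theorem isReduced_H_ir₁ (hn₁ : n₁ ≠ 0) (hn₂ : n₂ ≠ 0) (hm₁ : m₁ ≠ 0) (hm₂ : m₂ ≠ 0) :
    ∀ k ∈ [5, 9], IsReduced a n₁ n₂ m₁ m₂
      (fun v => (1 : E → ℝ) v • H n₁ n₂ m₁ m₂ k v) (ep a n₁ n₂) := by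
  have hε := ep_sq a n₁ n₂
  refine fun k hk => isReduced_of_rows (s := 1) hn₁ hn₂ hm₁ hm₂ (fun v => by simp)
    (fun k hk => ?_) ⟨1 + ep a n₁ n₂, 1, by simp [genRows], by ring⟩
    (Or.inr (forall_fin_four ⟨(1 - al a) * (1 - ep a n₁ n₂), 1,
        by simp [genRows, vIndex], by simp only [vSign, Matrix.cons_val]; ring⟩
      ⟨1 - ep a n₁ n₂, 2, by simp [genRows, vIndex], by
        simp only [vSign, Matrix.cons_val]; linear_combination hε⟩
      ⟨(1 - ep a n₁ n₂) * (1 - de a m₁ m₂), 1,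
        by simp [genRows, vIndex], by simp only [vSign, Matrix.cons_val]; ring⟩
      ⟨(1 - ep a n₁ n₂) * (1 - ep a n₁ n₂ * de a m₁ m₂), 1,
        by simp [genRows, vIndex], by simp only [vSign, Matrix.cons_val]; ring⟩)) hk
  fin_cases hk <;> exact ⟨by norm_num, by simp only [hSign]; ring1⟩

theorem isReduced_H_ir₂ (hn₁ : n₁ ≠ 0) (hn₂ : n₂ ≠ 0) (hm₁ : m₁ ≠ 0) (hm₂ : m₂ ≠ 0) :
    ∀ k ∈ [13, 17], IsReduced a n₁ n₂ m₁ m₂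
      (fun v => (1 : E → ℝ) v • H n₁ n₂ m₁ m₂ k v) (de a m₁ m₂) := by
  have hδ := de_sq a m₁ m₂
  refine fun k hk => isReduced_of_rows (s := 1) hn₁ hn₂ hm₁ hm₂ (fun v => by simp)
    (fun k hk => ?_) ⟨1 + de a m₁ m₂, 1, by simp [genRows], by ring⟩
    (Or.inr (forall_fin_four ⟨(1 - al a) * (1 - de a m₁ m₂), 1,
        by simp [genRows, vIndex], by simp only [vSign, Matrix.cons_val]; ring⟩
      ⟨(1 - ep a n₁ n₂) * (1 - de a m₁ m₂), 1,
        by simp [genRows, vIndex], by simp only [vSign, Matrix.cons_val]; ring⟩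
      ⟨1 - de a m₁ m₂, 2, by simp [genRows, vIndex], by
        simp only [vSign, Matrix.cons_val]; linear_combination hδ⟩
      ⟨(1 - de a m₁ m₂) * (1 - ep a n₁ n₂ * de a m₁ m₂), 1,
        by simp [genRows, vIndex], by simp only [vSign, Matrix.cons_val]; ring⟩)) hk
  fin_cases hk <;> exact ⟨by norm_num, by simp only [hSign]; ring1⟩

theorem isReduced_u₅_H_z (hn₁ : n₁ ≠ 0) (hn₂ : n₂ ≠ 0) (hm₁ : m₁ ≠ 0) (hm₂ : m₂ ≠ 0) :
    ∀ k ∈ [0, 2, 6, 10, 14], IsReduced a n₁ n₂ m₁ m₂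
      (fun v => (u n₁ n₂ m₁ m₂ 5 : E → ℝ) v • H n₁ n₂ m₁ m₂ k v) (ep a n₁ n₂) := by
  have hε := ep_sq a n₁ n₂
  refine fun k hk => isReduced_of_rows (s := (-ep a n₁ n₂)) hn₁ hn₂ hm₁ hm₂
    (fun v => (u_psi a n₁ n₂ m₁ m₂ v).2.2.2.2.1)
    (fun k hk => ?_) ⟨1 + ep a n₁ n₂, 1, by simp [genRows], by ring⟩
    (Or.inr (forall_fin_four ⟨(1 - al a) * (1 - ep a n₁ n₂), 1,
        by simp [genRows, vIndex], by simp only [vSign, Matrix.cons_val]; ring⟩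
      ⟨1 - ep a n₁ n₂, 2, by simp [genRows, vIndex], by
        simp only [vSign, Matrix.cons_val]; linear_combination hε⟩
      ⟨(1 - ep a n₁ n₂) * (1 - de a m₁ m₂), 1,
        by simp [genRows, vIndex], by simp only [vSign, Matrix.cons_val]; ring⟩
      ⟨(1 - ep a n₁ n₂) * (1 - ep a n₁ n₂ * de a m₁ m₂), 1,
        by simp [genRows, vIndex], by simp only [vSign, Matrix.cons_val]; ring⟩)) hk
  fin_cases hk <;> exact ⟨by norm_num, by simp only [hSign]; ring1⟩

theorem isReduced_u₅_H_r₁ (hn₁ : n₁ ≠ 0) (hn₂ : n₂ ≠ 0) (hm₁ : m₁ ≠ 0) (hm₂ : m₂ ≠ 0) :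
    ∀ k ∈ [4, 8], IsReduced a n₁ n₂ m₁ m₂
      (fun v => (u n₁ n₂ m₁ m₂ 5 : E → ℝ) v • H n₁ n₂ m₁ m₂ k v) (1) := by
  have hε := ep_sq a n₁ n₂
  refine fun k hk => isReduced_of_rows (s := (-ep a n₁ n₂)) hn₁ hn₂ hm₁ hm₂
    (fun v => (u_psi a n₁ n₂ m₁ m₂ v).2.2.2.2.1)
    (fun k hk => ?_) ⟨1, 2, by simp [genRows], by norm_num⟩ (Or.inl rfl) hk
  fin_cases hk <;> exact ⟨by norm_num, by simp only [hSign]; linear_combination hε⟩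

theorem isReduced_u₅_H_r₂ (hn₁ : n₁ ≠ 0) (hn₂ : n₂ ≠ 0) (hm₁ : m₁ ≠ 0) (hm₂ : m₂ ≠ 0) :
    ∀ k ∈ [12, 16], IsReduced a n₁ n₂ m₁ m₂
      (fun v => (u n₁ n₂ m₁ m₂ 5 : E → ℝ) v • H n₁ n₂ m₁ m₂ k v) (ep a n₁ n₂ * de a m₁ m₂) := by
  have hε := ep_sq a n₁ n₂
  have hδ := de_sq a m₁ m₂
  refine fun k hk => isReduced_of_rows (s := (-ep a n₁ n₂)) hn₁ hn₂ hm₁ hm₂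
    (fun v => (u_psi a n₁ n₂ m₁ m₂ v).2.2.2.2.1)
    (fun k hk => ?_) ⟨1 + ep a n₁ n₂ * de a m₁ m₂, 1, by simp [genRows], by ring⟩
    (Or.inr (forall_fin_four ⟨(1 - al a) * (1 - ep a n₁ n₂ * de a m₁ m₂), 1,
        by simp [genRows, vIndex], by simp only [vSign, Matrix.cons_val]; ring⟩
      ⟨(1 - ep a n₁ n₂) * (1 - ep a n₁ n₂ * de a m₁ m₂), 1,
        by simp [genRows, vIndex], by simp only [vSign, Matrix.cons_val]; ring⟩
      ⟨(1 - de a m₁ m₂) * (1 - ep a n₁ n₂ * de a m₁ m₂), 1,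
        by simp [genRows, vIndex], by simp only [vSign, Matrix.cons_val]; ring⟩
      ⟨1 - ep a n₁ n₂ * de a m₁ m₂, 2, by simp [genRows, vIndex], by
        simp only [vSign, Matrix.cons_val]; linear_combination hε * (de a m₁ m₂ * de a m₁ m₂) + hδ⟩))
    hk
  fin_cases hk <;> exact ⟨by norm_num, by simp only [hSign]; ring1⟩

theorem isReduced_u₉_H_z (hn₁ : n₁ ≠ 0) (hn₂ : n₂ ≠ 0) (hm₁ : m₁ ≠ 0) (hm₂ : m₂ ≠ 0) :
    ∀ k ∈ [0, 2, 6, 10, 14], IsReduced a n₁ n₂ m₁ m₂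
      (fun v => (u n₁ n₂ m₁ m₂ 9 : E → ℝ) v • H n₁ n₂ m₁ m₂ k v) (de a m₁ m₂) := by
  have hδ := de_sq a m₁ m₂
  refine fun k hk => isReduced_of_rows (s := (-de a m₁ m₂)) hn₁ hn₂ hm₁ hm₂
    (fun v => (u_psi a n₁ n₂ m₁ m₂ v).2.2.2.2.2.2.2.2)
    (fun k hk => ?_) ⟨1 + de a m₁ m₂, 1, by simp [genRows], by ring⟩
    (Or.inr (forall_fin_four ⟨(1 - al a) * (1 - de a m₁ m₂), 1,
        by simp [genRows, vIndex], by simp only [vSign, Matrix.cons_val]; ring⟩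
      ⟨(1 - ep a n₁ n₂) * (1 - de a m₁ m₂), 1,
        by simp [genRows, vIndex], by simp only [vSign, Matrix.cons_val]; ring⟩
      ⟨1 - de a m₁ m₂, 2, by simp [genRows, vIndex], by
        simp only [vSign, Matrix.cons_val]; linear_combination hδ⟩
      ⟨(1 - de a m₁ m₂) * (1 - ep a n₁ n₂ * de a m₁ m₂), 1,
        by simp [genRows, vIndex], by simp only [vSign, Matrix.cons_val]; ring⟩)) hk
  fin_cases hk <;> exact ⟨by norm_num, by simp only [hSign]; ring1⟩

theorem isReduced_u₉_H_r₂ (hn₁ : n₁ ≠ 0) (hn₂ : n₂ ≠ 0) (hm₁ : m₁ ≠ 0) (hm₂ : m₂ ≠ 0) :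
    ∀ k ∈ [12, 16], IsReduced a n₁ n₂ m₁ m₂
      (fun v => (u n₁ n₂ m₁ m₂ 9 : E → ℝ) v • H n₁ n₂ m₁ m₂ k v) (1) := by
  have hδ := de_sq a m₁ m₂
  refine fun k hk => isReduced_of_rows (s := (-de a m₁ m₂)) hn₁ hn₂ hm₁ hm₂
    (fun v => (u_psi a n₁ n₂ m₁ m₂ v).2.2.2.2.2.2.2.2)
    (fun k hk => ?_) ⟨1, 2, by simp [genRows], by norm_num⟩ (Or.inl rfl) hk
  fin_cases hk <;> exact ⟨by norm_num, by simp only [hSign]; linear_combination hδ⟩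

theorem isReduced_u₉_H_r₁ (hn₁ : n₁ ≠ 0) (hn₂ : n₂ ≠ 0) (hm₁ : m₁ ≠ 0) (hm₂ : m₂ ≠ 0) :
    ∀ k ∈ [4, 8], IsReduced a n₁ n₂ m₁ m₂
      (fun v => (u n₁ n₂ m₁ m₂ 9 : E → ℝ) v • H n₁ n₂ m₁ m₂ k v) (ep a n₁ n₂ * de a m₁ m₂) := by
  have hε := ep_sq a n₁ n₂
  have hδ := de_sq a m₁ m₂
  refine fun k hk => isReduced_of_rows (s := (-de a m₁ m₂)) hn₁ hn₂ hm₁ hm₂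
    (fun v => (u_psi a n₁ n₂ m₁ m₂ v).2.2.2.2.2.2.2.2)
    (fun k hk => ?_) ⟨1 + ep a n₁ n₂ * de a m₁ m₂, 1, by simp [genRows], by ring⟩
    (Or.inr (forall_fin_four ⟨(1 - al a) * (1 - ep a n₁ n₂ * de a m₁ m₂), 1,
        by simp [genRows, vIndex], by simp only [vSign, Matrix.cons_val]; ring⟩
      ⟨(1 - ep a n₁ n₂) * (1 - ep a n₁ n₂ * de a m₁ m₂), 1,
        by simp [genRows, vIndex], by simp only [vSign, Matrix.cons_val]; ring⟩
      ⟨(1 - de a m₁ m₂) * (1 - ep a n₁ n₂ * de a m₁ m₂), 1,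
        by simp [genRows, vIndex], by simp only [vSign, Matrix.cons_val]; ring⟩
      ⟨1 - ep a n₁ n₂ * de a m₁ m₂, 2, by simp [genRows, vIndex], by
        simp only [vSign, Matrix.cons_val]; linear_combination hε * (de a m₁ m₂ * de a m₁ m₂) + hδ⟩))
    hk
  fin_cases hk <;> exact ⟨by norm_num, by simp only [hSign]; ring1⟩

end Rows

/-! ### Polynomiality, homogeneity and `S`-equivariance of `H₀, …, H₁₇`. -/

section SEquivariants

variable {n₁ n₂ m₁ m₂ : ℕ}

/-- Cuts the verification to `H₀`, `H₁` and two families: the complex factor `c` treats a mapping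
and its multiple by `I` together. Indices above `17` give the zero mapping. -/
theorem H_induction {P : (E → E) → Prop} (h0 : P (H n₁ n₂ m₁ m₂ 0)) (h1 : P (H n₁ n₂ m₁ m₂ 1))
    (hz : ∀ (j : Fin 4) (c : ℂ), P (fun v => (0, Pi.single j (c * v.2 j))))
    (hr : ∀ (j : Fin 4) (c : ℂ), P (fun v => (0, Pi.single j (c * zResonant n₁ n₂ m₁ m₂ j v))))
    (h : P 0) (k : ℕ) : P (H n₁ n₂ m₁ m₂ k) := by
  have key : ∀ j : Fin 4, P (H n₁ n₂ m₁ m₂ (4 * j + 2)) ∧ P (H n₁ n₂ m₁ m₂ (4 * j + 2 + 1)) ∧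
      P (H n₁ n₂ m₁ m₂ (4 * j + 4)) ∧ P (H n₁ n₂ m₁ m₂ (4 * j + 4 + 1)) := fun j => by
    rw [(H_z j).1, (H_z j).2, (H_zResonant j).1, (H_zResonant j).2]
    exact ⟨by simpa only [one_mul] using hz j 1, hz j _, by simpa only [one_mul] using hr j 1,
      hr j _⟩
  match k with
  | 0 => exact h0
  | 1 => exact h1
  | 2 => exact (key 0).1
  | 3 => exact (key 0).2.1
  | 4 => exact (key 0).2.2.1
  | 5 => exact (key 0).2.2.2
  | 6 => exact (key 1).1
  | 7 => exact (key 1).2.1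
  | 8 => exact (key 1).2.2.1
  | 9 => exact (key 1).2.2.2
  | 10 => exact (key 2).1
  | 11 => exact (key 2).2.1
  | 12 => exact (key 2).2.2.1
  | 13 => exact (key 2).2.2.2
  | 14 => exact (key 3).1
  | 15 => exact (key 3).2.1
  | 16 => exact (key 3).2.2.1
  | 17 => exact (key 3).2.2.2
  | k + 18 => exact h

theorem isPolyMap_complex_comp (e : ℂ →ₗ[ℝ] E) {F : E → ℂ} (hF : F ∈ complexify (polyFun E)) :
    IsPolyMap (fun v => e (F v)) := fun l => by
  have h : (fun v => l (e (F v))) =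
      (l (e 1)) • (fun v => (F v).re) + (l (e Complex.I)) • fun v => (F v).im := by
    funext v
    have h : F v = (F v).re • (1 : ℂ) + (F v).im • Complex.I := by simp
    conv_lhs => rw [h]
    simp only [map_add, map_smul, Pi.add_apply, Pi.smul_apply, smul_eq_mul, mul_comm]
  rw [h]
  exact add_mem (Subalgebra.smul_mem _ hF.1 _) (Subalgebra.smul_mem _ hF.2 _)

theorem isPolyMap_single (j : Fin 4) {F : E → ℂ} (hF : F ∈ complexify (polyFun E)) :
    IsPolyMap (fun v => ((0, Pi.single j (F v)) : E)) :=
  isPolyMap_complex_comp (LinearMap.inr ℝ (Fin 2 → ℝ) (Fin 4 → ℂ) ∘ₗ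
    LinearMap.single ℝ (fun _ => ℂ) j) hF

theorem isHomogPoly_single (j : Fin 4) {F : E → ℂ} (hF : F ∈ complexify (polyFun E)) {d : ℕ}
    (hd : ∀ (t : ℝ) v, F (t • v) = t ^ d • F v) :
    IsHomogPoly d (fun v => ((0, Pi.single j (F v)) : E)) := by
  refine ⟨isPolyMap_single j hF, fun t v => ?_⟩
  simp only [hd]
  refine Prod.ext (by simp) ?_
  simp [← Pi.single_smul]

theorem single_repS (j : Fin 4) {F : E → ℂ}
    (hF : ∀ s v, F (repS n₁ n₂ m₁ m₂ s v) = (torusElt n₁ n₂ m₁ m₂ s.2 j : ℂ) * F v)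
    (s : S) (v : E) :
    ((0, Pi.single j (F (repS n₁ n₂ m₁ m₂ s v))) : E) =
      repS n₁ n₂ m₁ m₂ s (0, Pi.single j (F v)) := by
  refine Prod.ext (funext fun i => ?_) (funext fun i => ?_)
  · fin_cases i <;> simp [repS]
  · rw [repS_z]
    by_cases h : i = j
    · subst h; simp [hF]
    · simp [h]

theorem zResonant_mem (j : Fin 4) : zResonant n₁ n₂ m₁ m₂ j ∈ complexify (polyFun E) := by
  have h : ∀ (i i' : Fin 4) (k l : ℕ), (fun v : E => conj (v.2 i) ^ k * v.2 i' ^ l) ∈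
      complexify (polyFun E) := fun i i' k l =>
    mul_mem (pow_mem (conj_mem_complexify (z_mem_complexify i)) k) (pow_mem (z_mem_complexify i') l)
  have h' : ∀ (i i' : Fin 4) (k l : ℕ), (fun v : E => v.2 i ^ k * conj (v.2 i') ^ l) ∈
      complexify (polyFun E) := fun i i' k l =>
    mul_mem (pow_mem (z_mem_complexify i) k) (pow_mem (conj_mem_complexify (z_mem_complexify i')) l)
  fin_cases j
  exacts [h _ _ _ _, h' _ _ _ _, h _ _ _ _, h' _ _ _ _]

theorem zResonant_homogeneous (j : Fin 4) :
    ∃ d : ℕ, ∀ (t : ℝ) v, zResonant n₁ n₂ m₁ m₂ j (t • v) = t ^ d • zResonant n₁ n₂ m₁ m₂ j v := by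
  have h : ∀ (i i' : Fin 4) (k l : ℕ) (t : ℝ) (v : E), conj ((t • v).2 i) ^ k * (t • v).2 i' ^ l =
      t ^ (k + l) • (conj (v.2 i) ^ k * v.2 i' ^ l) := fun i i' k l t v => by
    simp [mul_pow, pow_add]; ring
  have h' : ∀ (i i' : Fin 4) (k l : ℕ) (t : ℝ) (v : E), (t • v).2 i ^ k * conj ((t • v).2 i') ^ l =
      t ^ (k + l) • (v.2 i ^ k * conj (v.2 i') ^ l) := fun i i' k l t v => by
    simp [mul_pow, pow_add]; ring
  fin_cases j
  exacts [⟨_, h _ _ _ _⟩, ⟨_, h' _ _ _ _⟩, ⟨_, h _ _ _ _⟩, ⟨_, h' _ _ _ _⟩]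

theorem zResonant_repS (hn₁ : n₁ ≠ 0) (hn₂ : n₂ ≠ 0) (hm₁ : m₁ ≠ 0) (hm₂ : m₂ ≠ 0) (j : Fin 4)
    (s : S) (v : E) : zResonant n₁ n₂ m₁ m₂ j (repS n₁ n₂ m₁ m₂ s v) =
      (torusElt n₁ n₂ m₁ m₂ s.2 j : ℂ) * zResonant n₁ n₂ m₁ m₂ j v := by
  have hθ : ∀ θ : Circle, (θ : ℂ) * conj (θ : ℂ) = 1 := fun θ => by
    rw [Complex.mul_conj, Circle.normSq_coe, Complex.ofReal_one]
  have h : ∀ (θ : Circle) (k l : ℕ) (z z' : ℂ), l ≠ 0 →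
      conj (((θ ^ k : Circle) : ℂ) * z) ^ (l - 1) * (((θ ^ l : Circle) : ℂ) * z') ^ k =
      ((θ ^ k : Circle) : ℂ) * (conj z ^ (l - 1) * z' ^ k) := fun θ k l z z' hl => by
    obtain ⟨l, rfl⟩ := Nat.exists_eq_succ_of_ne_zero hl
    calc _ = ((θ : ℂ) * conj (θ : ℂ)) ^ (k * l) * ((θ : ℂ) ^ k * (conj z ^ l * z' ^ k)) := by
          simp only [Circle.coe_pow, map_mul, map_pow, mul_pow, ← pow_mul, Nat.succ_eq_add_one,
            Nat.add_sub_cancel]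
          ring
      _ = _ := by rw [hθ, one_pow, one_mul, Circle.coe_pow]; rfl
  have h' : ∀ (θ : Circle) (k l : ℕ) (z z' : ℂ), k ≠ 0 →
      (((θ ^ k : Circle) : ℂ) * z) ^ l * conj (((θ ^ l : Circle) : ℂ) * z') ^ (k - 1) =
      ((θ ^ l : Circle) : ℂ) * (z ^ l * conj z' ^ (k - 1)) := fun θ k l z z' hk => by
    rw [mul_comm, h θ l k z' z hk, mul_comm (z ^ l)]
  fin_cases j
  exacts [h s.2.1 n₁ n₂ _ _ hn₂, h' s.2.1 n₁ n₂ _ _ hn₁, h s.2.2 m₁ m₂ _ _ hm₂,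
    h' s.2.2 m₁ m₂ _ _ hm₁]

theorem exists_isHomogPoly_H (k : ℕ) : ∃ d, IsHomogPoly d (H n₁ n₂ m₁ m₂ k) := by
  refine H_induction (P := fun g => ∃ d, IsHomogPoly d g) ⟨1, ?_⟩ ⟨0, ?_⟩ (fun j c => ⟨1, ?_⟩)
    (fun j c => ?_) ⟨0, .zero 0⟩ k
  · exact ⟨IsPolyMap.linear (LinearMap.inl ℝ _ _ ∘ₗ LinearMap.fst ℝ (Fin 2 → ℝ) (Fin 4 → ℂ)),
      fun t v => by simp [H]⟩
  · exact ⟨fun l => Subalgebra.algebraMap_mem (polyFun E) (l (![0, 1], 0)), fun t v => by simp [H]⟩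
  · exact isHomogPoly_single j (mul_mem (Subalgebra.algebraMap_mem _ c) (z_mem_complexify j))
      fun t v => by simp; ring
  · obtain ⟨d, hd⟩ := zResonant_homogeneous (n₁ := n₁) (n₂ := n₂) (m₁ := m₁) (m₂ := m₂) j
    exact ⟨d, isHomogPoly_single j (mul_mem (Subalgebra.algebraMap_mem _ c) (zResonant_mem j))
      fun t v => by simp [hd]; ring⟩

theorem H_repS (hn₁ : n₁ ≠ 0) (hn₂ : n₂ ≠ 0) (hm₁ : m₁ ≠ 0) (hm₂ : m₂ ≠ 0) (k : ℕ) (s : S) (v : E) :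
    H n₁ n₂ m₁ m₂ k (repS n₁ n₂ m₁ m₂ s v) = repS n₁ n₂ m₁ m₂ s (H n₁ n₂ m₁ m₂ k v) := by
  refine H_induction (P := fun g => ∀ s v, g (repS n₁ n₂ m₁ m₂ s v) = repS n₁ n₂ m₁ m₂ s (g v))
    ?_ ?_ (fun j c => ?_) (fun j c => ?_)
    (fun s v => (map_zero _).symm) k s v
  · intro s v
    refine Prod.ext (funext fun i => ?_) (funext fun i => ?_)
    · fin_cases i <;> simp [repS, H]
    · simp [repS, H]
  · intro s v
    refine Prod.ext (funext fun i => ?_) (funext fun i => ?_)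
    · fin_cases i <;> simp [repS, H]
    · simp [repS, H]
  · exact single_repS (F := fun v => c * v.2 j) j fun s v => by rw [repS_z, mul_left_comm]
  · refine single_repS (F := fun v => c * zResonant n₁ n₂ m₁ m₂ j v) j fun s v => ?_
    rw [zResonant_repS hn₁ hn₂ hm₁ hm₂, mul_left_comm]

end SEquivariants

/-! ### Generators of the module of reversible-equivariants. -/

section RevEquivariants

variable {a : Fin 5 → ℤˣ} {n₁ n₂ m₁ m₂ : ℕ}

/-- The action of `Γ` twisted by `σ`. -/
noncomputable def twistedRep (a : Fin 5 → ℤˣ) (n₁ n₂ m₁ m₂ : ℕ) : Gam →* Module.End ℝ E where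
  toFun γ := (((sigma γ : ℤˣ) : ℤ) : ℝ) • rep a n₁ n₂ m₁ m₂ γ
  map_one' := by simp
  map_mul' x y := by
    rw [map_mul, map_mul, smul_mul_smul_comm]
    push_cast
    rfl

/-- Reversible-equivariance is ordinary equivariance towards the action twisted by `σ`, so it need
only be tested on `S`, `φ` and `ψ`. -/
theorem mem_revEquivariants_iff {g : E → E} :
    g ∈ revEquivariants (rep a n₁ n₂ m₁ m₂) sigma ↔ IsPolyMap g ∧
      (∀ s v, g (repS n₁ n₂ m₁ m₂ s v) = repS n₁ n₂ m₁ m₂ s (g v)) ∧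
      (∀ v, g (phi v) = -phi (g v)) ∧ ∀ v, g (psi a v) = -psi a (g v) := by
  have hT := fun γ (x : E) => show twistedRep a n₁ n₂ m₁ m₂ γ x =
    (((sigma γ : ℤˣ) : ℤ) : ℝ) • rep a n₁ n₂ m₁ m₂ γ x from rfl
  refine and_congr_right fun _ => (forall_gam_iff (twistedRep a n₁ n₂ m₁ m₂) g).trans ?_
  have h1 : ∀ s, sigma (SemidirectProduct.inl s) = 1 := fun s => by simp [sigma]
  have h2 : sigma (SemidirectProduct.inr (-1, 1)) = -1 := by simp [sigma, sigmaZ]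
  have h3 : sigma (SemidirectProduct.inr (1, -1)) = -1 := by simp [sigma, sigmaZ]
  simp only [hT, h1, h2, h3, rep_inl, rep_phi, rep_psi]
  simp

/-- Twice the projection onto the mappings reversed by `ψ`. -/
noncomputable def revSum (a : Fin 5 → ℤˣ) : (E → E) →ₗ[ℝ] (E → E) where
  toFun g := fun v => g v - psi a (g (psi a v))
  map_add' f g := by funext v; simp only [Pi.add_apply, map_add]; abel
  map_smul' r g := by
    funext v
    simp only [Pi.smul_apply, map_smul, RingHom.id_apply, smul_sub]

theorem revSum_eq_of_rev {g : E → E} (hg : ∀ v, g (psi a v) = -psi a (g v)) :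
    revSum a g = (2 : ℝ) • g := by
  have h : ∀ v, psi a (psi a v) = v := fun v => DFunLike.congr_fun (psi_mul_psi a) v
  funext v
  change g v - psi a (g (psi a v)) = (2 : ℝ) • g v
  rw [hg, map_neg, h, two_smul, sub_neg_eq_add]

theorem IsReduced.revSum_mem {m f : E → ℝ} {k : ℕ} {t : ℝ}
    (h : IsReduced a n₁ n₂ m₁ m₂ (fun v => m v • H n₁ n₂ m₁ m₂ k v) t)
    (hf : f ∈ phiRing a n₁ n₂ m₁ m₂) :
    revSum a (fun v => (f v * m v) • H n₁ n₂ m₁ m₂ k v) ∈ genSpan a n₁ n₂ m₁ m₂ := by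
  have := h.mem_genSpan hf
  simp only [smul_smul] at this
  exact this

/-- If `H_k` is reversed by `φ`, its coefficient must be fixed by `φ`. Otherwise the coefficient
must be negated by `φ`, so it comes through `u₅` and `u₉`. This dichotomy organises the table. -/
theorem isReduced_H_cases (a : Fin 5 → ℤˣ) (hn₁ : n₁ ≠ 0) (hn₂ : n₂ ≠ 0) (hm₁ : m₁ ≠ 0)
    (hm₂ : m₂ ≠ 0) {k : ℕ} (hk : k ≤ 17) :
    (hSign 1 n₁ n₂ m₁ m₂ k = 1 ∧
      ∃ t, IsReduced a n₁ n₂ m₁ m₂ (fun v => (1 : E → ℝ) v • H n₁ n₂ m₁ m₂ k v) t) ∨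
    (hSign 1 n₁ n₂ m₁ m₂ k = -1 ∧
      (∃ t, IsReduced a n₁ n₂ m₁ m₂ (fun v => u n₁ n₂ m₁ m₂ 5 v • H n₁ n₂ m₁ m₂ k v) t) ∧
      ∃ t, IsReduced a n₁ n₂ m₁ m₂ (fun v => u n₁ n₂ m₁ m₂ 9 v • H n₁ n₂ m₁ m₂ k v) t) := by
  have h1 : ∀ k ∈ [3, 7, 11, 15], hSign 1 n₁ n₂ m₁ m₂ k = 1 ∧
      ∃ t, IsReduced a n₁ n₂ m₁ m₂ (fun v => (1 : E → ℝ) v • H n₁ n₂ m₁ m₂ k v) t := fun k hk =>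
    ⟨by fin_cases hk <;> rfl, _, isReduced_H_iz a hn₁ hn₂ hm₁ hm₂ k hk⟩
  have h2 : ∀ k ∈ [5, 9], hSign 1 n₁ n₂ m₁ m₂ k = 1 ∧
      ∃ t, IsReduced a n₁ n₂ m₁ m₂ (fun v => (1 : E → ℝ) v • H n₁ n₂ m₁ m₂ k v) t := fun k hk =>
    ⟨by fin_cases hk <;> exact ep_one, _, isReduced_H_ir₁ a hn₁ hn₂ hm₁ hm₂ k hk⟩
  have h3 : ∀ k ∈ [13, 17], hSign 1 n₁ n₂ m₁ m₂ k = 1 ∧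
      ∃ t, IsReduced a n₁ n₂ m₁ m₂ (fun v => (1 : E → ℝ) v • H n₁ n₂ m₁ m₂ k v) t := fun k hk =>
    ⟨by fin_cases hk <;> exact de_one, _, isReduced_H_ir₂ a hn₁ hn₂ hm₁ hm₂ k hk⟩
  have h4 : ∀ k ∈ [0, 2, 6, 10, 14], hSign 1 n₁ n₂ m₁ m₂ k = -1 ∧
      (∃ t, IsReduced a n₁ n₂ m₁ m₂ (fun v => u n₁ n₂ m₁ m₂ 5 v • H n₁ n₂ m₁ m₂ k v) t) ∧
      ∃ t, IsReduced a n₁ n₂ m₁ m₂ (fun v => u n₁ n₂ m₁ m₂ 9 v • H n₁ n₂ m₁ m₂ k v) t :=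
    fun k hk => ⟨by fin_cases hk <;> rfl, ⟨_, isReduced_u₅_H_z a hn₁ hn₂ hm₁ hm₂ k hk⟩,
      _, isReduced_u₉_H_z a hn₁ hn₂ hm₁ hm₂ k hk⟩
  have h5 : ∀ k ∈ [4, 8], hSign 1 n₁ n₂ m₁ m₂ k = -1 ∧
      (∃ t, IsReduced a n₁ n₂ m₁ m₂ (fun v => u n₁ n₂ m₁ m₂ 5 v • H n₁ n₂ m₁ m₂ k v) t) ∧
      ∃ t, IsReduced a n₁ n₂ m₁ m₂ (fun v => u n₁ n₂ m₁ m₂ 9 v • H n₁ n₂ m₁ m₂ k v) t :=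
    fun k hk => ⟨by fin_cases hk <;> exact congrArg _ ep_one,
      ⟨_, isReduced_u₅_H_r₁ a hn₁ hn₂ hm₁ hm₂ k hk⟩, _, isReduced_u₉_H_r₁ a hn₁ hn₂ hm₁ hm₂ k hk⟩
  have h6 : ∀ k ∈ [12, 16], hSign 1 n₁ n₂ m₁ m₂ k = -1 ∧
      (∃ t, IsReduced a n₁ n₂ m₁ m₂ (fun v => u n₁ n₂ m₁ m₂ 5 v • H n₁ n₂ m₁ m₂ k v) t) ∧
      ∃ t, IsReduced a n₁ n₂ m₁ m₂ (fun v => u n₁ n₂ m₁ m₂ 9 v • H n₁ n₂ m₁ m₂ k v) t :=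
    fun k hk => ⟨by fin_cases hk <;> exact congrArg _ de_one,
      ⟨_, isReduced_u₅_H_r₂ a hn₁ hn₂ hm₁ hm₂ k hk⟩, _, isReduced_u₉_H_r₂ a hn₁ hn₂ hm₁ hm₂ k hk⟩
  by_cases hk1 : k = 1
  · subst hk1
    exact Or.inl ⟨al_one, _, isReduced_H_one a hn₁ hn₂ hm₁ hm₂ 1 (by simp)⟩
  have : (k ∈ [3, 7, 11, 15] ∨ k ∈ [5, 9] ∨ k ∈ [13, 17]) ∨
      k ∈ [0, 2, 6, 10, 14] ∨ k ∈ [4, 8] ∨ k ∈ [12, 16] := by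
    simp only [List.mem_cons, List.not_mem_nil, or_false]
    omega
  rcases this with (h | h | h) | h | h | h
  exacts [Or.inl (h1 k h), Or.inl (h2 k h), Or.inl (h3 k h), Or.inr (h4 k h), Or.inr (h5 k h),
    Or.inr (h6 k h)]

/-- With `f = p + q u₅ + r u₉`, the operator for `φ` sends `f H_k` to `2p H_k` or to `2(q u₅ + r u₉)
H_k`, according to the sign of `H_k`. The operator for `ψ` is then handled by `IsReduced`. -/
theorem revSum_revSum_mem_genSpan (hn₁ : n₁ ≠ 0) (hn₂ : n₂ ≠ 0) (hm₁ : m₁ ≠ 0) (hm₂ : m₂ ≠ 0)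
    {f : E → ℝ} (hf : f ∈ sRing n₁ n₂ m₁ m₂) (k : ℕ) :
    revSum a (revSum 1 (fun v => f v • H n₁ n₂ m₁ m₂ k v)) ∈ genSpan a n₁ n₂ m₁ m₂ := by
  by_cases hk : k ≤ 17
  swap
  · obtain ⟨k, rfl⟩ := Nat.exists_eq_add_of_lt (not_le.1 hk)
    have e : (fun v => f v • H n₁ n₂ m₁ m₂ (17 + k + 1) v) = 0 := by
      funext v
      rw [show 17 + k + 1 = k + 18 by omega]
      exact smul_zero _
    rw [e, map_zero, map_zero]
    exact zero_mem _
  obtain ⟨p, hp, q, hq, r, hr, rfl⟩ := exists_of_mem_sRing (a := a) hf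
  have e : ∀ f : E → ℝ, revSum 1 (fun v => f v • H n₁ n₂ m₁ m₂ k v) =
      fun v => (f v + hSign 1 n₁ n₂ m₁ m₂ k * f (phi v)) • H n₁ n₂ m₁ m₂ k v := fun f => by
    funext v
    change f v • H n₁ n₂ m₁ m₂ k v - psi 1 (f (phi v) • H n₁ n₂ m₁ m₂ k (psi 1 v)) = _
    rw [map_smul, sub_eq_add_neg, ← smul_neg, neg_psi_H 1 hn₁ hn₂ hm₁ hm₂ hk, smul_smul, add_smul,
      mul_comm]
  have two : ∀ f ∈ phiRing a n₁ n₂ m₁ m₂, (2 : ℝ) • f ∈ phiRing a n₁ n₂ m₁ m₂ := fun f hf =>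
    Subalgebra.smul_mem _ hf _
  rw [e]
  simp only [Pi.add_apply, Pi.mul_apply, phiRing_phi hp, phiRing_phi hq, phiRing_phi hr, u_phi_five,
    u_phi_nine]
  rcases isReduced_H_cases a hn₁ hn₂ hm₁ hm₂ hk with ⟨hs, t, h⟩ | ⟨hs, ⟨t, h⟩, t', h'⟩
  · convert h.revSum_mem (two p hp) using 4 with v
    rw [hs, Pi.smul_apply, smul_eq_mul, Pi.one_apply]
    ring
  · have := add_mem (h.revSum_mem (two q hq)) (h'.revSum_mem (two r hr))
    rw [← map_add] at this
    convert this using 2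
    funext v
    simp only [Pi.add_apply, ← add_smul, hs, Pi.smul_apply, smul_eq_mul]
    congr 1
    ring

theorem mem_genSpan_of_mem_revEquivariants (hn₁ : n₁ ≠ 0) (hn₂ : n₂ ≠ 0) (hm₁ : m₁ ≠ 0)
    (hm₂ : m₂ ≠ 0) (hn : Nat.Coprime n₁ n₂) (hm : Nat.Coprime m₁ m₂) {g : E → E}
    (hg : g ∈ revEquivariants (rep a n₁ n₂ m₁ m₂) sigma) : g ∈ genSpan a n₁ n₂ m₁ m₂ := by
  obtain ⟨hp, hs, hφ, hψ⟩ := mem_revEquivariants_iff.1 hg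
  have h1 : g ∈ (genSpan a n₁ n₂ m₁ m₂).comap (revSum a ∘ₗ revSum 1) := by
    refine (Submodule.span_le.2 ?_ : sModule n₁ n₂ m₁ m₂ ≤ _)
      (mem_sModule_of_equivariant hn₁ hn₂ hm₁ hm₂ hn hm hp hs)
    rintro _ ⟨p, hp, k, rfl⟩
    exact revSum_revSum_mem_genSpan hn₁ hn₂ hm₁ hm₂ hp k
  have h2 : revSum a (revSum 1 g) ∈ genSpan a n₁ n₂ m₁ m₂ := h1
  rw [revSum_eq_of_rev hφ, map_smul, revSum_eq_of_rev hψ] at h2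
  have h3 := Submodule.smul_mem _ (4⁻¹ : ℝ) h2
  -- Each of the two operators doubles a mapping that is already reversed, whence the factor `1/4`.
  rwa [smul_smul, smul_smul, show (4⁻¹ : ℝ) * 2 * 2 = 1 by norm_num, one_smul] at h3

variable (a n₁ n₂ m₁ m₂) in
/-- An element of the ring of `S`-invariants on which `φ` and `ψ` act by signs. -/
structure HasSigns (p : E → ℝ) (s t : ℝ) : Prop where
  mem : p ∈ sRing n₁ n₂ m₁ m₂
  phi : ∀ v, p (phi v) = s * p v
  psi : ∀ v, p (psi a v) = t * p v

theorem HasSigns.one : HasSigns a n₁ n₂ m₁ m₂ 1 1 1 :=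
  ⟨one_mem _, fun v => by simp, fun v => by simp⟩

theorem HasSigns.mul {p q : E → ℝ} {s t s' t' : ℝ} (hp : HasSigns a n₁ n₂ m₁ m₂ p s t)
    (hq : HasSigns a n₁ n₂ m₁ m₂ q s' t') : HasSigns a n₁ n₂ m₁ m₂ (p * q) (s * s') (t * t') :=
  ⟨mul_mem hp.mem hq.mem, fun v => by simp only [Pi.mul_apply, hp.phi, hq.phi]; ring,
    fun v => by simp only [Pi.mul_apply, hp.psi, hq.psi]; ring⟩

theorem hasSigns_u_five : HasSigns a n₁ n₂ m₁ m₂ (u n₁ n₂ m₁ m₂ 5) (-1) (-ep a n₁ n₂) :=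
  ⟨u_mem_sRing _ _ _ _ _, fun v => by rw [u_phi_five, neg_one_mul],
    fun v => (u_psi a n₁ n₂ m₁ m₂ v).2.2.2.2.1⟩

theorem hasSigns_u_nine : HasSigns a n₁ n₂ m₁ m₂ (u n₁ n₂ m₁ m₂ 9) (-1) (-de a m₁ m₂) :=
  ⟨u_mem_sRing _ _ _ _ _, fun v => by rw [u_phi_nine, neg_one_mul],
    fun v => (u_psi a n₁ n₂ m₁ m₂ v).2.2.2.2.2.2.2.2⟩

theorem hasSigns_w_one : HasSigns a n₁ n₂ m₁ m₂ (w n₁ n₂ m₁ m₂ 1) 1 (al a) :=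
  ⟨u_mem_sRing _ _ _ _ 1, fun v => by rw [w_phi, one_mul], fun _ => rfl⟩

theorem hasSigns_w_four : HasSigns a n₁ n₂ m₁ m₂ (w n₁ n₂ m₁ m₂ 4) 1 (ep a n₁ n₂) :=
  ⟨u_mem_sRing _ _ _ _ 4, fun v => by rw [w_phi, one_mul],
    fun v => (u_psi a n₁ n₂ m₁ m₂ v).2.2.2.1⟩

theorem hasSigns_w_seven : HasSigns a n₁ n₂ m₁ m₂ (w n₁ n₂ m₁ m₂ 7) 1 (de a m₁ m₂) :=
  ⟨u_mem_sRing _ _ _ _ 8, fun v => by rw [w_phi, one_mul],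
    fun v => (u_psi a n₁ n₂ m₁ m₂ v).2.2.2.2.2.2.2.1⟩

theorem hasSigns_w_eight :
    HasSigns a n₁ n₂ m₁ m₂ (w n₁ n₂ m₁ m₂ 8) 1 (ep a n₁ n₂ * de a m₁ m₂) := by
  have h := hasSigns_u_five.mul (hasSigns_u_nine (a := a) (n₁ := n₁) (n₂ := n₂) (m₁ := m₁)
    (m₂ := m₂))
  rwa [neg_mul_neg, neg_mul_neg, one_mul] at h

-- The `ψ`-signs of coefficient and `H_k` need agree only after multiplication by the numerical
-- coefficient of the row, which vanishes when they differ. The `φ`-signs agree unconditionally.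
set_option maxHeartbeats 2000000 in
theorem hasSigns_of_mem_genRows {r : ℝ × (E → ℝ) × List ℕ} (hr : r ∈ genRows a n₁ n₂ m₁ m₂) :
    ∃ s t, HasSigns a n₁ n₂ m₁ m₂ r.2.1 s t ∧ ∀ k ∈ r.2.2, k ≤ 17 ∧
      s = hSign 1 n₁ n₂ m₁ m₂ k ∧ r.1 * t = r.1 * hSign a n₁ n₂ m₁ m₂ k := by
  have hα := al_sq a
  have hε := ep_sq a n₁ n₂
  have hδ := de_sq a m₁ m₂
  simp only [genRows, List.mem_cons, List.not_mem_nil, or_false] at hr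
  rcases hr with rfl | rfl | rfl | rfl | rfl | rfl | rfl | rfl | rfl | rfl | rfl | rfl | rfl | rfl |
    rfl | rfl | rfl | rfl | rfl | rfl | rfl | rfl | rfl | rfl | rfl | rfl | rfl | rfl | rfl | rfl |
    rfl | rfl | rfl | rfl | rfl | rfl | rfl | rfl <;>
  (refine ⟨_, _, by
    first
      | with_reducible exact HasSigns.one
      | with_reducible exact hasSigns_w_one
      | with_reducible exact hasSigns_w_four
      | with_reducible exact hasSigns_w_seven
      | with_reducible exact hasSigns_w_eight
      | with_reducible exact hasSigns_u_five
      | with_reducible exact hasSigns_u_nine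
      | with_reducible exact hasSigns_w_one.mul hasSigns_u_five
      | with_reducible exact hasSigns_w_four.mul hasSigns_u_five
      | with_reducible exact hasSigns_w_seven.mul hasSigns_u_five
      | with_reducible exact hasSigns_w_eight.mul hasSigns_u_five
      | with_reducible exact hasSigns_w_one.mul hasSigns_u_nine
      | with_reducible exact hasSigns_w_four.mul hasSigns_u_nine
      | with_reducible exact hasSigns_w_seven.mul hasSigns_u_nine
      | with_reducible exact hasSigns_w_eight.mul hasSigns_u_nine, ?_⟩
   simp only [List.forall_mem_cons, hSign, al_one, ep_one, de_one]
   repeat' apply And.intro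
   all_goals first | (norm_num1; done) | ring1 | exact fun _ h => absurd h List.not_mem_nil | grind)

theorem smul_H_mem_revEquivariants (hn₁ : n₁ ≠ 0) (hn₂ : n₂ ≠ 0) (hm₁ : m₁ ≠ 0) (hm₂ : m₂ ≠ 0)
    {c s t : ℝ} {p : E → ℝ} {k : ℕ} (hp : HasSigns a n₁ n₂ m₁ m₂ p s t) (hk : k ≤ 17)
    (hs : s = hSign 1 n₁ n₂ m₁ m₂ k) (ht : c * t = c * hSign a n₁ n₂ m₁ m₂ k) :
    (fun v => (c * p v) • H n₁ n₂ m₁ m₂ k v) ∈ revEquivariants (rep a n₁ n₂ m₁ m₂) sigma := by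
  have inv : ∀ (b : Fin 5 → ℤˣ) v, psi b (psi b v) = v := fun b v =>
    DFunLike.congr_fun (psi_mul_psi b) v
  have hH : ∀ (b : Fin 5 → ℤˣ) v, psi b (H n₁ n₂ m₁ m₂ k v) =
      -(hSign b n₁ n₂ m₁ m₂ k • H n₁ n₂ m₁ m₂ k (psi b v)) := fun b v => by
    rw [← neg_psi_H b hn₁ hn₂ hm₁ hm₂ hk, inv, neg_neg]
  refine mem_revEquivariants_iff.2 ⟨?_, fun σ v => ?_, fun v => ?_, fun v => ?_⟩
  · exact IsPolyMap.mul_smul (mul_mem (Subalgebra.algebraMap_mem _ c) (sRing_le_polyFun hp.mem))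
      (exists_isHomogPoly_H k).choose_spec.1
  · rw [sRing_repS hp.mem, H_repS hn₁ hn₂ hm₁ hm₂, map_smul]
  · rw [map_smul, ← psi_one, hH 1, ← smul_neg, neg_neg, smul_smul, psi_one, hp.phi]
    congr 1
    rw [hs]
    ring
  · rw [map_smul, hH a, ← smul_neg, neg_neg, smul_smul, hp.psi]
    congr 1
    linear_combination p v * ht

theorem generators_subset (hn₁ : n₁ ≠ 0) (hn₂ : n₂ ≠ 0) (hm₁ : m₁ ≠ 0) (hm₂ : m₂ ≠ 0) {J : E → E}
    (hJ : J ∈ generators a n₁ n₂ m₁ m₂) : J ∈ revEquivariants (rep a n₁ n₂ m₁ m₂) sigma := by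
  obtain ⟨r, hr, hJ⟩ := List.mem_flatMap.1 hJ
  obtain ⟨k, hk, rfl⟩ := List.mem_map.1 hJ
  obtain ⟨s, t, hst, h⟩ := hasSigns_of_mem_genRows hr
  exact smul_H_mem_revEquivariants hn₁ hn₂ hm₁ hm₂ hst (h k hk).1 (h k hk).2.1 (h k hk).2.2

theorem span_generators_eq_revEquivariants (hn₁ : n₁ ≠ 0) (hn₂ : n₂ ≠ 0) (hm₁ : m₁ ≠ 0)
    (hm₂ : m₂ ≠ 0) (hn : Nat.Coprime n₁ n₂) (hm : Nat.Coprime m₁ m₂) :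
    Submodule.span (invariantRing (rep a n₁ n₂ m₁ m₂)) {g | g ∈ generators a n₁ n₂ m₁ m₂} =
      revEquivariants (rep a n₁ n₂ m₁ m₂) sigma := by
  refine le_antisymm (Submodule.span_le.2 fun J hJ => generators_subset hn₁ hn₂ hm₁ hm₂ hJ)
    fun g hg => ?_
  have h := mem_genSpan_of_mem_revEquivariants hn₁ hn₂ hm₁ hm₂ hn hm hg
  clear hg
  induction h using Submodule.span_induction with
  | zero => exact zero_mem _
  | add f g _ _ hf hg => exact add_mem hf hg
  | smul r g _ hg =>
    exact Submodule.smul_mem _ (algebraMap ℝ (invariantRing (rep a n₁ n₂ m₁ m₂)) r) hg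
  | mem g hg =>
    obtain ⟨p, hp, J, hJ, rfl⟩ := hg
    rw [hilbertAlgebra_eq_invariantRing hn₂ hm₂ hn hm] at hp
    exact Submodule.smul_mem _ (⟨p, hp⟩ : invariantRing (rep a n₁ n₂ m₁ m₂))
      (Submodule.subset_span hJ)

end RevEquivariants

/-! ### Derivative of monomials along `L` and resonances. -/

section LieDerivative

variable (ω : Fin 4 → ℝ)

theorem differentiable_of_mem_cpoly {F : E → ℂ} (hF : F ∈ cpoly) : Differentiable ℝ F := by
  obtain ⟨h1, h2⟩ := mem_cpoly_iff.1 hF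
  have e : F = fun v => Complex.ofRealCLM (F v).re + Complex.ofRealCLM (F v).im * Complex.I := by
    funext v; simp
  have d1 := (contDiff_of_mem_polyFun h1).differentiable (by simp)
  have d2 := (contDiff_of_mem_polyFun h2).differentiable (by simp)
  rw [e]
  fun_prop

theorem mon_differentiable (p : Expo) : Differentiable ℝ (mon p) :=
  differentiable_of_mem_cpoly (mon_mem_cpoly p)

/-- The eigenvalue of a monomial under the semisimple part of `L`. -/
noncomputable def Expo.freq (p : Expo) : ℂ :=
  -(Complex.I * ∑ j, (ω j : ℂ) * ((p.2.2.1 j : ℂ) - p.2.2.2 j))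

/-- The point substituted is the image of `v` under the flow of `L` at time `t`. On a monomial, the
rotations contribute a single exponential in its frequency, and the nilpotent part acts only through
`x₁ + t x₂`. -/
theorem mon_flow (p : Expo) (v : E) (t : ℝ) :
    mon p (![v.1 0 + t * v.1 1, v.1 1], fun j => Complex.exp (t * -(Complex.I * ω j)) * v.2 j) =
      ((v.1 0 : ℂ) + t * v.1 1) ^ p.1 * Complex.exp (t * p.freq ω) *
        ((v.1 1 : ℂ) ^ p.2.1 * ((∏ j, v.2 j ^ p.2.2.1 j) * ∏ j, conj (v.2 j) ^ p.2.2.2 j)) := by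
  have h : Complex.exp (t * p.freq ω) =
      (∏ j, Complex.exp (t * -(Complex.I * ω j)) ^ p.2.2.1 j) *
        ∏ j, conj (Complex.exp (t * -(Complex.I * ω j))) ^ p.2.2.2 j := by
    rw [← Finset.prod_mul_distrib]
    simp only [← Complex.exp_conj, ← Complex.exp_nat_mul, ← Complex.exp_add, ← Complex.exp_sum]
    congr 1
    rw [Expo.freq, Finset.mul_sum, ← Finset.sum_neg_distrib, Finset.mul_sum]
    refine Finset.sum_congr rfl fun j _ => ?_
    simp only [map_mul, map_neg, Complex.conj_I, Complex.conj_ofReal]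
    ring
  rw [h]
  simp only [mon, Matrix.cons_val_zero, Matrix.cons_val_one, map_mul, mul_pow,
    Finset.prod_mul_distrib, Complex.ofReal_add, Complex.ofReal_mul]
  ring

/-- The derivative of a monomial along `L`. -/
theorem fderiv_mon (a b : ℕ) (c d : Fin 4 → ℕ) (v : E) :
    fderiv ℝ (mon (a, b, c, d)) v (linPart ω v) = a * mon (a - 1, b + 1, c, d) v +
      Expo.freq ω (a, b, c, d) * mon (a, b, c, d) v := by
  let γ : ℝ → E := fun t =>
    (![v.1 0 + t * v.1 1, v.1 1], fun j => Complex.exp (t * -(Complex.I * ω j)) * v.2 j)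
  have hγ0 : γ 0 = v := by
    refine Prod.ext (funext fun i => ?_) (funext fun i => ?_)
    · fin_cases i <;> simp [γ]
    · simp [γ]
  have hγ : HasDerivAt γ (linPart ω v) 0 := by
    refine HasDerivAt.prodMk (hasDerivAt_pi.2 fun i => ?_) (hasDerivAt_pi.2 fun j => ?_)
    · fin_cases i
      · simpa using ((hasDerivAt_id (0 : ℝ)).mul_const (v.1 1)).const_add (v.1 0)
      · simpa using hasDerivAt_const (0 : ℝ) (v.1 1)
    · have h := (((Complex.ofRealCLM.hasDerivAt (x := 0)).mul_const
        (-(Complex.I * ω j))).cexp).mul_const (v.2 j)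
      simpa using h
  have h1 : HasDerivAt (fun t => mon (a, b, c, d) (γ t))
      (fderiv ℝ (mon (a, b, c, d)) v (linPart ω v)) 0 := by
    have := (mon_differentiable (a, b, c, d) (γ 0)).hasFDerivAt.comp_hasDerivAt 0 hγ
    rwa [hγ0] at this
  -- When `a = 0` the truncated exponent `a - 1` is harmless, since its coefficient is `0`.
  have h2 : HasDerivAt (fun t : ℝ => ((v.1 0 : ℂ) + t * v.1 1) ^ a *
      Complex.exp (t * Expo.freq ω (a, b, c, d)) *
        ((v.1 1 : ℂ) ^ b * ((∏ j, v.2 j ^ c j) * ∏ j, conj (v.2 j) ^ d j)))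
      (a * mon (a - 1, b + 1, c, d) v + Expo.freq ω (a, b, c, d) * mon (a, b, c, d) v) 0 := by
    have h := (((((Complex.ofRealCLM.hasDerivAt (x := 0)).mul_const
      (v.1 1 : ℂ)).const_add (v.1 0 : ℂ)).pow a).mul
      ((Complex.ofRealCLM.hasDerivAt (x := 0)).mul_const
        (Expo.freq ω (a, b, c, d))).cexp).mul_const
        ((v.1 1 : ℂ) ^ b * ((∏ j, v.2 j ^ c j) * ∏ j, conj (v.2 j) ^ d j))
    refine h.congr_deriv ?_
    simp [mon]
    ring
  rw [show (fun t => mon (a, b, c, d) (γ t)) = _ from funext fun t => mon_flow ω (a, b, c, d) v t]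
    at h1
  exact h1.unique h2

/-- The resonance relations make `(ω₁, ω₂)` and `(ω₃, ω₄)` multiples of `(n₁, n₂)` and `(m₁, m₂)`,
so the frequency depends only on the two torus weights. -/
theorem freq_eq_of_weight {n₁ n₂ m₁ m₂ : ℕ} (hn₁ : n₁ ≠ 0) (hm₁ : m₁ ≠ 0)
    (hω₁₂ : n₁ * ω 1 = n₂ * ω 0) (hω₃₄ : m₁ * ω 3 = m₂ * ω 2)
    (p : Expo) : Expo.freq ω p = -(Complex.I * (((p.weight n₁ n₂ m₁ m₂).1 * (ω 0 / n₁) +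
      (p.weight n₁ n₂ m₁ m₂).2 * (ω 2 / m₁) : ℝ) : ℂ)) := by
  have h1 : (n₁ : ℝ) ≠ 0 := Nat.cast_ne_zero.2 hn₁
  have h3 : (m₁ : ℝ) ≠ 0 := Nat.cast_ne_zero.2 hm₁
  have e1 : ω 1 = n₂ * (ω 0 / n₁) := by field_simp; linarith
  have e3 : ω 3 = m₂ * (ω 2 / m₁) := by field_simp; linarith
  have e0 : ω 0 = n₁ * (ω 0 / n₁) := by field_simp
  have e2 : ω 2 = m₁ * (ω 2 / m₁) := by field_simp
  rw [Expo.freq, Fin.sum_univ_four, e1, e3]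
  rw [show (ω 0 : ℂ) = ((n₁ * (ω 0 / n₁) : ℝ) : ℂ) from congrArg _ e0,
    show (ω 2 : ℂ) = ((m₁ * (ω 2 / m₁) : ℝ) : ℂ) from congrArg _ e2]
  simp only [Expo.weight]
  push_cast
  ring

/-- Rational independence of `ω₁, ω₃`, unaffected by dividing by the integers `n₁, m₁`, lets the two
integer weights be recovered from the frequency. -/
theorem weight_eq_of_eq {n₁ m₁ : ℕ} (hn₁ : n₁ ≠ 0) (hm₁ : m₁ ≠ 0)
    (hω : LinearIndependent ℚ ![ω 0, ω 2]) {x y : ℤ × ℤ}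
    (h : x.1 * (ω 0 / n₁) + x.2 * (ω 2 / m₁) = y.1 * (ω 0 / n₁) + y.2 * (ω 2 / m₁)) : x = y := by
  have h1 : (n₁ : ℚ) ≠ 0 := Nat.cast_ne_zero.2 hn₁
  have h3 : (m₁ : ℚ) ≠ 0 := Nat.cast_ne_zero.2 hm₁
  have := LinearIndependent.pair_iff.1 hω ((x.1 - y.1 : ℚ) / n₁) ((x.2 - y.2 : ℚ) / m₁) (by
    simp only [Rat.smul_def]
    push_cast
    linear_combination h)
  simp only [div_eq_zero_iff, h1, h3, or_false, sub_eq_zero, Int.cast_inj] at this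
  exact Prod.ext this.1 this.2

end LieDerivative

/-! ### Solving the homological equation on monomials. -/

section Homological

variable (ω : Fin 4 → ℝ) (n₁ n₂ m₁ m₂ : ℕ)

/-- The homological operator. -/
noncomputable def homOp (Φ : E → E) (v : E) : E := fderiv ℝ Φ v (linPart ω v) - linPart ω (Φ v)

theorem homOp_add {Φ Ψ : E → E} (hΦ : IsPolyMap Φ) (hΨ : IsPolyMap Ψ) (v : E) :
    homOp ω (Φ + Ψ) v = homOp ω Φ v + homOp ω Ψ v := by
  rw [homOp, homOp, homOp, fderiv_add (hΦ.differentiable v) (hΨ.differentiable v), Pi.add_apply,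
    map_add, add_apply]
  abel

theorem homOp_smul {Φ : E → E} (hΦ : IsPolyMap Φ) (r : ℝ) (v : E) :
    homOp ω (r • Φ) v = r • homOp ω Φ v := by
  rw [homOp, homOp, fderiv_const_smul (hΦ.differentiable v), Pi.smul_apply, map_smul,
    smul_apply, smul_sub]

/-- The mappings congruent to homogeneous `S`-equivariant ones modulo the image of the homological
operator. -/
noncomputable def solvable (k : ℕ) : Submodule ℝ (E → E) where
  carrier := {R | ∃ Φ Y, IsHomogPoly k Φ ∧ IsHomogPoly k Y ∧
    (∀ s v, Y (repS n₁ n₂ m₁ m₂ s v) = repS n₁ n₂ m₁ m₂ s (Y v)) ∧ ∀ v, Y v + homOp ω Φ v = R v}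
  zero_mem' := ⟨0, 0, .zero k, .zero k, fun s v => (map_zero _).symm, fun v => by simp [homOp]⟩
  add_mem' := by
    rintro R R' ⟨Φ, Y, hΦ, hY, hs, h⟩ ⟨Φ', Y', hΦ', hY', hs', h'⟩
    refine ⟨Φ + Φ', Y + Y', hΦ.add hΦ', hY.add hY', fun s v => ?_, fun v => ?_⟩
    · simp only [Pi.add_apply, hs, hs', map_add]
    · rw [homOp_add ω hΦ.1 hΦ'.1, Pi.add_apply, Pi.add_apply, ← h, ← h']
      abel
  smul_mem' := by
    rintro r R ⟨Φ, Y, hΦ, hY, hs, h⟩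
    refine ⟨r • Φ, r • Y, hΦ.const_smul r, hY.const_smul r, fun s v => ?_, fun v => ?_⟩
    · simp only [Pi.smul_apply, hs, map_smul]
    · rw [homOp_smul ω hΦ.1, Pi.smul_apply, Pi.smul_apply, ← h, smul_add]

variable {ω n₁ n₂ m₁ m₂} {k : ℕ}

theorem homOp_mem_solvable {Φ : E → E} (hΦ : IsHomogPoly k Φ) :
    homOp ω Φ ∈ solvable ω n₁ n₂ m₁ m₂ k :=
  ⟨Φ, 0, hΦ, .zero k, fun _ _ => (map_zero _).symm, fun _ => zero_add _⟩

theorem equivariant_mem_solvable {Y : E → E} (hY : IsHomogPoly k Y)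
    (hs : ∀ s v, Y (repS n₁ n₂ m₁ m₂ s v) = repS n₁ n₂ m₁ m₂ s (Y v)) :
    Y ∈ solvable ω n₁ n₂ m₁ m₂ k :=
  ⟨0, Y, .zero k, hY, hs, fun v => by simp [homOp]⟩

/-- The embedding of `ℂ` as the `z_j`-axis. -/
noncomputable def zEmb (j : Fin 4) : ℂ →ₗ[ℝ] E :=
  LinearMap.inr ℝ (Fin 2 → ℝ) (Fin 4 → ℂ) ∘ₗ LinearMap.single ℝ (fun _ => ℂ) j

/-- The real part, placed on the `x_i`-axis. -/
noncomputable def xEmb (i : Fin 2) : ℂ →ₗ[ℝ] E :=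
  LinearMap.inl ℝ (Fin 2 → ℝ) (Fin 4 → ℂ) ∘ₗ LinearMap.single ℝ (fun _ => ℝ) i ∘ₗ Complex.reLm

theorem zEmb_apply (j : Fin 4) (z : ℂ) : zEmb j z = (0, Pi.single j z) := rfl

theorem xEmb_apply (i : Fin 2) (z : ℂ) : xEmb i z = (Pi.single i z.re, 0) := rfl

theorem linPart_zEmb (j : Fin 4) (z : ℂ) :
    linPart ω (zEmb j z) = zEmb j (-(Complex.I * ω j) * z) := by
  rw [zEmb_apply, zEmb_apply]
  refine Prod.ext (funext fun i => ?_) (funext fun i => ?_)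
  · fin_cases i <;> simp [linPart]
  · by_cases h : i = j
    · subst h; simp [linPart]
    · simp [linPart, h]

theorem linPart_xEmb_zero (z : ℂ) : linPart ω (xEmb 0 z) = 0 := by
  rw [xEmb_apply]
  refine Prod.ext (funext fun i => ?_) (funext fun i => ?_)
  · fin_cases i <;> simp [linPart]
  · simp [linPart]

theorem linPart_xEmb_one (z : ℂ) : linPart ω (xEmb 1 z) = xEmb 0 z := by
  rw [xEmb_apply, xEmb_apply]
  refine Prod.ext (funext fun i => ?_) (funext fun i => ?_)
  · fin_cases i <;> simp [linPart]
  · simp [linPart]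

theorem fderiv_smul_mon (e : ℂ →ₗ[ℝ] E) (γ : ℂ) (p : Expo) (v : E) :
    fderiv ℝ (fun v => e (γ * mon p v)) v (linPart ω v) =
      e (γ * (p.1 * mon (p.1 - 1, p.2.1 + 1, p.2.2) v + p.freq ω * mon p v)) := by
  have h := fderiv_linear_comp (mon_differentiable p) (e ∘ₗ LinearMap.mulLeft ℝ γ) v (linPart ω v)
  have h' := fderiv_mon ω p.1 p.2.1 p.2.2.1 p.2.2.2 v
  simp only [Prod.mk.eta] at h'
  rw [h'] at h
  exact h

theorem isHomogPoly_emb_mon (e : ℂ →ₗ[ℝ] E) (γ : ℂ) {p : Expo} (hp : p.deg = k) :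
    IsHomogPoly k (fun v => e (γ * mon p v)) := by
  refine ⟨?_, fun t v => ?_⟩
  · exact isPolyMap_complex_comp e (mul_mem (Subalgebra.algebraMap_mem _ γ) (mon_mem_complexify p))
  · simp only
    rw [mon_smul, hp, mul_left_comm, ← Complex.ofReal_pow, ← Complex.real_smul, map_smul]

theorem deg_shift {a b : ℕ} {c : (Fin 4 → ℕ) × (Fin 4 → ℕ)} :
    Expo.deg (a, b + 1, c) = Expo.deg (a + 1, b, c) := by
  simp only [Expo.deg]; omega

theorem mon_repS {p : Expo} (hp : p.2.1 = 0) (s : S) (v : E) :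
    mon p (repS n₁ n₂ m₁ m₂ s v) = torusChar (p.weight n₁ n₂ m₁ m₂) s.2 * mon p v := by
  rw [← mon_torus]
  simp [mon, hp, repS]

theorem torusChar_zWeight (j : Fin 4) (θ : Circle × Circle) :
    torusChar (zWeight n₁ n₂ m₁ m₂ j) θ = torusElt n₁ n₂ m₁ m₂ θ j := by
  rw [torusChar_apply]
  fin_cases j <;> simp [torusElt, zWeight]

/-- The non-resonant case. The operator is `μ` plus a shift that lowers the exponent of `x₁`, hence
triangular with nonzero diagonal; induction on that exponent inverts it. -/
theorem mem_of_shift_mem {M : Submodule ℝ (E → E)} {e : ℂ →ₗ[ℝ] E}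
    {c : (Fin 4 → ℕ) × (Fin 4 → ℕ)} {μ : ℂ} (hμ : μ ≠ 0)
    (key : ∀ (γ : ℂ) (a b : ℕ), Expo.deg (a, b, c) = k →
      (fun v => e (γ * (a * mon (a - 1, b + 1, c) v + μ * mon (a, b, c) v))) ∈ M) :
    ∀ (a b : ℕ) (γ : ℂ), Expo.deg (a, b, c) = k → (fun v => e (γ * mon (a, b, c) v)) ∈ M := by
  intro a
  induction a with
  | zero =>
    intro b γ hd
    convert key (γ / μ) 0 b hd using 3 with v
    field_simp
    simp only [Nat.cast_zero, zero_mul, zero_add]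
    ring
  | succ a ih =>
    intro b γ hd
    convert sub_mem (key (γ / μ) (a + 1) b hd) (ih (b + 1) (γ / μ * (a + 1)) (deg_shift.trans hd))
      using 1
    funext v
    simp only [Pi.sub_apply, ← map_sub, Nat.add_sub_cancel]
    congr 1
    push_cast
    field_simp
    ring

/-- At resonance only the shift remains: it sends `x₁^(a+1) x₂^b` to `(a+1) x₁^a x₂^(b+1)` and so
reaches every monomial containing `x₂`. Those without `x₂` have the weight of `z_j` and are
`S`-equivariant. -/
theorem zEmb_mon_mem_solvable
    (hres : ∀ (p : Expo) j, p.freq ω = -(Complex.I * ω j) →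
      p.weight n₁ n₂ m₁ m₂ = zWeight n₁ n₂ m₁ m₂ j)
    (j : Fin 4) (c : (Fin 4 → ℕ) × (Fin 4 → ℕ)) (a b : ℕ) (γ : ℂ) (hd : Expo.deg (a, b, c) = k) :
    (fun v => zEmb j (γ * mon (a, b, c) v)) ∈ solvable ω n₁ n₂ m₁ m₂ k := by
  have key : ∀ (γ : ℂ) (a b : ℕ), Expo.deg (a, b, c) = k →
      (fun v => zEmb j (γ * (a * mon (a - 1, b + 1, c) v +
        (Expo.freq ω (0, 0, c) + Complex.I * ω j) * mon (a, b, c) v))) ∈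
        solvable ω n₁ n₂ m₁ m₂ k := fun γ a b hp => by
    convert homOp_mem_solvable (isHomogPoly_emb_mon (zEmb j) γ hp) using 1
    funext v
    rw [homOp, fderiv_smul_mon, linPart_zEmb, ← map_sub,
      show Expo.freq ω (a, b, c) = Expo.freq ω (0, 0, c) from rfl]
    congr 1
    ring
  by_cases hr : Expo.freq ω (0, 0, c) + Complex.I * ω j = 0
  · match b with
    | 0 =>
      refine equivariant_mem_solvable (isHomogPoly_emb_mon _ _ hd)
        (single_repS (F := fun v => γ * mon (a, 0, c) v) j fun s v => ?_)
      have hw : Expo.weight n₁ n₂ m₁ m₂ (a, 0, c) = zWeight n₁ n₂ m₁ m₂ j :=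
        hres (0, 0, c) j (eq_neg_of_add_eq_zero_left hr)
      rw [mon_repS rfl, hw, torusChar_zWeight, mul_left_comm]
    | b + 1 =>
      have ha : (a + 1 : ℂ) ≠ 0 := Nat.cast_add_one_ne_zero a
      convert key (γ / (a + 1)) (a + 1) b (deg_shift ▸ hd) using 3 with v
      rw [hr, Nat.add_sub_cancel]
      push_cast
      field_simp
      ring
  · exact mem_of_shift_mem hr key a b γ hd

/-- The field is the `S`-invariant function `Re (γ x₁^a z^c z̄^d)` times the equivariant `H₀`. -/
theorem x_multiple_mem_solvable {c : (Fin 4 → ℕ) × (Fin 4 → ℕ)}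
    (hc : Expo.weight n₁ n₂ m₁ m₂ (0, 0, c) = 0) {a : ℕ} (γ : ℂ) (hd : Expo.deg (a + 1, 0, c) = k) :
    (fun v => xEmb 0 (γ * mon (a + 1, 0, c) v) + xEmb 1 (γ * mon (a, 1, c) v)) ∈
      solvable ω n₁ n₂ m₁ m₂ k := by
  refine equivariant_mem_solvable ((isHomogPoly_emb_mon _ _ hd).add
    (isHomogPoly_emb_mon _ _ (deg_shift.trans hd))) fun s v => ?_
  have e : ∀ v, xEmb 0 (γ * mon (a + 1, 0, c) v) + xEmb 1 (γ * mon (a, 1, c) v) =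
      (γ * mon (a, 0, c) v).re • ((v.1, 0) : E) := fun v => by
    have e0 : γ * mon (a + 1, 0, c) v = (v.1 0 : ℂ) * (γ * mon (a, 0, c) v) := by
      simp only [mon]; ring
    have e1 : γ * mon (a, 1, c) v = (v.1 1 : ℂ) * (γ * mon (a, 0, c) v) := by
      simp only [mon]; ring
    rw [e0, e1, xEmb_apply, xEmb_apply, Complex.re_ofReal_mul, Complex.re_ofReal_mul]
    refine Prod.ext (funext fun i => ?_) (by simp)
    fin_cases i <;> simp [mul_comm]
  have hm : mon (a, 0, c) (repS n₁ n₂ m₁ m₂ s v) = mon (a, 0, c) v := by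
    rw [mon_repS rfl, show Expo.weight n₁ n₂ m₁ m₂ (a, 0, c) = 0 from hc, torusChar_apply]
    simp
  rw [e, e, hm, map_smul]
  congr 1
  refine Prod.ext (funext fun i => ?_) (funext fun i => by simp [repS])
  fin_cases i <;> simp [repS]

theorem xEmb_one_mem_solvable_of_shear_invariant {c : (Fin 4 → ℕ) × (Fin 4 → ℕ)}
    (hc : Expo.weight n₁ n₂ m₁ m₂ (0, 0, c) = 0) {a : ℕ} (γ : ℂ) (hd : Expo.deg (a, 0, c) = k) :
    (fun v => xEmb 1 (γ * mon (a, 0, c) v)) ∈ solvable ω n₁ n₂ m₁ m₂ k := by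
  refine equivariant_mem_solvable (isHomogPoly_emb_mon _ _ hd) fun s v => ?_
  have hm : mon (a, 0, c) (repS n₁ n₂ m₁ m₂ s v) = mon (a, 0, c) v := by
    rw [mon_repS rfl, show Expo.weight n₁ n₂ m₁ m₂ (a, 0, c) = 0 from hc, torusChar_apply]
    simp
  rw [hm, xEmb_apply]
  refine Prod.ext (funext fun i => ?_) (funext fun i => by simp [repS])
  fin_cases i <;> simp [repS]

/-- On the `x`-plane the operator couples the two components: the image of a field along `x₂` also
has a component along `x₁`, which must be compensated. At resonance the compensation depends on the
power of `x₂` present. -/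
theorem xEmb_mon_mem_solvable
    (hres : ∀ p : Expo, p.freq ω = 0 → p.weight n₁ n₂ m₁ m₂ = 0)
    (c : (Fin 4 → ℕ) × (Fin 4 → ℕ)) (a b : ℕ) (γ : ℂ) (hd : Expo.deg (a, b, c) = k) :
    (fun v => xEmb 1 (γ * mon (a, b, c) v)) ∈ solvable ω n₁ n₂ m₁ m₂ k := by
  have key₀ : ∀ (γ : ℂ) (a b : ℕ), Expo.deg (a, b, c) = k →
      (fun v => xEmb 0 (γ * (a * mon (a - 1, b + 1, c) v +
        Expo.freq ω (0, 0, c) * mon (a, b, c) v))) ∈ solvable ω n₁ n₂ m₁ m₂ k :=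
    fun γ a b hp => by
    convert homOp_mem_solvable (isHomogPoly_emb_mon (xEmb 0) γ hp) using 1
    funext v
    rw [homOp, fderiv_smul_mon, linPart_xEmb_zero, sub_zero]
    rfl
  have key₁ : ∀ (γ : ℂ) (a b : ℕ), Expo.deg (a, b, c) = k →
      (fun v => xEmb 1 (γ * (a * mon (a - 1, b + 1, c) v +
        Expo.freq ω (0, 0, c) * mon (a, b, c) v)) - xEmb 0 (γ * mon (a, b, c) v)) ∈
        solvable ω n₁ n₂ m₁ m₂ k := fun γ a b hp => by
    convert homOp_mem_solvable (isHomogPoly_emb_mon (xEmb 1) γ hp) using 1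
    funext v
    rw [homOp, fderiv_smul_mon, linPart_xEmb_one]
    rfl
  have ha : (a + 1 : ℂ) ≠ 0 := Nat.cast_add_one_ne_zero a
  by_cases hr : Expo.freq ω (0, 0, c) = 0
  · have hc := hres _ hr
    match b with
    | 0 => exact xEmb_one_mem_solvable_of_shear_invariant hc γ hd
    | 1 =>
      -- Power one: the image of `x₁^(a+1)` along `x₂` has components `-x₁^(a+1)` and `(a+1) x₁^a
      -- x₂`. Adding the equivariant `x₁^a (x₁, x₂)` cancels the first and raises the second factor
      -- to `a + 2`.
      have ha' : ((a : ℂ) + 2) ≠ 0 := by exact_mod_cast (show a + 2 ≠ 0 by omega)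
      convert add_mem (key₁ (γ / (a + 2)) (a + 1) 0 (deg_shift ▸ hd))
        (x_multiple_mem_solvable hc (γ / (a + 2)) (deg_shift ▸ hd)) using 1
      funext v
      rw [Pi.add_apply, ← add_assoc, sub_add_cancel, ← map_add]
      congr 1
      rw [hr, Nat.add_sub_cancel]
      push_cast
      field_simp
      ring
    | b + 2 =>
      -- Power at least two: the unwanted component along `x₁` still contains `x₂`, so it is itself
      -- an image, namely of a multiple of `x₁^(a+2) x₂^b`.
      have ha' : ((a : ℂ) + 2) ≠ 0 := by exact_mod_cast (show a + 2 ≠ 0 by omega)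
      convert add_mem (key₁ (γ / (a + 1)) (a + 1) (b + 1) (deg_shift ▸ hd))
        (key₀ (γ / (a + 1) / (a + 2)) (a + 2) b (deg_shift ▸ deg_shift ▸ hd)) using 1
      funext v
      have h0 : γ / (a + 1) * mon (a + 1, b + 1, c) v = γ / (a + 1) / (a + 2) *
          (((a + 2 : ℕ) : ℂ) * mon (a + 2 - 1, b + 1, c) v +
            Expo.freq ω (0, 0, c) * mon (a + 2, b, c) v) := by
        rw [hr, show a + 2 - 1 = a + 1 from rfl]
        push_cast
        field_simp
        ring
      rw [Pi.add_apply, ← h0, sub_add_cancel, hr, Nat.add_sub_cancel]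
      congr 1
      push_cast
      field_simp
      ring
  -- Off resonance all fields along `x₁` are already reached, so the coupling term may be dropped
  -- and the triangular argument repeated.
  · refine mem_of_shift_mem hr (fun γ a b hd => ?_) a b γ hd
    convert add_mem (key₁ γ a b hd) (mem_of_shift_mem hr key₀ a b γ hd) using 1
    funext v
    simp

theorem mem_solvable_of_isHomogPoly
    (hres₀ : ∀ p : Expo, p.freq ω = 0 → p.weight n₁ n₂ m₁ m₂ = 0)
    (hres : ∀ (p : Expo) j, p.freq ω = -(Complex.I * ω j) →
      p.weight n₁ n₂ m₁ m₂ = zWeight n₁ n₂ m₁ m₂ j)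
    {R : E → E} (hR : IsHomogPoly k R) : R ∈ solvable ω n₁ n₂ m₁ m₂ k := by
  have ext : ∀ (e : ℂ →ₗ[ℝ] E), (∀ p : Expo, p.deg = k → ∀ γ : ℂ,
      (fun v => e (γ * mon p v)) ∈ solvable ω n₁ n₂ m₁ m₂ k) → ∀ l : E →ₗ[ℝ] ℂ,
      (fun v => e (l (R v))) ∈ solvable ω n₁ n₂ m₁ m₂ k := fun e he l => by
    have hF : (fun v => l (R v)) ∈ Submodule.span ℂ (mon '' {p | p.deg = k}) :=
      mem_span_mon_of_homogeneous (mem_cpoly_iff.2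
        ⟨hR.1 (Complex.reLm ∘ₗ l), hR.1 (Complex.imLm ∘ₗ l)⟩) fun t v => by
        simp only [hR.2, map_smul, Complex.real_smul, Complex.ofReal_pow]
    have : ∀ F ∈ Submodule.span ℂ (mon '' {p | p.deg = k}), ∀ γ : ℂ,
        (fun v => e (γ * F v)) ∈ solvable ω n₁ n₂ m₁ m₂ k := fun F hF => by
      induction hF using Submodule.span_induction with
      | mem F hF =>
        obtain ⟨p, hp, rfl⟩ := hF
        exact he p hp
      | zero =>
        intro γ
        simp only [Pi.zero_apply, mul_zero, map_zero]
        exact zero_mem (solvable ω n₁ n₂ m₁ m₂ k)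
      | add F G _ _ hF hG =>
        intro γ
        convert add_mem (hF γ) (hG γ) using 1
        funext v
        simp [mul_add]
      | smul γ' F _ hF => exact fun γ => by simpa [mul_assoc] using hF (γ * γ')
    simpa using this _ hF 1
  have hx : ∀ p : Expo, p.deg = k → ∀ γ : ℂ,
      (fun v => xEmb 1 (γ * mon p v)) ∈ solvable ω n₁ n₂ m₁ m₂ k := fun p hp γ =>
    xEmb_mon_mem_solvable hres₀ p.2.2 p.1 p.2.1 γ hp
  have hx₀ : ∀ p : Expo, p.deg = k → ∀ γ : ℂ,
      (fun v => xEmb 0 (γ * mon p v)) ∈ solvable ω n₁ n₂ m₁ m₂ k := fun p hp γ => by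
    -- Fields along `x₁` come for free: modulo fields along `x₂`, already treated, the operator
    -- sends `m` along `x₂` to `-m` along `x₁`.
    have h1 := homOp_mem_solvable (ω := ω) (n₁ := n₁) (n₂ := n₂) (m₁ := m₁) (m₂ := m₂)
      (isHomogPoly_emb_mon (xEmb 1) γ hp)
    have h2 : (fun v => xEmb 1 (γ * p.1 * mon (p.1 - 1, p.2.1 + 1, p.2.2) v)) ∈
        solvable ω n₁ n₂ m₁ m₂ k := by
      obtain ⟨a, b, c⟩ := p
      cases a with
      | zero =>
        simp only [Nat.cast_zero, mul_zero, zero_mul, map_zero]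
        exact zero_mem (solvable ω n₁ n₂ m₁ m₂ k)
      | succ a => exact hx (a, b + 1, c) (deg_shift.trans hp) _
    convert sub_mem (add_mem h2 (hx p hp (γ * p.freq ω))) h1 using 1
    funext v
    rw [Pi.sub_apply, Pi.add_apply, homOp, fderiv_smul_mon, linPart_xEmb_one, ← map_add]
    simp only [mul_add, mul_assoc, sub_sub_cancel]
  have e : R = (fun v => xEmb 0 ((Complex.ofRealCLM.toLinearMap ∘ₗ LinearMap.proj 0 ∘ₗ
        LinearMap.fst ℝ (Fin 2 → ℝ) (Fin 4 → ℂ)) (R v))) +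
      (fun v => xEmb 1 ((Complex.ofRealCLM.toLinearMap ∘ₗ LinearMap.proj 1 ∘ₗ
        LinearMap.fst ℝ (Fin 2 → ℝ) (Fin 4 → ℂ)) (R v))) +
      ∑ j : Fin 4, fun v => zEmb j (((LinearMap.proj j : (Fin 4 → ℂ) →ₗ[ℝ] ℂ) ∘ₗ
        LinearMap.snd ℝ (Fin 2 → ℝ) (Fin 4 → ℂ)) (R v)) := by
    funext v
    simp only [Pi.add_apply, Finset.sum_apply, xEmb_apply, zEmb_apply]
    refine Prod.ext (funext fun i => ?_) ?_
    · fin_cases i <;> simp [Prod.fst_sum]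
    · simp only [Prod.snd_add, Prod.snd_sum, add_zero, zero_add]
      exact (Finset.univ_sum_single (R v).2).symm
  rw [e]
  exact add_mem (add_mem (ext _ hx₀ _) (ext _ hx _)) (sum_mem fun j _ => ext _
    (fun p hp γ => zEmb_mon_mem_solvable hres j p.2.2 p.1 p.2.1 γ hp) _)

end Homological

/-! ### Averaging solutions over the involutions. -/

section Averaging

variable {ω : Fin 4 → ℝ} {n₁ n₂ m₁ m₂ k : ℕ} (b : Fin 5 → ℤˣ)

theorem psi_psi (v : E) : psi b (psi b v) = v := DFunLike.congr_fun (psi_mul_psi b) v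

theorem psi_psi_comm (c : Fin 5 → ℤˣ) (v : E) : psi b (psi c v) = psi c (psi b v) :=
  DFunLike.congr_fun (psi_comm b c) v

theorem linPart_psi (v : E) : linPart ω (psi b v) = -psi b (linPart ω v) := by
  refine Prod.ext (funext fun i => ?_) (funext fun i => ?_)
  · fin_cases i <;> simp [psi, linPart]
  · simp [psi, linPart]; ring

theorem psi_repS (s : S) (v : E) :
    psi b (repS n₁ n₂ m₁ m₂ s v) = repS n₁ n₂ m₁ m₂ s⁻¹ (psi b v) :=
  DFunLike.congr_fun (psi_mul_repS b n₁ n₂ m₁ m₂ s) v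

/-- Take `Φ' = (Φ + ψΦψ)/2` and `Y' = (Y - ψYψ)/2`. As `L` anticommutes with `ψ`, conjugation by `ψ`
reverses the sign of the homological operator, so the equation survives. `S`-equivariance survives
since `ψ` conjugates `s` to `s⁻¹`. The last clause holds because these involutions commute; it
allows averaging over one without losing the other. -/
theorem exists_averaged {R Φ Y : E → E} (hR : ∀ v, R (psi b v) = -psi b (R v))
    (hΦ : IsHomogPoly k Φ) (hY : IsHomogPoly k Y)
    (hs : ∀ s v, Y (repS n₁ n₂ m₁ m₂ s v) = repS n₁ n₂ m₁ m₂ s (Y v))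
    (h : ∀ v, Y v + homOp ω Φ v = R v) :
    ∃ Φ' Y', IsHomogPoly k Φ' ∧ IsHomogPoly k Y' ∧
      (∀ s v, Y' (repS n₁ n₂ m₁ m₂ s v) = repS n₁ n₂ m₁ m₂ s (Y' v)) ∧
      (∀ v, Y' v + homOp ω Φ' v = R v) ∧ (∀ v, Φ' (psi b v) = psi b (Φ' v)) ∧
      (∀ v, Y' (psi b v) = -psi b (Y' v)) ∧
      ∀ c, (∀ v, Φ (psi c v) = psi c (Φ v)) → (∀ v, Y (psi c v) = -psi c (Y v)) →
        (∀ v, Φ' (psi c v) = psi c (Φ' v)) ∧ ∀ v, Y' (psi c v) = -psi c (Y' v) := by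
  have hΦb : IsHomogPoly k (fun v => psi b (Φ (psi b v))) := (hΦ.comp_linear (psi b)).linear_comp _
  have hYb : IsHomogPoly k (fun v => (-1 : ℝ) • psi b (Y (psi b v))) :=
    ((hY.comp_linear (psi b)).linear_comp _).const_smul _
  have hop : ∀ v, homOp ω (fun v => psi b (Φ (psi b v))) v = -psi b (homOp ω Φ (psi b v)) :=
    fun v => by
    rw [homOp, homOp, fderiv_linear_comp (hΦ.comp_linear (psi b)).1.differentiable (psi b),
      fderiv_comp_linear hΦ.1.differentiable, linPart_psi, linPart_psi, map_sub, map_neg, map_neg]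
    abel
  refine ⟨(2⁻¹ : ℝ) • (Φ + fun v => psi b (Φ (psi b v))),
    (2⁻¹ : ℝ) • (Y + fun v => (-1 : ℝ) • psi b (Y (psi b v))), (hΦ.add hΦb).const_smul _,
    (hY.add hYb).const_smul _, fun s v => ?_, fun v => ?_, fun v => ?_, fun v => ?_,
    fun c hΦc hYc => ⟨fun v => ?_, fun v => ?_⟩⟩
  · simp only [Pi.smul_apply, Pi.add_apply, psi_repS, hs, inv_inv, map_smul, map_add]
  · have h2 : Y v + homOp ω Φ v +
        (-1 : ℝ) • psi b (Y (psi b v) + homOp ω Φ (psi b v)) = (2 : ℝ) • R v := by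
      rw [h, h, hR, map_neg, psi_psi, two_smul, neg_smul, one_smul, neg_neg]
    rw [homOp_smul (Φ := Φ + _) ω (hΦ.add hΦb).1, homOp_add ω hΦ.1 hΦb.1, hop]
    simp only [Pi.smul_apply, Pi.add_apply, ← smul_add]
    rw [inv_smul_eq_iff₀ two_ne_zero, ← h2, map_add, neg_smul, neg_smul, one_smul, one_smul]
    abel
  · simp only [Pi.smul_apply, Pi.add_apply, psi_psi, map_smul, map_add]
    rw [add_comm]
  · simp only [Pi.smul_apply, Pi.add_apply, psi_psi, map_smul, map_add, neg_smul, one_smul, map_neg,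
      ← smul_neg]
    congr 1
    abel
  · simp only [Pi.smul_apply, Pi.add_apply, psi_psi_comm b c, hΦc, map_smul, map_add]
  · simp only [Pi.smul_apply, Pi.add_apply, psi_psi_comm b c, hYc, map_smul, map_add, neg_smul,
      one_smul, map_neg, ← smul_neg]
    congr 1
    abel

theorem exists_reversible_solution (a : Fin 5 → ℤˣ) {R : E → E}
    (hRφ : ∀ v, R (phi v) = -phi (R v)) (hRψ : ∀ v, R (psi a v) = -psi a (R v))
    (hR : R ∈ solvable ω n₁ n₂ m₁ m₂ k) :
    ∃ Φ Y, IsHomogPoly k Φ ∧ (∀ v, Φ (phi v) = phi (Φ v)) ∧ (∀ v, Φ (psi a v) = psi a (Φ v)) ∧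
      IsHomogPoly k Y ∧ Y ∈ revEquivariants (rep a n₁ n₂ m₁ m₂) sigma ∧
      ∀ v, Y v + fderiv ℝ Φ v (linPart ω v) - linPart ω (Φ v) = R v := by
  obtain ⟨Φ, Y, hΦ, hY, hs, h⟩ := hR
  obtain ⟨Φ, Y, hΦ, hY, hs, h, hΦ₁, hY₁, -⟩ := exists_averaged 1 hRφ hΦ hY hs h
  obtain ⟨Φ, Y, hΦ, hY, hs, h, hΦ₂, hY₂, H⟩ := exists_averaged a hRψ hΦ hY hs h
  obtain ⟨hΦ₁, hY₁⟩ := H 1 hΦ₁ hY₁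
  refine ⟨Φ, Y, hΦ, hΦ₁, hΦ₂, hY, mem_revEquivariants_iff.2 ⟨hY.1, hs, hY₁, hY₂⟩, fun v => ?_⟩
  rw [← h, homOp, add_sub_assoc]

end Averaging

/-! ### Homogeneous coefficients in the module decomposition. -/

section Homogeneity

/-- Homogeneous mappings lying in a sum of submodules of homogeneous mappings of fixed degrees lie
in the summand of their degree. -/
theorem mem_of_mem_iSup_of_homogeneous {V : Type*} [AddCommGroup V] [Module ℝ V]
    (N : ℕ → Submodule ℝ (V → V)) (hN : ∀ i, ∀ g ∈ N i, ∀ (t : ℝ) v, g (t • v) = t ^ i • g v)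
    {k : ℕ} {g : V → V} (hg : g ∈ ⨆ i, N i) (hk : ∀ (t : ℝ) v, g (t • v) = t ^ k • g v) :
    g ∈ N k := by
  -- Pairing with linear functionals turns vector-valued maps into scalar functions, to which
  -- independence of characters applies.
  let T : (V → V) →ₗ[ℝ] (V × Module.Dual ℝ V → ℝ) :=
    { toFun := fun g x => x.2 (g x.1)
      map_add' := fun f g => by funext x; simp
      map_smul' := fun r g => by funext x; simp }
  have hT : Function.Injective T := fun f g h => by
    funext v
    exact Module.eval_apply_injective ℝ (LinearMap.ext fun l => congrFun h (v, l))
  have h1 : T g ∈ ⨆ i, (N i).map T := by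
    rw [← Submodule.map_iSup]
    exact Submodule.mem_map_of_mem hg
  have h2 : T g ∈ (N k).map T := by
    refine mem_of_mem_iSup_of_eigen (fun (t : ℝ) (x : V × Module.Dual ℝ V) => (t • x.1, x.2))
      (fun d : ℕ => (powMonoidHom d : ℝ →* ℝ)) powMonoidHom_injective _ ?_ h1 fun t x => ?_
    · rintro i _ ⟨f, hf, rfl⟩ t x
      simp [T, hN i f hf]
    · simp [T, hk]
  obtain ⟨g', hg', h⟩ := h2
  rwa [← hT h]

/-- Homogeneity of functions. -/
def IsHomogFun (d : ℕ) (f : E → ℝ) : Prop := ∀ (t : ℝ) v, f (t • v) = t ^ d * f v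

theorem IsHomogFun.mul {d e : ℕ} {f g : E → ℝ} (hf : IsHomogFun d f) (hg : IsHomogFun e g) :
    IsHomogFun (d + e) (f * g) := fun t v => by
  rw [Pi.mul_apply, hf, hg, Pi.mul_apply]; ring

theorem IsHomogFun.smul {d : ℕ} {f : E → ℝ} (hf : IsHomogFun d f) (r : ℝ) :
    IsHomogFun d (r • f) := fun t v => by
  rw [Pi.smul_apply, hf, Pi.smul_apply, smul_eq_mul, smul_eq_mul]; ring

theorem IsHomogFun.add {d : ℕ} {f g : E → ℝ} (hf : IsHomogFun d f) (hg : IsHomogFun d g) :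
    IsHomogFun d (f + g) := fun t v => by
  rw [Pi.add_apply, hf, hg, Pi.add_apply]; ring

variable {a : Fin 5 → ℤˣ} {n₁ n₂ m₁ m₂ : ℕ}

theorem exists_isHomogFun_u (i : ℕ) : ∃ d, IsHomogFun d (u n₁ n₂ m₁ m₂ i) := by
  have hn : ∀ j : Fin 4, ∃ d, IsHomogFun d (fun v => Complex.normSq (v.2 j)) := fun j =>
    ⟨2, fun t v => by simp [Complex.normSq_apply]; ring⟩
  have hr : ∀ (i j : Fin 4) (k l : ℕ) (t : ℝ) (v : E), (t • v).2 i ^ k * conj ((t • v).2 j) ^ l =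
      ((t ^ (k + l) : ℝ) : ℂ) * (v.2 i ^ k * conj (v.2 j) ^ l) := fun i j k l t v => by
    simp [mul_pow, pow_add]; ring
  unfold u
  split
  · exact ⟨1, fun t v => by simp⟩
  · exact hn 0
  · exact hn 1
  · exact ⟨n₂ + n₁, fun t v => by simp only [hr, Complex.re_ofReal_mul]⟩
  · exact ⟨n₂ + n₁, fun t v => by simp only [hr, Complex.im_ofReal_mul]⟩
  · exact hn 2
  · exact hn 3
  · exact ⟨m₂ + m₁, fun t v => by simp only [hr, Complex.re_ofReal_mul]⟩
  · exact ⟨m₂ + m₁, fun t v => by simp only [hr, Complex.im_ofReal_mul]⟩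
  · exact ⟨0, fun t v => by simp⟩

theorem exists_isHomogFun_mul {f g : E → ℝ} (hf : ∃ d, IsHomogFun d f)
    (hg : ∃ d, IsHomogFun d g) : ∃ d, IsHomogFun d (f * g) :=
  ⟨_, hf.choose_spec.mul hg.choose_spec⟩

theorem exists_isHomogFun_smul {f : E → ℝ} (hf : ∃ d, IsHomogFun d f) (r : ℝ) :
    ∃ d, IsHomogFun d (r • f) :=
  ⟨_, hf.choose_spec.smul r⟩

theorem exists_isHomogFun_w (i : ℕ) : ∃ d, IsHomogFun d (w n₁ n₂ m₁ m₂ i) := by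
  unfold w
  split <;> first
    | exact exists_isHomogFun_u _
    | exact exists_isHomogFun_mul (exists_isHomogFun_u _) (exists_isHomogFun_u _)
    | exact ⟨0, fun t v => by simp⟩

theorem exists_isHomogFun_of_mem_hilbertBasis {f : E → ℝ} (hf : f ∈ hilbertBasis a n₁ n₂ m₁ m₂) :
    ∃ d, IsHomogFun d f := by
  have hw : ∀ i, ∃ d, IsHomogFun d (w n₁ n₂ m₁ m₂ i) := exists_isHomogFun_w
  simp only [hilbertBasis, List.mem_cons, List.not_mem_nil, or_false, pow_two] at hf
  rcases hf with rfl | rfl | rfl | rfl | rfl | rfl | rfl | rfl | rfl | rfl | rfl | rfl | rfl | rfl |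
    rfl | rfl | rfl | rfl <;>
  first
    | with_reducible exact hw _
    | with_reducible exact exists_isHomogFun_smul (hw _) _
    | with_reducible exact exists_isHomogFun_smul (exists_isHomogFun_mul (hw _) (hw _)) _

theorem exists_isHomogFun_of_mem_genRows {r : ℝ × (E → ℝ) × List ℕ}
    (hr : r ∈ genRows a n₁ n₂ m₁ m₂) : ∃ d, IsHomogFun d r.2.1 := by
  have hw : ∀ i, ∃ d, IsHomogFun d (w n₁ n₂ m₁ m₂ i) := exists_isHomogFun_w
  have hu : ∀ i, ∃ d, IsHomogFun d (u n₁ n₂ m₁ m₂ i) := exists_isHomogFun_u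
  have h1 : ∃ d, IsHomogFun d 1 := ⟨0, fun t v => by simp⟩
  simp only [genRows, List.mem_cons, List.not_mem_nil, or_false] at hr
  rcases hr with rfl | rfl | rfl | rfl | rfl | rfl | rfl | rfl | rfl | rfl | rfl | rfl | rfl | rfl |
    rfl | rfl | rfl | rfl | rfl | rfl | rfl | rfl | rfl | rfl | rfl | rfl | rfl | rfl | rfl | rfl |
    rfl | rfl | rfl | rfl | rfl | rfl | rfl | rfl <;>
  first
    | with_reducible exact h1
    | with_reducible exact hw _
    | with_reducible exact hu _
    | with_reducible exact exists_isHomogFun_mul (hw _) (hu _)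

theorem exists_homogeneous_generator {J : E → E} (hJ : J ∈ generators a n₁ n₂ m₁ m₂) :
    ∃ d, IsHomogPoly d J := by
  obtain ⟨r, hr, hJ⟩ := List.mem_flatMap.1 hJ
  obtain ⟨k, hk, rfl⟩ := List.mem_map.1 hJ
  obtain ⟨s, t, hst, -⟩ := hasSigns_of_mem_genRows hr
  obtain ⟨d, hd⟩ := exists_isHomogFun_of_mem_genRows hr
  obtain ⟨e, he⟩ := exists_isHomogPoly_H (n₁ := n₁) (n₂ := n₂) (m₁ := m₁) (m₂ := m₂) k
  refine ⟨d + e, IsPolyMap.mul_smul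
    (mul_mem (Subalgebra.algebraMap_mem _ r.1) (sRing_le_polyFun hst.mem)) he.1, fun t v => ?_⟩
  simp only [hd t v, he.2 t v, smul_smul]
  congr 1
  ring

variable (a n₁ n₂ m₁ m₂) in
/-- The homogeneous elements of degree `d` of the Hilbert algebra. -/
noncomputable def homogPart (d : ℕ) : Submodule ℝ (E → ℝ) where
  carrier := {f | f ∈ hilbertAlgebra a n₁ n₂ m₁ m₂ ∧ IsHomogFun d f}
  zero_mem' := ⟨zero_mem _, fun t v => by simp⟩
  add_mem' hf hg := ⟨add_mem hf.1 hg.1, hf.2.add hg.2⟩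
  smul_mem' r _ hf := ⟨Subalgebra.smul_mem _ hf.1 r, hf.2.smul r⟩

/-- The algebra is generated by homogeneous functions, hence is the sum of its homogeneous parts. -/
theorem mem_iSup_homogPart {f : E → ℝ} (hf : f ∈ hilbertAlgebra a n₁ n₂ m₁ m₂) :
    f ∈ ⨆ d, homogPart a n₁ n₂ m₁ m₂ d := by
  induction hf using Algebra.adjoin_induction with
  | mem f hf =>
    obtain ⟨d, hd⟩ := exists_isHomogFun_of_mem_hilbertBasis hf
    exact Submodule.mem_iSup_of_mem d ⟨Algebra.subset_adjoin hf, hd⟩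
  | algebraMap r =>
    exact Submodule.mem_iSup_of_mem 0 ⟨Subalgebra.algebraMap_mem _ r, fun t v => by simp⟩
  | add f g _ _ hf hg => exact add_mem hf hg
  | mul f g hf' hg' hf hg =>
    clear hf' hg'
    induction hf using Submodule.iSup_induction' with
    | zero => rw [zero_mul]; exact zero_mem _
    | add f f' _ _ h h' => rw [add_mul]; exact add_mem h h'
    | mem i f hf =>
      induction hg using Submodule.iSup_induction' with
      | zero => rw [mul_zero]; exact zero_mem _
      | add g g' _ _ h h' => rw [mul_add]; exact add_mem h h'
      | mem j g hg =>
        exact Submodule.mem_iSup_of_mem (i + j) ⟨mul_mem hf.1 hg.1, hf.2.mul hg.2⟩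

variable (a n₁ n₂ m₁ m₂) in
/-- The combinations of the generators all of whose terms are homogeneous of degree `k`. -/
noncomputable def homogSpan (k : ℕ) : Submodule ℝ (E → E) where
  carrier := {g | ∃ q : Fin (generators a n₁ n₂ m₁ m₂).length → E → ℝ,
    (∀ ν, q ν ∈ hilbertAlgebra a n₁ n₂ m₁ m₂ ∧
      IsHomogPoly k (q ν • (generators a n₁ n₂ m₁ m₂).get ν)) ∧
    g = ∑ ν, q ν • (generators a n₁ n₂ m₁ m₂).get ν}
  zero_mem' := ⟨0, fun ν => ⟨zero_mem _, by rw [Pi.zero_apply, zero_smul]; exact .zero k⟩,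
    by simp⟩
  add_mem' := by
    rintro _ _ ⟨q, hq, rfl⟩ ⟨q', hq', rfl⟩
    refine ⟨q + q', fun ν => ⟨add_mem (hq ν).1 (hq' ν).1, ?_⟩, ?_⟩
    · rw [Pi.add_apply, add_smul]
      exact (hq ν).2.add (hq' ν).2
    · simp only [Pi.add_apply, add_smul, Finset.sum_add_distrib]
  smul_mem' := by
    rintro r _ ⟨q, hq, rfl⟩
    refine ⟨r • q, fun ν => ⟨Subalgebra.smul_mem _ (hq ν).1 r, ?_⟩, ?_⟩
    · rw [Pi.smul_apply, smul_assoc]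
      exact (hq ν).2.const_smul r
    · simp only [Pi.smul_apply, smul_assoc, Finset.smul_sum]

theorem genSpan_le_iSup_homogSpan :
    genSpan a n₁ n₂ m₁ m₂ ≤ ⨆ k, homogSpan a n₁ n₂ m₁ m₂ k := by
  refine Submodule.span_le.2 ?_
  rintro _ ⟨p, hp, J, hJ, rfl⟩
  obtain ⟨e, he⟩ := exists_homogeneous_generator hJ
  obtain ⟨ν, rfl⟩ := List.get_of_mem hJ
  have h := mem_iSup_homogPart hp
  change p • (generators a n₁ n₂ m₁ m₂).get ν ∈ ⨆ k, homogSpan a n₁ n₂ m₁ m₂ k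
  clear hp
  induction h using Submodule.iSup_induction' with
  | zero => rw [zero_smul]; exact zero_mem _
  | add f f' _ _ h h' => rw [add_smul]; exact add_mem h h'
  | mem d p hp =>
    refine Submodule.mem_iSup_of_mem (d + e) ⟨Pi.single ν p, fun μ => ?_, ?_⟩
    · by_cases h : μ = ν
      · subst h
        rw [Pi.single_eq_same]
        refine ⟨hp.1, IsPolyMap.mul_smul (sRing_le_polyFun (hilbertAlgebra_le_sRing hp.1)) he.1,
          fun t v => ?_⟩
        simp only [Pi.smul_apply', hp.2 t v, he.2 t v, smul_smul]
        congr 1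
        ring
      · rw [Pi.single_eq_of_ne h, zero_smul]
        exact ⟨zero_mem _, .zero _⟩
    · rw [Finset.sum_eq_single ν]
      · rw [Pi.single_eq_same]
      · intro μ _ h
        rw [Pi.single_eq_of_ne h, zero_smul]
      · exact fun h => absurd (Finset.mem_univ ν) h

/-- Decomposing the coefficients into homogeneous parts puts `g` in the sum of the `homogSpan`s.
Terms of distinct degrees are independent, so only the one of degree `k` is needed. -/
theorem mem_homogSpan {k : ℕ} {g : E → E} (hg : g ∈ genSpan a n₁ n₂ m₁ m₂)
    (hk : IsHomogPoly k g) : g ∈ homogSpan a n₁ n₂ m₁ m₂ k := by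
  refine mem_of_mem_iSup_of_homogeneous (homogSpan a n₁ n₂ m₁ m₂) ?_
    (genSpan_le_iSup_homogSpan hg) hk.2
  rintro i _ ⟨q, hq, rfl⟩
  have h : IsHomogPoly i (∑ ν, q ν • (generators a n₁ n₂ m₁ m₂).get ν) :=
    IsHomogPoly.sum (g := fun ν => q ν • (generators a n₁ n₂ m₁ m₂).get ν) Finset.univ
      fun ν _ => (hq ν).2
  exact h.2

end Homogeneity

/-! ### The normal form theorem. -/

section NormalForm

theorem exists_normalForm (n₁ n₂ m₁ m₂ : ℕ)
    (hn₁ : n₁ ≠ 0) (hn₂ : n₂ ≠ 0) (hm₁ : m₁ ≠ 0) (hm₂ : m₂ ≠ 0)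
    (hn : Nat.Coprime n₁ n₂) (hm : Nat.Coprime m₁ m₂)
    (ω : Fin 4 → ℝ) (hω₁₂ : n₁ * ω 1 = n₂ * ω 0) (hω₃₄ : m₁ * ω 3 = m₂ * ω 2)
    (hω : LinearIndependent ℚ ![ω 0, ω 2]) (a : Fin 5 → ℤˣ) (X : E → E)
    (hX : ContDiff ℝ (⊤ : ℕ∞) X) (hX0 : X 0 = 0)
    (hφ : ∀ x, X (phi x) = -phi (X x)) (hψ : ∀ x, X (psi a x) = -psi a (X x))
    (hL : HasFDerivAt X (LinearMap.toContinuousLinearMap (linPart ω)) 0) :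
    ∃ q : ℕ → Fin (generators a n₁ n₂ m₁ m₂).length → E → ℝ,
      (∀ k ν, q k ν ∈ hilbertAlgebra a n₁ n₂ m₁ m₂ ∧
        IsHomogPoly k (q k ν • (generators a n₁ n₂ m₁ m₂).get ν)) ∧
      FormallyConjugate X (formalField (linPart ω)
        (fun k => ∑ ν, q k ν • (generators a n₁ n₂ m₁ m₂).get ν)) := by
  -- Equality of frequencies implies equality of torus weights: this is the only place where the
  -- arithmetic of the `ωⱼ` enters the normal form.
  have hres : ∀ (p : Expo) (w : ℤ × ℤ), p.freq ω = -(Complex.I * ((w.1 * (ω 0 / n₁) +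
      w.2 * (ω 2 / m₁) : ℝ) : ℂ)) → p.weight n₁ n₂ m₁ m₂ = w := fun p w h => by
    rw [freq_eq_of_weight ω hn₁ hm₁ hω₁₂ hω₃₄, neg_inj, mul_right_inj' Complex.I_ne_zero] at h
    exact weight_eq_of_eq ω hn₁ hm₁ hω (Complex.ofReal_injective h)
  have h1 : (n₁ : ℝ) ≠ 0 := Nat.cast_ne_zero.2 hn₁
  have h3 : (m₁ : ℝ) ≠ 0 := Nat.cast_ne_zero.2 hm₁
  have hfreq : ∀ j, ω j = (zWeight n₁ n₂ m₁ m₂ j).1 * (ω 0 / n₁) +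
      (zWeight n₁ n₂ m₁ m₂ j).2 * (ω 2 / m₁) := fun j => by
    fin_cases j <;> simp [zWeight] <;> field_simp <;> linarith
  obtain ⟨g, hg, hconj⟩ := exists_formallyConjugate (τ := ![phi, psi a]) hX hX0 hL
    (Fin.forall_fin_two.2 ⟨hφ, hψ⟩) (Fin.forall_fin_two.2 ⟨linPart_psi 1, linPart_psi a⟩)
    (fun k => {Y | Y ∈ revEquivariants (rep a n₁ n₂ m₁ m₂) sigma ∧ IsHomogPoly k Y})
    (fun k Y hY => ⟨hY.2, Fin.forall_fin_two.2 (mem_revEquivariants_iff.1 hY.1).2.2⟩)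
    (fun k R hR hτ => by
      obtain ⟨hRφ, hRψ⟩ := Fin.forall_fin_two.1 hτ
      obtain ⟨Φ, Y, hΦ, hΦ₁, hΦ₂, hY, hYΓ, h⟩ := exists_reversible_solution a hRφ hRψ
        (mem_solvable_of_isHomogPoly (ω := ω) (n₁ := n₁) (n₂ := n₂) (m₁ := m₁) (m₂ := m₂)
          (fun p hp => hres p 0 (by simpa using hp))
          (fun p j hp => hres p _ (by rwa [← hfreq])) hR)
      exact ⟨Φ, Y, hΦ, Fin.forall_fin_two.2 ⟨hΦ₁, hΦ₂⟩, ⟨hYΓ, hY⟩, h⟩)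
  have key : ∀ k, g (k + 2) ∈ homogSpan a n₁ n₂ m₁ m₂ (k + 2) := fun k =>
    mem_homogSpan (mem_genSpan_of_mem_revEquivariants hn₁ hn₂ hm₁ hm₂ hn hm (hg k).1) (hg k).2
  choose q hq hgq using key
  -- The coefficients in degrees `0` and `1` are immaterial, since `formalField` reads `g` only from
  -- degree `2` on.
  refine ⟨fun | 0 => 0 | 1 => 0 | k + 2 => q k, fun k ν => ?_, ?_⟩
  · match k with
    | 0 | 1 =>
      refine ⟨zero_mem _, ?_⟩
      simp only [Pi.zero_apply, zero_smul]
      exact .zero _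
    | k + 2 => exact hq k ν
  · convert hconj using 1
    funext k
    match k with
    | 0 | 1 => rfl
    | k + 2 => exact (hgq k).symm

end NormalForm

end Bireversible

theorem mainTheorem4 (n₁ n₂ m₁ m₂ : ℕ)
    (hn₁ : n₁ ≠ 0) (hn₂ : n₂ ≠ 0) (hm₁ : m₁ ≠ 0) (hm₂ : m₂ ≠ 0)
    (hn : Nat.Coprime n₁ n₂) (hm : Nat.Coprime m₁ m₂)
    (ω : Fin 4 → ℝ) (hω₁₂ : n₁ * ω 1 = n₂ * ω 0) (hω₃₄ : m₁ * ω 3 = m₂ * ω 2)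
    (hω : LinearIndependent ℚ ![ω 0, ω 2])
    (a : Fin 5 → ℤˣ) :
    -- the Hilbert basis of the ring of invariants
    Algebra.adjoin ℝ {f | f ∈ Bireversible.hilbertBasis a n₁ n₂ m₁ m₂} =
      Bireversible.invariantRing (Bireversible.rep a n₁ n₂ m₁ m₂) ∧
    -- the generators of the module of reversible-equivariants
    Submodule.span (Bireversible.invariantRing (Bireversible.rep a n₁ n₂ m₁ m₂))
        {g | g ∈ Bireversible.generators a n₁ n₂ m₁ m₂} =
      Bireversible.revEquivariants (Bireversible.rep a n₁ n₂ m₁ m₂) Bireversible.sigma ∧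
    -- the formal normal form
    ∀ X : Bireversible.E → Bireversible.E,
      ContDiff ℝ (⊤ : ℕ∞) X → X 0 = 0 →
      (∀ x, X (Bireversible.phi x) = -Bireversible.phi (X x)) →
      (∀ x, X (Bireversible.psi a x) = -Bireversible.psi a (X x)) →
      HasFDerivAt X (LinearMap.toContinuousLinearMap (Bireversible.linPart ω)) 0 →
      ∃ q : ℕ → Fin (Bireversible.generators a n₁ n₂ m₁ m₂).length → Bireversible.E → ℝ,
        (∀ k ν, q k ν ∈ Algebra.adjoin ℝ {f | f ∈ Bireversible.hilbertBasis a n₁ n₂ m₁ m₂} ∧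
          Bireversible.IsHomogPoly k
            (q k ν • (Bireversible.generators a n₁ n₂ m₁ m₂).get ν)) ∧
        Bireversible.FormallyConjugate X
          (Bireversible.formalField (Bireversible.linPart ω)
            (fun k => ∑ ν, q k ν • (Bireversible.generators a n₁ n₂ m₁ m₂).get ν)) := by
  refine ⟨Bireversible.hilbertAlgebra_eq_invariantRing hn₂ hm₂ hn hm,
    Bireversible.span_generators_eq_revEquivariants hn₁ hn₂ hm₁ hm₂ hn hm,
    fun X hX hX0 hφ hψ hL => ?_⟩
  exact Bireversible.exists_normalForm n₁ n₂ m₁ m₂ hn₁ hn₂ hm₁ hm₂ hn hm ω hω₁₂ hω₃₄ hω a X hX hX0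
    hφ hψ hL
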